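/- **Counting and Inverse Counting Lemma I.** Let $\mathcal H$ be a real separable Hilbert space and let $\mathcal B$ be a real Banach space compactly embedded into $\mathcal H$ (i.e. $\mathcal B\subset\mathcal H$ through an injective compact linear map). Let $L^\infty([0,1]^2;\mathcal B)$ denote the space of kernels $\bm w:[0,1]^2\to\mathcal B$ that are Lebesgue measurable as maps into $\mathcal H$ and satisfy $\|\bm w\|_{L^\infty([0,1]^2;\mathcal B)}:=\operatorname{ess\,sup}\|\bm w(\xi,\zeta)\|_{\mathcal B}<\infty$. Let $\bm w_n$ ($n\in\mathbb N$) and $\bm w$ belong to $L^\infty([0,1]^2;\mathcal B)$, with $$\sup_n \|\bm w_n\|_{L^\infty([0,1]^2;\mathcal B)} < w_{\max} < \infty .$$ An oriented simple graph $F$ is a finite vertex set $\mathsf v(F)$ with a set of directed edges $\mathsf e(F)\subset \mathsf v(F)\times\mathsf v(F)$ such that $(i,j)\in\mathsf e(F)$ implies $(j,i)\notin\mathsf e(F)$ (so there are no loops). Its tensorized homomorphism density in $\bm w$ is $$\bm t(F,\bm w) := \int_{[0,1]^{\mathsf v(F)}} \bigotimes_{(i,j)\in\mathsf e(F)} \bm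 w(\xi_i,\xi_j)\prod_{i\in\mathsf v(F)}\mathrm d\xi_i \ \in\ \mathcal H^{\otimes \mathsf e(F)},$$ where $\mathcal H^{\otimes \mathsf e(F)}$ is the Hilbert tensor product of copies of $\mathcal H$ indexed by $\mathsf e(F)$. For $\bm u\in L^\infty([0,1]^2;\mathcal H)$ let $$\|\bm u\|_{\square;\mathcal H} := \sup_{\|\bm e\|_{\mathcal H}\le 1,\ S,T\subset[0,1]\text{ measurable}} \Big\langle \bm e, \int_{S\times T}\bm u(\xi,\zeta)\,\mathrm d\xi\,\mathrm d\zeta\Big\rangle_{\mathcal H},$$ and let $$\delta_{\square;\mathcal H}(\bm u_1,\bm u_2) := \inf_\Phi \|\bm u_1-\bm u_2(\Phi(\cdot),\Phi(\cdot))\|_{\square;\mathcal H},$$ where $\Phi$ ranges over all bijective measure-preserving maps $\Phi:[0,1]\to[0,1]$. Then the following two notions of convergence are equivalent: 1. for every oriented simple graph $F$, $\displaystyle\lim_{n\to\infty}\|\bm t(F,\bm w_n)-\bm t(F,\bm w)\|_{\mathcal H^{\otimes\mathsf e(F)}}=0$; 2. $\displaystyle\lim_{n\to\infty}\delta_{\square;\mathcal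 H}(\bm w_n,\bm w)=0$. -/

import Mathlib

open MeasureTheory Filter Topology
open scoped TensorProduct ENNReal NNReal

noncomputable section

/-! ### Hilbert tensor powers -/

/-- The algebraic tensor power of `H` over the finite index set `S`, carrying (below) the Hilbert
inner product, `⟪⨂ vᵢ, ⨂ uᵢ⟫ = ∏ ⟪vᵢ, uᵢ⟫` on elementary tensors. -/
def AlgTensorPower (S H : Type*) [NormedAddCommGroup H] [InnerProductSpace ℝ H] : Type _ :=
  ⨂[ℝ] _ : S, H

namespace AlgTensorPower

variable (S H : Type*) [NormedAddCommGroup H] [InnerProductSpace ℝ H]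

instance : AddCommGroup (AlgTensorPower S H) := inferInstanceAs (AddCommGroup (⨂[ℝ] _ : S, H))

instance : Module ℝ (AlgTensorPower S H) := inferInstanceAs (Module ℝ (⨂[ℝ] _ : S, H))

/-- The elementary tensor `⨂ vᵢ`. -/
def tprod : MultilinearMap ℝ (fun _ : S => H) (AlgTensorPower S H) :=
  PiTensorProduct.tprod ℝ


/-- The bilinear form determined by `⟪⨂ vᵢ, ⨂ uᵢ⟫ = ∏ ⟪vᵢ, uᵢ⟫`. -/
def form [Fintype S] : AlgTensorPower S H →ₗ[ℝ] AlgTensorPower S H →ₗ[ℝ] ℝ :=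
  (PiTensorProduct.dualDistrib (R := ℝ) (M := fun _ : S => H)) ∘ₗ
    (PiTensorProduct.map fun _ : S => innerₗ H)

theorem form_tprod [Fintype S] (v u : S → H) :
    form S H (tprod S H v) (tprod S H u) = ∏ i, inner ℝ (v i) (u i) := by
  change PiTensorProduct.dualDistrib (PiTensorProduct.map (fun _ : S => innerₗ H)
    (PiTensorProduct.tprod ℝ v)) (PiTensorProduct.tprod ℝ u) = _
  rw [PiTensorProduct.map_tprod, PiTensorProduct.dualDistrib_apply]
  simp

theorem exists_sum_tprod (x : AlgTensorPower S H) :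
    ∃ (n : ℕ) (c : Fin n → ℝ) (v : Fin n → S → H), x = ∑ k, c k • tprod S H (v k) := by
  refine PiTensorProduct.induction_on x ?_ ?_
  · intro r f
    exact ⟨1, fun _ => r, fun _ => f, by rw [Fin.sum_univ_one]; rfl⟩
  · rintro x y ⟨n, c, v, rfl⟩ ⟨m, d, u, rfl⟩
    refine ⟨n + m, Fin.append c d, Fin.append v u, ?_⟩
    rw [Fin.sum_univ_add]
    simp only [Fin.append_left, Fin.append_right]
    rfl

theorem form_symm [Fintype S] (x y : AlgTensorPower S H) : form S H x y = form S H y x := by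
  obtain ⟨n, c, v, rfl⟩ := exists_sum_tprod S H x
  obtain ⟨m, d, u, rfl⟩ := exists_sum_tprod S H y
  simp only [map_sum, map_smul, LinearMap.sum_apply, LinearMap.smul_apply, form_tprod,
    Finset.mul_sum, smul_eq_mul]
  rw [Finset.sum_comm]
  refine Finset.sum_congr rfl fun i _ => Finset.sum_congr rfl fun j _ => ?_
  simp only [real_inner_comm]
  ring

theorem posSemidef_prod_inner {n : ℕ} (v : Fin n → S → H) (T : Finset S) :
    (Matrix.of fun k l => ∏ i ∈ T, inner ℝ (v k i) (v l i) :
      Matrix (Fin n) (Fin n) ℝ).PosSemidef := by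
  classical
  induction T using Finset.induction_on with
  | empty =>
    have h := Matrix.posSemidef_gram ℝ (fun _ : Fin n => (1 : ℝ))
    have e : (Matrix.of fun k l => ∏ i ∈ (∅ : Finset S), inner ℝ (v k i) (v l i)) =
        Matrix.gram ℝ (fun _ : Fin n => (1 : ℝ)) := by
      ext k l
      simp [Matrix.gram]
    rw [e]
    exact h
  | insert a T ha ih =>
    have h := (Matrix.posSemidef_gram ℝ (fun k => v k a)).hadamard ih
    have e : (Matrix.of fun k l => ∏ i ∈ insert a T, inner ℝ (v k i) (v l i)) =
        (Matrix.gram ℝ (fun k => v k a)).hadamard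
          (Matrix.of fun k l => ∏ i ∈ T, inner ℝ (v k i) (v l i)) := by
      ext k l
      simp [Matrix.gram, Finset.prod_insert ha]
    rw [e]
    exact h

theorem form_self_nonneg [Fintype S] (x : AlgTensorPower S H) : 0 ≤ form S H x x := by
  obtain ⟨n, c, v, rfl⟩ := exists_sum_tprod S H x
  have h := (posSemidef_prod_inner S H v Finset.univ).dotProduct_mulVec_nonneg c
  have e : form S H (∑ k, c k • tprod S H (v k)) (∑ k, c k • tprod S H (v k)) =
      star c ⬝ᵥ (Matrix.of fun k l => ∏ i, inner ℝ (v k i) (v l i)).mulVec c := by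
    simp only [map_sum, map_smul, LinearMap.sum_apply, LinearMap.smul_apply, form_tprod,
      smul_eq_mul, dotProduct, Matrix.mulVec, Matrix.of_apply, Pi.star_apply, star_trivial]
    refine Finset.sum_congr rfl fun i _ => ?_
    congr 1
    refine Finset.sum_congr rfl fun j _ => ?_
    rw [mul_comm]
    congr 1
    exact Finset.prod_congr rfl fun s _ => real_inner_comm _ _
  rw [e]
  exact h

/-- The inner product of the tensor power. -/
@[reducible] def core [Fintype S] : PreInnerProductSpace.Core ℝ (AlgTensorPower S H) where
  inner x y := form S H x y
  conj_inner_symm x y := by simpa using form_symm S H y x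
  re_inner_nonneg x := by simpa using form_self_nonneg S H x
  add_left x y z := by simp
  smul_left x y r := by simp

instance [Fintype S] : SeminormedAddCommGroup (AlgTensorPower S H) :=
  InnerProductSpace.Core.toSeminormedAddCommGroup (c := core S H)

instance [Fintype S] : InnerProductSpace ℝ (AlgTensorPower S H) :=
  InnerProductSpace.ofCore (core S H)

theorem inner_def [Fintype S] (x y : AlgTensorPower S H) : inner ℝ x y = form S H x y := rfl

end AlgTensorPower

/-- The Hilbert tensor power `H^{⊗ S}`: the completion of the algebraic tensor power with respect
to its Hilbert inner product. -/
abbrev HilbertTensorPower (S H : Type*) [Fintype S] [NormedAddCommGroup H]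
    [InnerProductSpace ℝ H] : Type _ :=
  UniformSpace.Completion (AlgTensorPower S H)

/-- The elementary tensor `⨂ vᵢ` in the Hilbert tensor power. -/
def hilbertTprod {S H : Type*} [Fintype S] [NormedAddCommGroup H] [InnerProductSpace ℝ H]
    (v : S → H) : HilbertTensorPower S H :=
  ((AlgTensorPower.tprod S H v : AlgTensorPower S H) : UniformSpace.Completion (AlgTensorPower S H))

theorem inner_hilbertTprod {S H : Type*} [Fintype S] [NormedAddCommGroup H]
    [InnerProductSpace ℝ H] (v u : S → H) :
    inner ℝ (hilbertTprod v) (hilbertTprod u) = ∏ i, inner ℝ (v i) (u i) := by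
  rw [hilbertTprod, hilbertTprod, UniformSpace.Completion.inner_coe, AlgTensorPower.inner_def,
    AlgTensorPower.form_tprod]

/-! ### Oriented simple graphs and homomorphism densities -/

/-- An oriented simple graph with vertex set `V`: a set of directed edges such that an edge and its
reversal never both occur. In particular there are no loops. -/
structure OrientedSimpleGraph (V : Type*) where
  edges : Finset (V × V)
  oriented : ∀ i j : V, (i, j) ∈ edges → (j, i) ∉ edges

/-- The tensorized homomorphism density
`t(F, u) = ∫_{[0,1]^V} ⨂_{(i,j) ∈ e(F)} u(ξᵢ, ξⱼ) ∏ dξᵢ ∈ H^{⊗ e(F)}` (a Bochner integral). -/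
def homDensity {V H : Type*} [Fintype V] [NormedAddCommGroup H] [InnerProductSpace ℝ H]
    (F : OrientedSimpleGraph V) (u : unitInterval × unitInterval → H) :
    HilbertTensorPower F.edges H :=
  ∫ ξ : V → unitInterval, hilbertTprod fun e : F.edges => u (ξ e.1.1, ξ e.1.2)

/-! ### Cut norm and unlabeled cut distance -/

section Cut

variable {H : Type*} [NormedAddCommGroup H] [InnerProductSpace ℝ H]

/-- The cut norm `sup ⟪e, ∫_{S × T} u⟫` over `‖e‖ ≤ 1` and measurable `S, T ⊆ [0,1]`. -/
def cutNorm (u : unitInterval × unitInterval → H) : ℝ :=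
  sSup {r : ℝ | ∃ (e : H) (S T : Set unitInterval), ‖e‖ ≤ 1 ∧ MeasurableSet S ∧ MeasurableSet T ∧
    r = inner ℝ e (∫ z in S ×ˢ T, u z)}

/-- The unlabeled cut distance `inf_Φ ‖u₁ - u₂ ∘ (Φ × Φ)‖_□` over all bijective measure-preserving
maps `Φ` of `[0,1]`. -/
def cutDist (u₁ u₂ : unitInterval × unitInterval → H) : ℝ :=
  ⨅ Φ : {Φ : unitInterval → unitInterval //
      Function.Bijective Φ ∧ MeasurePreserving Φ volume volume},
    cutNorm fun z => u₁ z - u₂ (Φ.1 z.1, Φ.1 z.2)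

end Cut

/-! ### Kernels -/

/-- `w ∈ L^∞([0,1]²; B)`, where `ι : B → H` is the embedding: `w` is measurable as a map into `H`
and has essentially bounded `B`-norm. No strong measurability into `B` is required, so that
measure-valued kernels such as `(ξ, ζ) ↦ δ_{X(ζ)}` are included; every strongly measurable
essentially bounded `w` qualifies. -/
def IsLinftyKernel {B H : Type*} [NormedAddCommGroup B] [NormedSpace ℝ B] [NormedAddCommGroup H]
    [InnerProductSpace ℝ H] (ι : B →L[ℝ] H) (w : unitInterval × unitInterval → B) : Prop :=
  AEStronglyMeasurable (fun z => ι (w z)) volume ∧ eLpNorm w ∞ volume < ∞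

end

/-! Compactness of the embedding puts the values of all kernels, up to null sets, in one compact set
of `H`. On that set an orthogonal projection of finite rank `d` moves every point by little, so an
`H`-valued kernel is, up to a uniformly small error, a `d`-tuple of scalar kernels. The coordinates
of the tensorized density are mixed scalar densities in which each edge carries one of `d` colours.
Both implications thus reduce to `d`-tuples of scalar kernels, with one rearrangement serving all
coordinates at once. Step kernels on an equipartition reduce these to `d`-tuples of `N × N`
matrices, permutations of indices being realized by interval exchanges.

Counting (`abs_moment_sub_le`): the edges are replaced one at a time. With all vertices but the two
endpoints fixed, the remaining edges contribute a product `f a * g b`, against which a matrix of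
small cut norm integrates to little.

Inverse counting (`exists_perm_cutLE_of_moment`): `k` points are sampled, and each pair of them
receives a random direction, colour and sign, the sign being biased by the kernel. This random
configuration gives unbiased estimates of all kernels. Its law is a combination of densities of
oriented simple graphs, since every pair is used at most once (`configWeight_eq_sum`), so close
densities give close laws. By weak regularity each kernel is near one that factors through a bounded
partition. With positive probability the estimated matrices are close, in four-cycle norm, to this
kernel read along the sample, and the class frequencies are nearly right. The four-cycle norm serves
here because it controls the cut norm and its mean is computable: the four edges of a four-cycle on
distinct vertices are conditionally independent. Close laws share an outcome that is good for both
tuples (`exists_common_outcome`). After permutations both are then near a blow-up of the same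
matrices, hence near each other. -/

noncomputable section

/-! ### Finite kernels: cut bounds -/

section FiniteCut

variable {X Y : Type*} [Fintype X] [Fintype Y]

/-- The normalized cut norm of the matrix `D` is at most `ε`. -/
def CutLE (D : X → X → ℝ) (ε : ℝ) : Prop :=
  ∀ S T : Finset X, |∑ x ∈ S, ∑ y ∈ T, D x y| ≤ ε * (Fintype.card X : ℝ) ^ 2

theorem CutLE.mono {D : X → X → ℝ} {ε δ : ℝ} (h : CutLE D ε) (hεδ : ε ≤ δ) : CutLE D δ :=
  fun S T => (h S T).trans (by gcongr)

theorem CutLE.add {D D' : X → X → ℝ} {ε δ : ℝ} (h : CutLE D ε) (h' : CutLE D' δ) :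
    CutLE (fun x y => D x y + D' x y) (ε + δ) := by
  intro S T
  simp only [Finset.sum_add_distrib, add_mul]
  exact (abs_add_le _ _).trans (add_le_add (h S T) (h' S T))

theorem CutLE.neg {D : X → X → ℝ} {ε : ℝ} (h : CutLE D ε) :
    CutLE (fun x y => -D x y) ε := by
  intro S T
  simpa only [Finset.sum_neg_distrib, abs_neg] using h S T

theorem CutLE.sub {D D' : X → X → ℝ} {ε δ : ℝ} (h : CutLE D ε) (h' : CutLE D' δ) :
    CutLE (fun x y => D x y - D' x y) (ε + δ) := by
  simpa only [sub_eq_add_neg] using h.add h'.neg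

theorem CutLE.comp_perm {D : X → X → ℝ} {ε : ℝ} (h : CutLE D ε) (σ : Equiv.Perm X) :
    CutLE (fun x y => D (σ x) (σ y)) ε := by
  intro S T
  have := h (S.map σ.toEmbedding) (T.map σ.toEmbedding)
  simpa only [Finset.sum_map, Equiv.coe_toEmbedding] using this

theorem CutLE.of_sum_abs {D : X → X → ℝ} {ε : ℝ}
    (h : ∑ x, ∑ y, |D x y| ≤ ε * (Fintype.card X : ℝ) ^ 2) : CutLE D ε := by
  intro S T
  refine le_trans ?_ h
  calc |∑ x ∈ S, ∑ y ∈ T, D x y| ≤ ∑ x ∈ S, ∑ y ∈ T, |D x y| :=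
        (Finset.abs_sum_le_sum_abs _ _).trans
          (Finset.sum_le_sum fun _ _ => Finset.abs_sum_le_sum_abs _ _)
    _ ≤ ∑ x ∈ S, ∑ y, |D x y| := Finset.sum_le_sum fun _ _ =>
        Finset.sum_le_univ_sum_of_nonneg fun _ => abs_nonneg _
    _ ≤ ∑ x, ∑ y, |D x y| :=
        Finset.sum_le_univ_sum_of_nonneg fun _ => Finset.sum_nonneg fun _ _ => abs_nonneg _

/-- A linear functional on `[0,1]^X` is bounded in absolute value by its value at a vertex. -/
theorem exists_abs_sum_mul_le (c f : X → ℝ) (h0 : ∀ x, 0 ≤ f x) (h1 : ∀ x, f x ≤ 1) :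
    ∃ S : Finset X, |∑ x, f x * c x| ≤ |∑ x ∈ S, c x| := by
  classical
  have key : ∀ c : X → ℝ, ∑ x, f x * c x ≤ ∑ x ∈ Finset.univ.filter (fun x => 0 ≤ c x), c x := by
    intro c
    rw [Finset.sum_filter]
    refine Finset.sum_le_sum fun x _ => ?_
    split_ifs with h
    · nlinarith [h1 x]
    · nlinarith [h0 x]
  rcases le_total 0 (∑ x, f x * c x) with h | h
  · refine ⟨Finset.univ.filter (fun x => 0 ≤ c x), ?_⟩
    rw [abs_of_nonneg h]
    exact (key c).trans (le_abs_self _)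
  · refine ⟨Finset.univ.filter (fun x => 0 ≤ -c x), ?_⟩
    rw [abs_of_nonpos h]
    have := key (fun x => -c x)
    simp only [mul_neg, Finset.sum_neg_distrib] at this
    exact this.trans (neg_le_abs _)

/-- The sum is affine in `f` for fixed `g` and conversely, so its extremes over the two cubes occur
at indicators: `f` is rounded first, then `g`. -/
theorem CutLE.weighted {D : X → X → ℝ} {ε : ℝ} (h : CutLE D ε) (f g : X → ℝ)
    (hf0 : ∀ x, 0 ≤ f x) (hf1 : ∀ x, f x ≤ 1) (hg0 : ∀ x, 0 ≤ g x) (hg1 : ∀ x, g x ≤ 1) :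
    |∑ x, ∑ y, f x * g y * D x y| ≤ ε * (Fintype.card X : ℝ) ^ 2 := by
  obtain ⟨S, hS⟩ := exists_abs_sum_mul_le (fun x => ∑ y, g y * D x y) f hf0 hf1
  obtain ⟨T, hT⟩ := exists_abs_sum_mul_le (fun y => ∑ x ∈ S, D x y) g hg0 hg1
  calc |∑ x, ∑ y, f x * g y * D x y| = |∑ x, f x * ∑ y, g y * D x y| := by
        simp only [Finset.mul_sum, mul_assoc]
    _ ≤ |∑ x ∈ S, ∑ y, g y * D x y| := hS
    _ = |∑ y, g y * ∑ x ∈ S, D x y| := by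
        rw [Finset.sum_comm]; simp only [Finset.mul_sum]
    _ ≤ |∑ y ∈ T, ∑ x ∈ S, D x y| := hT
    _ ≤ ε * (Fintype.card X : ℝ) ^ 2 := by rw [Finset.sum_comm]; exact h S T

/-- Splitting `f / a` and `g / b` into positive and negative parts gives four sums with weights in
`[0,1]`, whence the factor 4. -/
theorem CutLE.bilinear {D : X → X → ℝ} {ε : ℝ} (h : CutLE D ε) (f g : X → ℝ) {a b : ℝ}
    (hf : ∀ x, |f x| ≤ a) (hg : ∀ x, |g x| ≤ b) (ha : 0 < a) (hb : 0 < b) :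
    |∑ x, ∑ y, f x * g y * D x y| ≤ 4 * a * b * ε * (Fintype.card X : ℝ) ^ 2 := by
  have e : ∀ t c : ℝ, 0 < c → t = c * (max (t / c) 0 - max (-t / c) 0) := by
    intro t c hc
    rw [neg_div]
    rcases le_total 0 (t / c) with h | h
    · rw [max_eq_left h, max_eq_right (by linarith)]; field_simp; ring
    · rw [max_eq_right h, max_eq_left (by linarith)]; field_simp; ring
  have b0 : ∀ t : ℝ, 0 ≤ max t 0 := fun t => le_max_right _ _
  have b1 : ∀ t c : ℝ, 0 < c → |t| ≤ c → max (t / c) 0 ≤ 1 := by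
    intro t c hc ht
    refine max_le ?_ zero_le_one
    rw [div_le_one hc]
    exact (le_abs_self _).trans ht
  have b2 : ∀ t c : ℝ, 0 < c → |t| ≤ c → max (-t / c) 0 ≤ 1 := by
    intro t c hc ht
    exact b1 _ _ hc (by rwa [abs_neg])
  have w1 := h.weighted (fun x => max (f x / a) 0) (fun x => max (g x / b) 0)
    (fun x => b0 _) (fun x => b1 _ _ ha (hf x)) (fun x => b0 _) (fun x => b1 _ _ hb (hg x))
  have w2 := h.weighted (fun x => max (f x / a) 0) (fun x => max (-g x / b) 0)
    (fun x => b0 _) (fun x => b1 _ _ ha (hf x)) (fun x => b0 _) (fun x => b2 _ _ hb (hg x))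
  have w3 := h.weighted (fun x => max (-f x / a) 0) (fun x => max (g x / b) 0)
    (fun x => b0 _) (fun x => b2 _ _ ha (hf x)) (fun x => b0 _) (fun x => b1 _ _ hb (hg x))
  have w4 := h.weighted (fun x => max (-f x / a) 0) (fun x => max (-g x / b) 0)
    (fun x => b0 _) (fun x => b2 _ _ ha (hf x)) (fun x => b0 _) (fun x => b2 _ _ hb (hg x))
  have split : ∑ x, ∑ y, f x * g y * D x y = a * b *
      ((∑ x, ∑ y, max (f x / a) 0 * max (g y / b) 0 * D x y)
        - (∑ x, ∑ y, max (f x / a) 0 * max (-g y / b) 0 * D x y)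
        - (∑ x, ∑ y, max (-f x / a) 0 * max (g y / b) 0 * D x y)
        + (∑ x, ∑ y, max (-f x / a) 0 * max (-g y / b) 0 * D x y)) := by
    simp only [← Finset.sum_sub_distrib, ← Finset.sum_add_distrib, Finset.mul_sum]
    refine Finset.sum_congr rfl fun x _ => Finset.sum_congr rfl fun y _ => ?_
    conv_lhs => rw [e (f x) a ha, e (g y) b hb]
    ring
  rw [split, abs_mul, abs_of_pos (mul_pos ha hb)]
  have : ∀ p q r s E : ℝ, |p| ≤ E → |q| ≤ E → |r| ≤ E → |s| ≤ E → |p - q - r + s| ≤ 4 * E := by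
    intro p q r s E hp hq hr hs
    rw [abs_le] at *
    constructor <;> linarith
  calc a * b * _ ≤ a * b * (4 * (ε * (Fintype.card X : ℝ) ^ 2)) :=
        mul_le_mul_of_nonneg_left (this _ _ _ _ _ w1 w2 w3 w4) (mul_pos ha hb).le
    _ = _ := by ring

/-! ### The four-cycle norm -/

/-- The (unnormalized) density of the oriented four-cycle `K_{2,2}`. -/
def fourCycle (D : X → X → ℝ) : ℝ :=
  ∑ x, ∑ x', ∑ y, ∑ y', D x y * D x y' * D x' y * D x' y'

theorem sq_sum_subset_le (S : Finset X) (f : X → ℝ) :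
    (∑ x ∈ S, f x) ^ 2 ≤ Fintype.card X * ∑ x, f x ^ 2 := by
  calc (∑ x ∈ S, f x) ^ 2 ≤ S.card * ∑ x ∈ S, f x ^ 2 := sq_sum_le_card_mul_sum_sq
    _ ≤ Fintype.card X * ∑ x, f x ^ 2 := by
        have := Finset.card_le_univ S
        have h2 : ∑ x ∈ S, f x ^ 2 ≤ ∑ x, f x ^ 2 :=
          Finset.sum_le_univ_sum_of_nonneg fun _ => sq_nonneg _
        have h3 : 0 ≤ ∑ x ∈ S, f x ^ 2 := Finset.sum_nonneg fun _ _ => sq_nonneg _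
        gcongr

/-- Cauchy–Schwarz twice: over `x ∈ S`, and then over pairs `(y, y')` in `T ×ˢ T`. Each time the
outer sum is enlarged to all indices, the terms being squares. -/
theorem pow_four_sum_le_fourCycle (D : X → X → ℝ) (S T : Finset X) :
    (∑ x ∈ S, ∑ y ∈ T, D x y) ^ 4 ≤ (Fintype.card X : ℝ) ^ 4 * fourCycle D := by
  have h1 : (∑ x ∈ S, ∑ y ∈ T, D x y) ^ 2 ≤ Fintype.card X * ∑ x, (∑ y ∈ T, D x y) ^ 2 :=
    sq_sum_subset_le S _
  have h2 : ∑ x, (∑ y ∈ T, D x y) ^ 2 = ∑ p ∈ T ×ˢ T, ∑ x, D x p.1 * D x p.2 := by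
    rw [Finset.sum_comm]
    refine Finset.sum_congr rfl fun x _ => ?_
    rw [sq, Finset.sum_mul_sum, Finset.sum_product]
  have h3 := sq_sum_subset_le (T ×ˢ T) (fun p : X × X => ∑ x, D x p.1 * D x p.2)
  have h4 : ∑ p : X × X, (∑ x, D x p.1 * D x p.2) ^ 2 = fourCycle D := by
    rw [Fintype.sum_prod_type]
    unfold fourCycle
    simp only [sq, Finset.sum_mul_sum]
    rw [Finset.sum_congr rfl fun y _ => Finset.sum_comm, Finset.sum_comm]
    refine Finset.sum_congr rfl fun x _ => ?_
    rw [Finset.sum_congr rfl fun y _ => Finset.sum_comm, Finset.sum_comm]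
    refine Finset.sum_congr rfl fun x' _ => Finset.sum_congr rfl fun y _ =>
      Finset.sum_congr rfl fun y' _ => by ring
  rw [h4, Fintype.card_prod] at h3
  have h0 : 0 ≤ ∑ x, (∑ y ∈ T, D x y) ^ 2 := Finset.sum_nonneg fun _ _ => sq_nonneg _
  calc (∑ x ∈ S, ∑ y ∈ T, D x y) ^ 4 = ((∑ x ∈ S, ∑ y ∈ T, D x y) ^ 2) ^ 2 := by ring
    _ ≤ (Fintype.card X * ∑ x, (∑ y ∈ T, D x y) ^ 2) ^ 2 := by gcongr
    _ = (Fintype.card X : ℝ) ^ 2 * (∑ x, (∑ y ∈ T, D x y) ^ 2) ^ 2 := by ring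
    _ ≤ (Fintype.card X : ℝ) ^ 2 * ((Fintype.card X * Fintype.card X : ℕ) * fourCycle D) := by
        rw [h2]; gcongr
    _ = _ := by push_cast; ring

/-- This is the preceding bound at `S = T = ∅`, divided by the power of the cardinality. -/
theorem fourCycle_nonneg (D : X → X → ℝ) : 0 ≤ fourCycle D := by
  rcases isEmpty_or_nonempty X with h | h
  · simp [fourCycle]
  · have := (pow_four_sum_le_fourCycle D ∅ ∅)
    have hX : (0 : ℝ) < (Fintype.card X : ℝ) ^ 4 := by positivity
    simp only [Finset.sum_empty] at this
    by_contra hneg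
    nlinarith

theorem CutLE.of_fourCycle {D : X → X → ℝ} {ε : ℝ} (hε : 0 ≤ ε)
    (h : fourCycle D ≤ ε ^ 4 * (Fintype.card X : ℝ) ^ 4) : CutLE D ε := by
  intro S T
  have h1 := pow_four_sum_le_fourCycle D S T
  refine le_of_pow_le_pow_left₀ (n := 4) (by norm_num) (by positivity) ?_
  calc |∑ x ∈ S, ∑ y ∈ T, D x y| ^ 4 = (∑ x ∈ S, ∑ y ∈ T, D x y) ^ 4 :=
        Even.pow_abs (by decide) _
    _ ≤ (Fintype.card X : ℝ) ^ 4 * (ε ^ 4 * (Fintype.card X : ℝ) ^ 4) :=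
        h1.trans (by gcongr)
    _ = _ := by ring

/-- For fixed `x'` and `y'` two of the other factors depend on `x` alone and on `y` alone, so the
inner sum is `D` tested against a product of bounded functions. -/
theorem CutLE.fourCycle_le {D : X → X → ℝ} {ε B : ℝ} (h : CutLE D ε) (hB : 0 < B)
    (hD : ∀ x y, |D x y| ≤ B) : fourCycle D ≤ 4 * B ^ 3 * ε * (Fintype.card X : ℝ) ^ 4 := by
  have e : fourCycle D = ∑ x', ∑ y', D x' y' * ∑ x, ∑ y, D x y' * D x' y * D x y := by
    unfold fourCycle
    rw [Finset.sum_comm]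
    refine Finset.sum_congr rfl fun x' _ => ?_
    simp only [Finset.mul_sum]
    rw [Finset.sum_comm' (t' := Finset.univ) (s' := fun _ => Finset.univ) (by simp)]
    rw [Finset.sum_comm]
    rw [Finset.sum_congr rfl fun x _ => Finset.sum_comm, Finset.sum_comm]
    refine Finset.sum_congr rfl fun y' _ => Finset.sum_congr rfl fun x _ =>
      Finset.sum_congr rfl fun y _ => by ring
  rw [e]
  have hb : ∀ x' y', D x' y' * ∑ x, ∑ y, D x y' * D x' y * D x y ≤
      B * (4 * B * B * ε * (Fintype.card X : ℝ) ^ 2) := by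
    intro x' y'
    refine (le_abs_self _).trans ?_
    rw [abs_mul]
    exact mul_le_mul (hD x' y') (h.bilinear (fun x => D x y') (fun y => D x' y)
      (fun x => hD x y') (fun y => hD x' y) hB hB) (abs_nonneg _) hB.le
  refine (Finset.sum_le_sum fun x' _ => Finset.sum_le_sum fun y' _ => hb x' y').trans ?_
  simp only [Finset.sum_const, Finset.card_univ, nsmul_eq_mul]
  apply le_of_eq
  ring

/-! ### Weak regularity -/

/-- Energy decrement: if the cut bound fails on `S × T`, subtracting `±ε` times the indicator of
this rectangle lowers the sum of squares by at least `ε ^ 2 * |X| ^ 2`. Hence `n` rectangles exhaust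
the energy allowed by the hypothesis. -/
theorem exists_cut_decomposition (ε : ℝ) (hε : 0 < ε) (n : ℕ) :
    ∀ D : X → X → ℝ, ∑ x, ∑ y, D x y ^ 2 ≤ n * ε ^ 2 * (Fintype.card X : ℝ) ^ 2 →
      ∃ (c : Fin n → ℝ) (S T : Fin n → Finset X), (∀ l, |c l| ≤ ε) ∧
        CutLE (fun x y => D x y - ∑ l, c l * ((S l : Set X).indicator 1 x *
          (T l : Set X).indicator 1 y)) ε := by
  classical
  induction n with
  | zero =>
    intro D hD
    refine ⟨0, fun _ => ∅, fun _ => ∅, fun l => l.elim0, ?_⟩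
    have h0 : ∀ x y, D x y = 0 := by
      have hD' : ∑ x, ∑ y, D x y ^ 2 = 0 := le_antisymm (by simpa using hD)
        (Finset.sum_nonneg fun _ _ => Finset.sum_nonneg fun _ _ => sq_nonneg _)
      rw [Finset.sum_eq_zero_iff_of_nonneg
        (fun _ _ => Finset.sum_nonneg fun _ _ => sq_nonneg _)] at hD'
      intro x y
      have := hD' x (Finset.mem_univ _)
      rw [Finset.sum_eq_zero_iff_of_nonneg (fun _ _ => sq_nonneg _)] at this
      exact pow_eq_zero_iff two_ne_zero |>.1 (this y (Finset.mem_univ _))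
    intro S T
    simp only [h0, Finset.univ_eq_empty, Finset.sum_empty, sub_zero, Finset.sum_const_zero,
      abs_zero]
    positivity
  | succ n ih =>
    intro D hD
    by_cases hcut : CutLE D ε
    · refine ⟨0, fun _ => ∅, fun _ => ∅, fun l => by simpa using hε.le, ?_⟩
      simpa using hcut
    · unfold CutLE at hcut
      push Not at hcut
      obtain ⟨S, T, hST⟩ := hcut
      obtain ⟨c, hc, hcs⟩ : ∃ c : ℝ, |c| = ε ∧
          c * ∑ x ∈ S, ∑ y ∈ T, D x y = ε * |∑ x ∈ S, ∑ y ∈ T, D x y| := by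
        rcases le_total 0 (∑ x ∈ S, ∑ y ∈ T, D x y) with h | h
        · exact ⟨ε, abs_of_pos hε, by rw [abs_of_nonneg h]⟩
        · exact ⟨-ε, by rw [abs_neg, abs_of_pos hε], by rw [abs_of_nonpos h]; ring⟩
      set N : ℝ := (Fintype.card X : ℝ)
      let D' : X → X → ℝ := fun x y =>
        D x y - c * ((S : Set X).indicator 1 x * (T : Set X).indicator 1 y)
      have hD' : ∑ x, ∑ y, D' x y ^ 2 ≤ n * ε ^ 2 * N ^ 2 := by
        have e1 : ∑ x, ∑ y, D' x y ^ 2 = ∑ x, ∑ y, D x y ^ 2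
            - 2 * (c * ∑ x ∈ S, ∑ y ∈ T, D x y) + c ^ 2 * (S.card * T.card) := by
          have a1 : ∑ x ∈ S, ∑ y ∈ T, D x y = ∑ x, ∑ y,
              ((S : Set X).indicator 1 x * (T : Set X).indicator 1 y) * D x y := by
            rw [← Finset.sum_subset (Finset.subset_univ S)]
            · refine Finset.sum_congr rfl fun x hx => ?_
              rw [← Finset.sum_subset (Finset.subset_univ T)]
              · exact Finset.sum_congr rfl fun y hy => by simp [hx, hy]
              · intro y _ hy; simp [hy]
            · intro x _ hx; simp [hx]
          have a2 : (S.card * T.card : ℝ) = ∑ x, ∑ y,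
              ((S : Set X).indicator 1 x * (T : Set X).indicator 1 y : ℝ) := by
            rw [← Finset.sum_mul_sum]
            simp [Set.indicator_apply, Finset.sum_ite_mem]
          rw [a1, a2]
          simp only [Finset.mul_sum, ← Finset.sum_sub_distrib, ← Finset.sum_add_distrib]
          refine Finset.sum_congr rfl fun x _ => Finset.sum_congr rfl fun y _ => ?_
          by_cases hx : x ∈ S <;> by_cases hy : y ∈ T <;> simp [D', hx, hy]
          ring
        have hS : (S.card : ℝ) ≤ N := Nat.cast_le.2 (Finset.card_le_univ S)
        have hT : (T.card : ℝ) ≤ N := Nat.cast_le.2 (Finset.card_le_univ T)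
        have hST' : (S.card * T.card : ℝ) ≤ N ^ 2 := by rw [sq]; gcongr
        have hc2 : c ^ 2 = ε ^ 2 := by rw [← sq_abs, hc]
        rw [e1, hcs, hc2]
        push_cast at hD
        nlinarith [mul_le_mul_of_nonneg_left hST' (sq_nonneg ε),
          mul_le_mul_of_nonneg_left hST.le hε.le]
      obtain ⟨c', S', T', hc', hcut'⟩ := ih D' hD'
      refine ⟨Fin.cons c c', Fin.cons S S', Fin.cons T T', ?_, ?_⟩
      · intro l
        refine Fin.cases ?_ (fun l => ?_) l
        · simpa using hc.le
        · simpa using hc' l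
      · convert hcut' using 3 with x y
        rw [Fin.sum_univ_succ]
        simp only [Fin.cons_zero, Fin.cons_succ, D']
        ring

/-- Weak regularity: a bounded matrix is close in cut norm to a matrix that factors through a
partition into boundedly many classes. -/
theorem exists_weak_regularity (M ε : ℝ) (hε : 0 < ε) : ∃ n : ℕ, ∀ (X : Type) [Fintype X]
    (D : X → X → ℝ), (∀ x y, |D x y| ≤ M) → ∃ (P : X → (Fin n → Bool × Bool))
      (g : (Fin n → Bool × Bool) → (Fin n → Bool × Bool) → ℝ), (∀ p q, |g p q| ≤ n * ε) ∧
        CutLE (fun x y => D x y - g (P x) (P y)) ε := by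
  classical
  obtain ⟨n, hn⟩ := exists_nat_ge (M ^ 2 / ε ^ 2)
  refine ⟨n, fun X _ D hD => ?_⟩
  have hsum : ∑ x, ∑ y, D x y ^ 2 ≤ n * ε ^ 2 * (Fintype.card X : ℝ) ^ 2 := by
    have hM : M ^ 2 ≤ n * ε ^ 2 := by rwa [div_le_iff₀ (by positivity)] at hn
    have : ∀ x y, D x y ^ 2 ≤ n * ε ^ 2 := fun x y =>
      le_trans (by rw [← sq_abs]; exact pow_le_pow_left₀ (abs_nonneg _) (hD x y) 2) hM
    refine (Finset.sum_le_sum fun x _ => Finset.sum_le_sum fun y _ => this x y).trans ?_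
    simp only [Finset.sum_const, Finset.card_univ, nsmul_eq_mul]
    apply le_of_eq; ring
  obtain ⟨c, S, T, hc, hcut⟩ := exists_cut_decomposition ε hε n D hsum
  -- The class of `x` records its membership in every `S l` and every `T l`; rows use the first bit,
  -- columns the second.
  refine ⟨fun x l => (decide (x ∈ S l), decide (x ∈ T l)),
    fun p q => ∑ l, c l * ((if (p l).1 then 1 else 0) * (if (q l).2 then 1 else 0)), ?_, ?_⟩
  · intro p q
    refine (Finset.abs_sum_le_sum_abs _ _).trans ?_
    calc _ ≤ ∑ _l : Fin n, ε := by
          refine Finset.sum_le_sum fun l _ => ?_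
          have := hc l
          split_ifs <;> simp [this, hε.le]
      _ = _ := by simp
  · convert hcut using 3 with x y
    simp [Set.indicator_apply]

/-! ### Matching two partitions by a permutation -/

/-- A permutation with fewest mismatches admits no improving transposition, so for mismatched points
`y`, `y'` the label `P (σ y')` is never the label `Q y`. Each label thus occurs among the mismatches
on one side only, and there its count is at most the difference of the class sizes. -/
theorem exists_perm_card_ne_le [DecidableEq X] [DecidableEq Y] (P Q : X → Y) :
    ∃ σ : Equiv.Perm X, ((Finset.univ.filter fun x => P (σ x) ≠ Q x).card : ℝ) ≤
      ∑ p, |((Finset.univ.filter fun x => P x = p).card : ℝ)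
        - (Finset.univ.filter fun x => Q x = p).card| := by
  obtain ⟨σ, -, hσ⟩ := Finset.exists_min_image (Finset.univ : Finset (Equiv.Perm X))
    (fun σ => (Finset.univ.filter fun x => P (σ x) ≠ Q x).card) ⟨1, Finset.mem_univ _⟩
  refine ⟨σ, ?_⟩
  set W := Finset.univ.filter fun x => P (σ x) ≠ Q x with hW
  have key : ∀ y ∈ W, ∀ y' ∈ W, P (σ y') ≠ Q y := by
    intro y hy y' hy' h
    -- If the label carried at `y'` were the one wanted at `y`, exchanging the two would repair `y`
    -- and break nothing, since `y'` was already mismatched.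
    have hle := hσ (σ * Equiv.swap y y') (Finset.mem_univ _)
    have hss : (Finset.univ.filter fun x => P ((σ * Equiv.swap y y') x) ≠ Q x) ⊂ W := by
      refine Finset.ssubset_iff_subset_ne.2 ⟨?_, ?_⟩
      · intro x hx
        have hx' : P (σ (Equiv.swap y y' x)) ≠ Q x := (Finset.mem_filter.1 hx).2
        by_cases hxy : x = y
        · rwa [hxy]
        by_cases hxy' : x = y'
        · rwa [hxy']
        rw [Equiv.swap_apply_of_ne_of_ne hxy hxy'] at hx'
        simpa [hW] using hx'
      · intro heq
        rw [← heq] at hy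
        have hy2 : P (σ (Equiv.swap y y' y)) ≠ Q y := (Finset.mem_filter.1 hy).2
        rw [Equiv.swap_apply_left] at hy2
        exact hy2 h
    exact absurd (Finset.card_lt_card hss) (not_lt.2 hle)
  have hcard : (W.card : ℝ) = ∑ p, ((W.filter fun x => Q x = p).card : ℝ) := by
    rw [Finset.card_eq_sum_card_fiberwise (f := Q) (t := Finset.univ) (by simp)]
    push_cast
    rfl
  rw [hcard]
  refine Finset.sum_le_sum fun p _ => ?_
  have e1 : (Finset.univ.filter fun x => P x = p).card =
      (Finset.univ.filter fun x => P (σ x) = p).card := by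
    refine (Finset.card_bij (fun x _ => σ x) ?_ ?_ ?_).symm
    · intro x hx; simpa using hx
    · intro x _ y _ h; exact σ.injective h
    · intro y hy
      exact ⟨σ.symm y, by simpa using hy, by simp⟩
  have e2 : ∀ R : X → Y, (Finset.univ.filter fun x => R x = p).card =
      (W.filter fun x => R x = p).card + (Wᶜ.filter fun x => R x = p).card := by
    intro R
    rw [← Finset.card_union_of_disjoint, ← Finset.filter_union, Finset.union_compl]
    exact Finset.disjoint_filter_filter disjoint_compl_right
  have e3 : (Wᶜ.filter fun x => P (σ x) = p) = (Wᶜ.filter fun x => Q x = p) := by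
    refine Finset.filter_congr fun x hx => ?_
    simp only [hW, Finset.compl_filter, not_not, Finset.mem_filter, Finset.mem_univ,
      true_and] at hx
    rw [hx]
  rw [e1, e2 (fun x => P (σ x)), e2 Q, e3]
  push_cast
  rw [add_sub_add_right_eq_sub]
  by_cases hp : ∃ y ∈ W, Q y = p
  · obtain ⟨y, hy, hyp⟩ := hp
    have : (W.filter fun x => P (σ x) = p) = ∅ := by
      rw [Finset.filter_eq_empty_iff]
      intro y' hy' h
      exact key y hy y' hy' (h.trans hyp.symm)
    rw [this]
    simp
  · have : (W.filter fun x => Q x = p) = ∅ := by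
      rw [Finset.filter_eq_empty_iff]
      intro y' hy' h
      exact hp ⟨y', hy', h⟩
    rw [this]
    simp

end FiniteCut

/-! ### Averaging over a partition, and regularity with a bounded approximant. -/

section Averaging

variable {X Y : Type*} [Fintype X] [DecidableEq Y]

/-- The averaging kernel of the partition of `X` into the fibres of `P`. -/
def fibreKernel (P : X → Y) (x x' : X) : ℝ :=
  if P x' = P x then ((Finset.univ.filter fun z => P z = P x).card : ℝ)⁻¹ else 0

theorem fibreKernel_nonneg (P : X → Y) (x x' : X) : 0 ≤ fibreKernel P x x' := by
  unfold fibreKernel; split_ifs <;> positivity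

theorem fibreKernel_symm (P : X → Y) (x x' : X) : fibreKernel P x x' = fibreKernel P x' x := by
  unfold fibreKernel
  by_cases h : P x' = P x
  · simp [h]
  · rw [if_neg h, if_neg (Ne.symm h)]

theorem sum_fibreKernel_mul (P : X → Y) (x : X) (g : Y → ℝ) :
    ∑ x', fibreKernel P x x' * g (P x') = g (P x) := by
  have h : ∀ x', fibreKernel P x x' * g (P x') = if P x' = P x then
      ((Finset.univ.filter fun z => P z = P x).card : ℝ)⁻¹ * g (P x) else 0 := by
    intro x'
    unfold fibreKernel
    split_ifs with h
    · rw [h]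
    · simp
  simp only [h]
  rw [← Finset.sum_filter, Finset.sum_const, nsmul_eq_mul, ← mul_assoc, mul_inv_cancel₀, one_mul]
  exact Nat.cast_ne_zero.2 (Finset.card_ne_zero.2 ⟨x, by simp⟩)

theorem sum_fibreKernel (P : X → Y) (x : X) : ∑ x', fibreKernel P x x' = 1 := by
  simpa using sum_fibreKernel_mul P x fun _ => 1

/-- The average of `D` over the cells of the partition into fibres of `P`. -/
def fibreAverage (P : X → Y) (D : X → X → ℝ) (x y : X) : ℝ :=
  ∑ x', ∑ y', fibreKernel P x x' * fibreKernel P y y' * D x' y'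

/-- The averaging kernel is doubly stochastic, so averaging replaces the indicators of `S` and `T`
by weights in `[0,1]`. -/
theorem CutLE.fibreAverage {D : X → X → ℝ} {ε : ℝ} (h : CutLE D ε) (P : X → Y) :
    CutLE (fibreAverage P D) ε := by
  intro S T
  have e : ∑ x ∈ S, ∑ y ∈ T, _root_.fibreAverage P D x y = ∑ x', ∑ y',
      (∑ x ∈ S, fibreKernel P x x') * (∑ y ∈ T, fibreKernel P y y') * D x' y' := by
    unfold _root_.fibreAverage
    simp only [Finset.sum_mul]
    rw [Finset.sum_congr rfl fun x _ => Finset.sum_comm, Finset.sum_comm]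
    refine Finset.sum_congr rfl fun x' _ => ?_
    rw [Finset.sum_congr rfl fun x _ => Finset.sum_comm, Finset.sum_comm]
    refine Finset.sum_congr rfl fun y' _ => Finset.sum_congr rfl fun x _ => ?_
    rw [Finset.mul_sum, Finset.sum_mul]
  have w : ∀ (S : Finset X) (x' : X), ∑ x ∈ S, fibreKernel P x x' ≤ 1 := by
    intro S x'
    calc ∑ x ∈ S, fibreKernel P x x' ≤ ∑ x, fibreKernel P x x' :=
          Finset.sum_le_univ_sum_of_nonneg fun _ => fibreKernel_nonneg _ _ _
      _ = 1 := by
          rw [← sum_fibreKernel P x']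
          exact Finset.sum_congr rfl fun _ _ => fibreKernel_symm _ _ _
  have w0 : ∀ (S : Finset X) (x' : X), 0 ≤ ∑ x ∈ S, fibreKernel P x x' := fun S x' =>
    Finset.sum_nonneg fun _ _ => fibreKernel_nonneg _ _ _
  rw [e]
  exact h.weighted _ _ (w0 S) (w S) (w0 T) (w T)

/-- Weak regularity with a bounded approximant: a bounded matrix is close in cut norm to a matrix
with the same bound that factors through a partition into boundedly many classes. -/
theorem exists_weak_regularity_bounded (M ε : ℝ) (hM : 0 ≤ M) (hε : 0 < ε) :
    ∃ n : ℕ, ∀ (X : Type) [Fintype X]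
    (D : X → X → ℝ), (∀ x y, |D x y| ≤ M) → ∃ (P : X → (Fin n → Bool × Bool))
      (g : (Fin n → Bool × Bool) → (Fin n → Bool × Bool) → ℝ), (∀ p q, |g p q| ≤ M) ∧
        CutLE (fun x y => D x y - g (P x) (P y)) ε := by
  classical
  obtain ⟨n, hn⟩ := exists_weak_regularity M (ε / 2) (half_pos hε)
  refine ⟨n, fun X _ D hD => ?_⟩
  obtain ⟨P, g, -, hcut⟩ := hn X D hD
  have hav : ∀ x y, |fibreAverage P D x y| ≤ M := by
    intro x y
    calc |fibreAverage P D x y| ≤ ∑ x', ∑ y', fibreKernel P x x' * fibreKernel P y y' * M := by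
          refine (Finset.abs_sum_le_sum_abs _ _).trans (Finset.sum_le_sum fun x' _ => ?_)
          refine (Finset.abs_sum_le_sum_abs _ _).trans (Finset.sum_le_sum fun y' _ => ?_)
          rw [abs_mul, abs_of_nonneg (mul_nonneg (fibreKernel_nonneg _ _ _)
            (fibreKernel_nonneg _ _ _))]
          exact mul_le_mul_of_nonneg_left (hD _ _) (mul_nonneg (fibreKernel_nonneg _ _ _)
            (fibreKernel_nonneg _ _ _))
      _ = M := by
          simp only [← Finset.sum_mul, ← Finset.mul_sum, sum_fibreKernel, mul_one, one_mul]
  have hfac : ∀ x y x₁ y₁, P x = P x₁ → P y = P y₁ →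
      fibreAverage P D x y = fibreAverage P D x₁ y₁ := by
    intro x y x₁ y₁ hx hy
    simp only [fibreAverage, fibreKernel, hx, hy]
  -- The average is constant on cells, so any representatives will do; the value 0 is used only for
  -- cells that are empty.
  refine ⟨P, fun p q => if h : (∃ x, P x = p) ∧ ∃ y, P y = q then
    fibreAverage P D h.1.choose h.2.choose else 0, ?_, ?_⟩
  · intro p q
    dsimp only
    split_ifs with h
    · exact hav _ _
    · simpa using hM
  · have e : ∀ x y, (if h : (∃ x', P x' = P x) ∧ ∃ y', P y' = P y then
        fibreAverage P D h.1.choose h.2.choose else 0) = fibreAverage P D x y := by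
      intro x y
      have h : (∃ x', P x' = P x) ∧ ∃ y', P y' = P y := ⟨⟨x, rfl⟩, y, rfl⟩
      rw [dif_pos h]
      exact hfac _ _ _ _ h.1.choose_spec h.2.choose_spec
    simp only [e]
    have e2 : ∀ x y, fibreAverage P (fun x y => D x y - g (P x) (P y)) x y =
        fibreAverage P D x y - g (P x) (P y) := by
      intro x y
      simp only [fibreAverage, mul_sub, Finset.sum_sub_distrib]
      congr 1
      simp only [mul_assoc, ← Finset.mul_sum]
      rw [Finset.sum_congr rfl fun x' _ => by rw [sum_fibreKernel_mul P y (fun q => g (P x') q)]]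
      exact sum_fibreKernel_mul P x (fun p => g p (P y))
    -- Averaging fixes kernels that factor through `P`, so `D` minus its average is `D - g` minus
    -- the average of `D - g`, costing `ε / 2` twice.
    have := hcut.sub (hcut.fibreAverage P)
    simp only [e2] at this
    rw [add_halves] at this
    convert this using 3 with x y
    ring

end Averaging

/-! ### Resampling -/

section Resample

open Finset
open scoped BigOperators

variable {I X : Type*} [Fintype I] [DecidableEq I] [Fintype X]

/-- Exchanging the coordinate `x i` with the fresh variable `a` is an involution of `(I → X) × X`.
-/
theorem expect_update (h : (I → X) → ℝ) (i : I) :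
    𝔼 x, 𝔼 a, h (Function.update x i a) = 𝔼 x, h x := by
  rcases isEmpty_or_nonempty X with hX | hX
  · have : IsEmpty (I → X) := ⟨fun x => hX.elim (x i)⟩
    simp [Finset.univ_eq_empty]
  let e : (I → X) × X ≃ (I → X) × X :=
    { toFun := fun p => (Function.update p.1 i p.2, p.1 i)
      invFun := fun p => (Function.update p.1 i p.2, p.1 i)
      left_inv := fun p => by simp
      right_inv := fun p => by simp }
  have h1 : 𝔼 x, 𝔼 a, h (Function.update x i a) =
      𝔼 p : (I → X) × X, h (Function.update p.1 i p.2) := by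
    rw [← Finset.univ_product_univ, Finset.expect_product]
  have h2 : 𝔼 p : (I → X) × X, h p.1 = 𝔼 x, h x := by
    rw [← Finset.univ_product_univ, Finset.expect_product]
    simp
  rw [h1, ← h2]
  exact Fintype.expect_equiv e _ _ fun p => rfl

theorem expect_pair (h : X → X → ℝ) {i j : I} (hij : i ≠ j) :
    𝔼 x : I → X, h (x i) (x j) = 𝔼 a, 𝔼 b, h a b := by
  rcases isEmpty_or_nonempty X with hX | hX
  · have : IsEmpty (I → X) := ⟨fun x => hX.elim (x i)⟩
    simp [Finset.univ_eq_empty]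
  rw [← expect_update _ i]
  rw [← expect_update _ j]
  simp only [Function.update_self, Function.update_of_ne hij.symm,
    Fintype.expect_const]
  rw [Finset.expect_comm]

/-- Distinct coordinates of a uniform sample are independent: `i` and `i'` are resampled in turn,
and `expect_pair` does the other two. -/
theorem expect_four (h : X → X → X → X → ℝ) {i i' j j' : I} (h1 : i ≠ i') (h2 : i ≠ j)
    (h3 : i ≠ j') (h4 : i' ≠ j) (h5 : i' ≠ j') (h6 : j ≠ j') :
    𝔼 x : I → X, h (x i) (x i') (x j) (x j') = 𝔼 a, 𝔼 a', 𝔼 b, 𝔼 b', h a a' b b' := by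
  rcases isEmpty_or_nonempty X with hX | hX
  · have : IsEmpty (I → X) := ⟨fun x => hX.elim (x i)⟩
    simp [Finset.univ_eq_empty]
  rw [← expect_update _ i]
  simp only [Function.update_self, Function.update_of_ne h1.symm, Function.update_of_ne h2.symm,
    Function.update_of_ne h3.symm]
  rw [Finset.expect_comm]
  refine Finset.expect_congr rfl fun a _ => ?_
  rw [← expect_update _ i']
  simp only [Function.update_self, Function.update_of_ne h4.symm, Function.update_of_ne h5.symm]
  rw [Finset.expect_comm]
  refine Finset.expect_congr rfl fun a' _ => ?_
  exact expect_pair (h a a') h6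

/-- The second moment of a sum of independent centred bounded variables. -/
theorem expect_sq_sum_le [Nonempty X] (f : X → ℝ) (hf : ∀ x, |f x| ≤ 1) (h0 : ∑ x, f x = 0) :
    𝔼 x : I → X, (∑ i, f (x i)) ^ 2 ≤ Fintype.card I := by
  have e : ∀ x : I → X, (∑ i, f (x i)) ^ 2 = ∑ i, ∑ j, f (x i) * f (x j) := by
    intro x; rw [sq, Finset.sum_mul_sum]
  simp only [e]
  rw [Finset.expect_sum_comm]
  have : ∀ i, 𝔼 x : I → X, ∑ j, f (x i) * f (x j) ≤ 1 := by
    intro i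
    rw [Finset.expect_sum_comm, Finset.sum_eq_single i]
    · calc 𝔼 x : I → X, f (x i) * f (x i) ≤ 𝔼 _x : I → X, (1 : ℝ) :=
            Finset.expect_le_expect fun x _ => by
              nlinarith [abs_mul_abs_self (f (x i)), hf (x i), abs_nonneg (f (x i))]
        _ = 1 := Fintype.expect_const _
    -- Off-diagonal terms vanish, since `f` has mean zero and distinct coordinates are independent.
    · intro j _ hj
      rw [expect_pair (fun a b => f a * f b) hj.symm]
      refine Finset.expect_eq_zero fun a _ => ?_
      rw [← Finset.mul_expect, Fintype.expect_eq_sum_div_card, h0]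
      simp
    · simp
  refine (Finset.sum_le_sum fun i _ => this i).trans ?_
  simp

end Resample

/-! ### Product weights -/

/-- Independence under a product law: by injectivity each coordinate meets at most one factor `g j`,
and the coordinates that meet none sum to 1. -/
theorem sum_prod_mul_prod_comp {E Ω J : Type*} [Fintype E] [DecidableEq E] [Fintype Ω] [Fintype J]
    (p : E → Ω → ℝ) (hp : ∀ e, ∑ s, p e s = 1) (e : J → E) (he : Function.Injective e)
    (g : J → Ω → ℝ) :
    ∑ ω : E → Ω, (∏ a, p a (ω a)) * ∏ j, g j (ω (e j)) = ∏ j, ∑ s, p (e j) s * g j s := by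
  classical
  have h1 : ∀ ω : E → Ω, (∏ a, p a (ω a)) * ∏ j, g j (ω (e j)) =
      ∏ a, (p a (ω a) * ∏ j with e j = a, g j (ω a)) := by
    intro ω
    rw [Finset.prod_mul_distrib]
    congr 1
    rw [← Finset.prod_fiberwise Finset.univ e]
    refine Finset.prod_congr rfl fun a _ => Finset.prod_congr rfl fun j hj => ?_
    rw [(Finset.mem_filter.1 hj).2]
  simp only [h1]
  have h2 := (Finset.prod_univ_sum (fun _ : E => (Finset.univ : Finset Ω))
    (fun a s => p a s * ∏ j with e j = a, g j s)).symm
  rw [Fintype.piFinset_univ] at h2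
  rw [h2, ← Finset.prod_subset (Finset.subset_univ (Finset.univ.image e))]
  · rw [Finset.prod_image fun x _ y _ h => he h]
    refine Finset.prod_congr rfl fun j _ => Finset.sum_congr rfl fun s _ => ?_
    congr 1
    have : (Finset.univ.filter fun j' => e j' = e j) = {j} := by
      ext j'; simp [he.eq_iff]
    rw [this, Finset.prod_singleton]
  · intro a _ ha
    have : (Finset.univ.filter fun j' => e j' = a) = ∅ := by
      rw [Finset.filter_eq_empty_iff]
      intro j _ h
      exact ha (Finset.mem_image.2 ⟨j, Finset.mem_univ _, h⟩)
    simp [this, hp]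

/-! ### Random colourings sampled from a tuple of kernels -/

section Sampling

open Finset
open scoped BigOperators

variable {X : Type*} {d k : ℕ}

/-- The value `±1` of a Boolean. -/
def boolSign (b : Bool) : ℝ := if b then 1 else -1

theorem abs_boolSign (b : Bool) : |boolSign b| = 1 := by cases b <;> simp [boolSign]

/-- The kernel `U c` read along an edge of direction `b`. -/
def directed (U : Fin d → X → X → ℝ) (b : Bool) (c : Fin d) (x y : X) : ℝ :=
  if b then U c x y else U c y x

/-- The probability that the pair `(x, y)` receives the direction, colour and sign `s`. -/
def stateWeight (M : ℝ) (U : Fin d → X → X → ℝ) (x y : X) (s : Bool × Fin d × Bool) : ℝ :=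
  (1 + boolSign s.2.2 * directed U s.1 s.2.1 x y / M) / (4 * d)

/-- The law of the state of the pair `e` given the sample `x`: only increasing pairs matter. -/
def pairWeight (M : ℝ) (U : Fin d → X → X → ℝ) (x : Fin k → X) (e : Fin k × Fin k)
    (s : Bool × Fin d × Bool) : ℝ :=
  if e.1 < e.2 then stateWeight M U (x e.1) (x e.2) s else 1 / (4 * d)

/-- The law of the whole configuration given the sample `x`. -/
def configWeight (M : ℝ) (U : Fin d → X → X → ℝ) (x : Fin k → X)
    (ω : Fin k × Fin k → Bool × Fin d × Bool) : ℝ :=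
  ∏ e, pairWeight M U x e (ω e)

/-- The unbiased estimator of `U c` along direction `b` from the state of a pair. -/
def estimator (M : ℝ) (c : Fin d) (b : Bool) (s : Bool × Fin d × Bool) : ℝ :=
  if s.1 = b ∧ s.2.1 = c then 2 * d * M * boolSign s.2.2 else 0

/-- The estimated matrix of colour `c`. -/
def sampleMatrix (M : ℝ) (ω : Fin k × Fin k → Bool × Fin d × Bool) (c : Fin d)
    (i j : Fin k) : ℝ :=
  if i < j then estimator M c true (ω (i, j)) else estimator M c false (ω (j, i))

variable {M : ℝ} {U : Fin d → X → X → ℝ}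

theorem abs_directed_le (hU : ∀ c x y, |U c x y| ≤ M) (b : Bool) (c : Fin d) (x y : X) :
    |directed U b c x y| ≤ M := by
  unfold directed; split_ifs <;> exact hU _ _ _

theorem pairWeight_nonneg (hM : 0 < M) (hU : ∀ c x y, |U c x y| ≤ M) (x : Fin k → X)
    (e : Fin k × Fin k) (s : Bool × Fin d × Bool) : 0 ≤ pairWeight M U x e s := by
  unfold pairWeight stateWeight
  split_ifs
  · refine div_nonneg ?_ (by positivity)
    have h : |boolSign s.2.2 * directed U s.1 s.2.1 (x e.1) (x e.2) / M| ≤ 1 := by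
      rw [abs_div, abs_mul, abs_boolSign, one_mul, abs_of_pos hM, div_le_one hM]
      exact abs_directed_le hU _ _ _ _
    linarith [(abs_le.1 h).1]
  · positivity

theorem sum_pairWeight (hd : 0 < d) (x : Fin k → X) (e : Fin k × Fin k) :
    ∑ s, pairWeight M U x e s = 1 := by
  have hd' : (d : ℝ) ≠ 0 := by positivity
  unfold pairWeight stateWeight
  split_ifs
  · simp only [Fintype.sum_prod_type, Fintype.sum_bool, boolSign, if_true, Bool.false_eq_true,
      if_false]
    rw [← Finset.sum_add_distrib, Finset.sum_congr rfl fun c _ => show _ = (1 / d : ℝ) by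
      field_simp; ring]
    simp [hd']
  · simp only [Finset.sum_const, Finset.card_univ, Fintype.card_prod, Fintype.card_bool,
      Fintype.card_fin, nsmul_eq_mul]
    push_cast
    field_simp
    norm_num

theorem configWeight_nonneg (hM : 0 < M) (hU : ∀ c x y, |U c x y| ≤ M) (x : Fin k → X)
    (ω : Fin k × Fin k → Bool × Fin d × Bool) : 0 ≤ configWeight M U x ω :=
  Finset.prod_nonneg fun _ _ => pairWeight_nonneg hM hU _ _ _

theorem sum_configWeight (hd : 0 < d) (x : Fin k → X) : ∑ ω, configWeight M U x ω = 1 := by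
  -- With no test factors the product formula gives the total mass.
  have := sum_prod_mul_prod_comp (J := Empty) (fun e => pairWeight M U x e)
    (sum_pairWeight hd x) (fun j => j.elim) (fun j => j.elim) (fun j => j.elim)
  simpa [configWeight] using this

theorem abs_sampleMatrix_le (hM : 0 < M) (ω : Fin k × Fin k → Bool × Fin d × Bool) (c : Fin d)
    (i j : Fin k) : |sampleMatrix M ω c i j| ≤ 2 * d * M := by
  unfold sampleMatrix estimator
  split_ifs <;> simp only [abs_mul, abs_boolSign, abs_zero, mul_one] <;> try positivity
  all_goals rw [abs_of_pos hM]; simp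

/-- The increasing rearrangement of a pair. -/
def sortPair (i j : Fin k) : Fin k × Fin k := if i < j then (i, j) else (j, i)

/-- Unbiasedness: only one direction and colour count, and there the two signs contribute `2 *
directed / (4 * d * M)`, which the factor `2 * d * M` of the estimator restores. Subtracting `v` is
harmless because the weights sum to 1. -/
theorem sum_pairWeight_mul_estimator (hd : 0 < d) (hM : 0 < M) (x : Fin k → X) (c : Fin d)
    {i j : Fin k} (hij : i ≠ j) (v : ℝ) :
    ∑ s, pairWeight M U x (sortPair i j) s * (estimator M c (decide (i < j)) s - v) =
      U c (x i) (x j) - v := by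
  have hd' : (d : ℝ) ≠ 0 := by positivity
  have hM' := hM.ne'
  simp only [mul_sub, Finset.sum_sub_distrib, ← Finset.sum_mul, sum_pairWeight hd, one_mul]
  congr 1
  have key : ∀ (a a' : X) (b : Bool), ∑ s, stateWeight M U a a' s * estimator M c b s =
      directed U b c a a' := by
    intro a a' b
    simp only [Fintype.sum_prod_type, Fintype.sum_bool, stateWeight, estimator, boolSign, if_true,
      Bool.false_eq_true, if_false]
    rw [← Finset.sum_add_distrib, Finset.sum_eq_single c]
    · cases b <;> simp <;> field_simp <;> ring
    · intro c' _ hc'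
      simp [hc']
    · simp
  rcases lt_or_gt_of_ne hij with h | h
  · simp only [sortPair, h, if_true, pairWeight, decide_true, key, directed]
  · simp only [sortPair, not_lt_of_gt h, h, if_false, if_true, pairWeight, decide_false, key,
      directed, Bool.false_eq_true]

theorem sampleMatrix_eq (ω : Fin k × Fin k → Bool × Fin d × Bool) (c : Fin d) (i j : Fin k) :
    sampleMatrix M ω c i j = estimator M c (decide (i < j)) (ω (sortPair i j)) := by
  unfold sampleMatrix sortPair
  split_ifs with h <;> simp [h]

theorem sortPair_injective {i j i' j' : Fin k} (h : sortPair i j = sortPair i' j') :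
    (i = i' ∧ j = j') ∨ (i = j' ∧ j = i') := by
  unfold sortPair at h
  split_ifs at h <;> simp only [Prod.mk.injEq] at h <;> tauto

/-- Conditionally on the sample, the errors of the estimated matrix along the edges of a
four-cycle with distinct vertices are independent. -/
theorem sum_configWeight_mul_four (hd : 0 < d) (hM : 0 < M) (x : Fin k → X) (c : Fin d)
    (V : X → X → ℝ) {i i' j j' : Fin k} (h1 : i ≠ i') (h2 : i ≠ j)
    (h3 : i ≠ j') (h4 : i' ≠ j) (h5 : i' ≠ j') (h6 : j ≠ j') :
    ∑ ω, configWeight M U x ω * ((sampleMatrix M ω c i j - V (x i) (x j)) *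
      (sampleMatrix M ω c i j' - V (x i) (x j')) * (sampleMatrix M ω c i' j - V (x i') (x j)) *
      (sampleMatrix M ω c i' j' - V (x i') (x j'))) =
    (U c (x i) (x j) - V (x i) (x j)) * (U c (x i) (x j') - V (x i) (x j')) *
      (U c (x i') (x j) - V (x i') (x j)) * (U c (x i') (x j') - V (x i') (x j')) := by
  let r : Bool → Fin k := fun b => if b then i else i'
  let t : Bool → Fin k := fun b => if b then j else j'
  -- The edges of the four-cycle join `r a` to `t b`. The two sides being disjoint, no edge is the
  -- reversal of another, so the four underlying pairs are distinct.
  have hne : ∀ a b, r a ≠ t b := by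
    intro a b; cases a <;> cases b <;> simp [r, t, h2, h3, h4, h5]
  have hr : Function.Injective r := by
    intro a b h; cases a <;> cases b <;> simp_all [r]
  have ht : Function.Injective t := by
    intro a b h; cases a <;> cases b <;> simp_all [t]
  have he : Function.Injective fun q : Bool × Bool => sortPair (r q.1) (t q.2) := by
    rintro ⟨a, b⟩ ⟨a', b'⟩ h
    rcases sortPair_injective h with h | h
    · exact Prod.ext (hr h.1) (ht h.2)
    · exact absurd h.1 (hne _ _)
  have := sum_prod_mul_prod_comp (fun e => pairWeight M U x e)
    (sum_pairWeight hd x) (fun q : Bool × Bool => sortPair (r q.1) (t q.2)) he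
    (fun q s => estimator M c (decide (r q.1 < t q.2)) s - V (x (r q.1)) (x (t q.2)))
  change ∑ ω, configWeight M U x ω * _ = _ at this
  simp only [sum_pairWeight_mul_estimator hd hM x c (hne _ _), ← sampleMatrix_eq,
    Fintype.prod_prod_type, Fintype.prod_bool] at this
  simpa [r, t, mul_assoc] using this

end Sampling

/-! ### Expected sampling error, and the dependence of the sampling law on the densities. -/

section Discrepancy

open Finset
open scoped BigOperators

variable {X : Type*} [Fintype X] {d k : ℕ} {M : ℝ} {U : Fin d → X → X → ℝ}

/-- For distinct indices the mean is exactly the normalized four-cycle density of `U c - V`.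
Otherwise the crude bound `B ^ 4` is paid for by the indicator of a coincidence. -/
theorem expect_sum_configWeight_mul_four_le [Nonempty X] (hd : 0 < d) (hM : 0 < M)
    (hU : ∀ c x y, |U c x y| ≤ M)
    (c : Fin d) (V : X → X → ℝ) {B τ : ℝ} (hB : 2 * d * M + M ≤ B) (hV : ∀ x y, |V x y| ≤ M)
    (hτ : fourCycle (fun x y => U c x y - V x y) ≤ τ * (Fintype.card X : ℝ) ^ 4) (hτ0 : 0 ≤ τ)
    (i i' j j' : Fin k) :
    𝔼 x : Fin k → X, ∑ ω, configWeight M U x ω * ((sampleMatrix M ω c i j - V (x i) (x j)) *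
      (sampleMatrix M ω c i j' - V (x i) (x j')) * (sampleMatrix M ω c i' j - V (x i') (x j)) *
      (sampleMatrix M ω c i' j' - V (x i') (x j'))) ≤ τ + B ^ 4 * ((if i = i' then 1 else 0) +
        (if i = j then 1 else 0) + (if i = j' then 1 else 0) + (if i' = j then 1 else 0) +
        (if i' = j' then 1 else 0) + (if j = j' then 1 else 0)) := by
  have hB0 : 0 < B := lt_of_lt_of_le (by positivity) hB
  by_cases hdist : i ≠ i' ∧ i ≠ j ∧ i ≠ j' ∧ i' ≠ j ∧ i' ≠ j' ∧ j ≠ j'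
  · obtain ⟨h1, h2, h3, h4, h5, h6⟩ := hdist
    simp only [sum_configWeight_mul_four hd hM _ c V h1 h2 h3 h4 h5 h6]
    rw [expect_four (fun a a' b b' => (U c a b - V a b) * (U c a b' - V a b') *
      (U c a' b - V a' b) * (U c a' b' - V a' b')) h1 h2 h3 h4 h5 h6]
    have : (𝔼 a, 𝔼 a', 𝔼 b, 𝔼 b', (U c a b - V a b) * (U c a b' - V a b') *
        (U c a' b - V a' b) * (U c a' b' - V a' b')) =
        fourCycle (fun x y => U c x y - V x y) / (Fintype.card X : ℝ) ^ 4 := by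
      simp only [Fintype.expect_eq_sum_div_card, fourCycle, ← Finset.sum_div, div_div]
      congr 1
      ring
    rw [this]
    have hX : (0 : ℝ) < (Fintype.card X : ℝ) ^ 4 := by positivity
    rw [div_le_iff₀ hX]
    refine hτ.trans ?_
    gcongr
    simp only [h1, h2, h3, h4, h5, h6, if_false]
    simp
  · have hbd : ∀ (x : Fin k → X) ω (i j : Fin k), |sampleMatrix M ω c i j - V (x i) (x j)| ≤ B := by
      intro x ω i j
      refine (abs_sub _ _).trans (le_trans ?_ hB)
      exact add_le_add (abs_sampleMatrix_le hM ω c i j) (hV _ _)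
    calc _ ≤ 𝔼 x : Fin k → X, ∑ ω, configWeight M U x ω * B ^ 4 := by
          refine Finset.expect_le_expect fun x _ => Finset.sum_le_sum fun ω _ => ?_
          refine mul_le_mul_of_nonneg_left ?_ (configWeight_nonneg hM hU x ω)
          refine (le_abs_self _).trans ?_
          rw [abs_mul, abs_mul, abs_mul]
          calc _ ≤ B * B * B * B := by gcongr <;> exact hbd _ _ _ _
            _ = B ^ 4 := by ring
      _ = B ^ 4 := by
          simp only [← Finset.sum_mul, sum_configWeight hd, one_mul]
          exact Fintype.expect_const _
      _ ≤ τ + B ^ 4 * 1 := by linarith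
      _ ≤ _ := by
          gcongr
          have h01 : ∀ (p : Prop) [Decidable p], (0 : ℝ) ≤ if p then 1 else 0 := by
            intro p _; split_ifs <;> norm_num
          have a1 := h01 (i = i')
          have a2 := h01 (i = j)
          have a3 := h01 (i = j')
          have a4 := h01 (i' = j)
          have a5 := h01 (i' = j')
          have a6 := h01 (j = j')
          by_cases h1 : i = i'
          · rw [if_pos h1] at *; linarith
          by_cases h2 : i = j
          · rw [if_pos h2] at *; linarith
          by_cases h3 : i = j'
          · rw [if_pos h3] at *; linarith
          by_cases h4 : i' = j
          · rw [if_pos h4] at *; linarith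
          by_cases h5 : i' = j'
          · rw [if_pos h5] at *; linarith
          by_cases h6 : j = j'
          · rw [if_pos h6] at *; linarith
          exact absurd ⟨h1, h2, h3, h4, h5, h6⟩ hdist

/-- Each of the six possible coincidences among four indices concerns `k ^ 3` of the `k ^ 4` tuples.
-/
theorem expect_sum_configWeight_mul_fourCycle_le [Nonempty X] (hd : 0 < d) (hM : 0 < M)
    (hU : ∀ c x y, |U c x y| ≤ M)
    (c : Fin d) (V : X → X → ℝ) {B τ : ℝ} (hB : 2 * d * M + M ≤ B) (hV : ∀ x y, |V x y| ≤ M)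
    (hτ : fourCycle (fun x y => U c x y - V x y) ≤ τ * (Fintype.card X : ℝ) ^ 4) (hτ0 : 0 ≤ τ) :
    𝔼 x : Fin k → X, ∑ ω, configWeight M U x ω *
      fourCycle (fun i j => sampleMatrix M ω c i j - V (x i) (x j)) ≤
      τ * k ^ 4 + 6 * B ^ 4 * k ^ 3 := by
  simp only [fourCycle, Finset.mul_sum]
  have e : ∀ f : (Fin k → X) → (Fin k × Fin k → Bool × Fin d × Bool) → Fin k → Fin k → Fin k →
      Fin k → ℝ, 𝔼 x, ∑ ω, ∑ i, ∑ i', ∑ j, ∑ j', f x ω i i' j j' =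
        ∑ i, ∑ i', ∑ j, ∑ j', 𝔼 x, ∑ ω, f x ω i i' j j' := by
    intro f
    simp only [← Finset.expect_sum_comm]
    refine Finset.expect_congr rfl fun x _ => ?_
    rw [Finset.sum_comm]
    refine Finset.sum_congr rfl fun i _ => ?_
    rw [Finset.sum_comm]
    refine Finset.sum_congr rfl fun i' _ => ?_
    rw [Finset.sum_comm]
    refine Finset.sum_congr rfl fun j _ => ?_
    rw [Finset.sum_comm]
  rw [e]
  refine (Finset.sum_le_sum fun i _ => Finset.sum_le_sum fun i' _ => Finset.sum_le_sum fun j _ =>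
    Finset.sum_le_sum fun j' _ =>
      expect_sum_configWeight_mul_four_le hd hM hU c V hB hV hτ hτ0 i i' j j').trans ?_
  apply le_of_eq
  simp only [Finset.sum_add_distrib, ← Finset.mul_sum, Finset.sum_const, Finset.card_univ,
    Fintype.card_fin, nsmul_eq_mul, Finset.sum_ite_eq, Finset.mem_univ, if_true]
  ring

/-- The frequency is a mean of `k` independent indicators; centring them at `μ` brings in
`expect_sq_sum_le`. -/
theorem expect_sq_frequency_le [Nonempty X] {Y : Type*} [DecidableEq Y] (hk : 0 < k) (P : X → Y)
    (p : Y) :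
    𝔼 x : Fin k → X, (((Finset.univ.filter fun i => P (x i) = p).card : ℝ) / k -
      ((Finset.univ.filter fun z => P z = p).card : ℝ) / Fintype.card X) ^ 2 ≤ 1 / k := by
  set μ : ℝ := ((Finset.univ.filter fun z => P z = p).card : ℝ) / Fintype.card X with hμ
  have hX : (0 : ℝ) < Fintype.card X := by positivity
  have hk' : (0 : ℝ) < k := by positivity
  have hμ0 : 0 ≤ μ := by positivity
  have hμ1 : μ ≤ 1 := by
    rw [hμ, div_le_one hX]
    exact_mod_cast Finset.card_le_univ _
  have h := expect_sq_sum_le (I := Fin k) (X := X) (fun z => (if P z = p then 1 else 0) - μ)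
    (fun z => by
      split_ifs
      · rw [abs_le]; constructor <;> linarith
      · rw [abs_le]; constructor <;> linarith)
    (by
      rw [Finset.sum_sub_distrib, Finset.sum_boole]
      simp only [Finset.sum_const, Finset.card_univ, nsmul_eq_mul, hμ]
      field_simp
      simp)
  have e : ∀ x : Fin k → X, (((Finset.univ.filter fun i => P (x i) = p).card : ℝ) / k - μ) ^ 2 =
      1 / (k : ℝ) ^ 2 * (∑ i, ((if P (x i) = p then 1 else 0) - μ)) ^ 2 := by
    intro x
    rw [Finset.sum_sub_distrib, Finset.sum_boole]
    simp only [Finset.sum_const, Finset.card_univ, nsmul_eq_mul, Fintype.card_fin]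
    field_simp
  simp only [e]
  rw [← Finset.mul_expect]
  refine (mul_le_mul_of_nonneg_left h (by positivity)).trans ?_
  rw [Fintype.card_fin]
  apply le_of_eq
  field_simp

/-! ### Moments -/

/-- The normalized density of the oriented graph `F`, the edge `e` carrying the kernel `U e`. -/
def moment {V : Type*} [Fintype V] [DecidableEq V] (F : OrientedSimpleGraph V)
    (U : V × V → X → X → ℝ) : ℝ :=
  𝔼 x : V → X, ∏ e ∈ F.edges, U e (x e.1) (x e.2)

/-- The oriented graph formed by the increasing pairs in `T`, with directions given by `b`. -/
def orientedOfPairs (T : Finset (Fin k × Fin k)) (b : Fin k × Fin k → Bool) :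
    OrientedSimpleGraph (Fin k) where
  edges := (T.filter fun e => e.1 < e.2).image fun e => if b e then e else e.swap
  oriented := by
    intro i j h h'
    simp only [Finset.mem_image, Finset.mem_filter, Prod.exists] at h h'
    obtain ⟨a, a', ⟨-, h1⟩, h2⟩ := h
    obtain ⟨c, c', ⟨-, h3⟩, h4⟩ := h'
    split_ifs at h2 h4 <;> simp only [Prod.mk.injEq, Prod.swap] at h2 h4 <;>
      obtain ⟨rfl, rfl⟩ := h2 <;> obtain ⟨rfl, rfl⟩ := h4 <;> rename_i p q
    · exact absurd h1 (not_lt_of_gt h3)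
    · exact (p q).elim
    · exact (q p).elim
    · exact absurd h1 (not_lt_of_gt h3)

/-- An edge may be the reversal of the pair it comes from; `sortPair` recovers the pair and hence
its colour. -/
theorem prod_orientedOfPairs (T : Finset (Fin k × Fin k)) (hT : ∀ e ∈ T, e.1 < e.2)
    (ω : Fin k × Fin k → Bool × Fin d × Bool) (x : Fin k → X) :
    ∏ e ∈ (orientedOfPairs T fun e => (ω e).1).edges,
      U (ω (sortPair e.1 e.2)).2.1 (x e.1) (x e.2) =
    ∏ e ∈ T, directed U (ω e).1 (ω e).2.1 (x e.1) (x e.2) := by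
  have hf : (T.filter fun e => e.1 < e.2) = T := Finset.filter_true_of_mem hT
  simp only [orientedOfPairs, hf]
  rw [Finset.prod_image]
  · refine Finset.prod_congr rfl fun e he => ?_
    have := hT e he
    unfold directed
    split_ifs with h
    · simp [sortPair, this]
    · simp [sortPair, not_lt_of_gt this]
  · rintro ⟨a, b⟩ he ⟨a', b'⟩ he' h
    have h1 := hT _ he
    have h2 := hT _ he'
    dsimp only at h h1 h2
    split_ifs at h <;> simp only [Prod.mk.injEq, Prod.swap] at h <;> obtain ⟨rfl, rfl⟩ := h
    · rfl
    · exact absurd h1 (not_lt_of_gt h2)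
    · exact absurd h1 (not_lt_of_gt h2)
    · rfl

/-- The product over increasing pairs of `1 + (signed kernel) / M` expands over sets `T` of pairs. A
pair enters a term at most once and in one direction, so every term is an edge product over an
oriented simple graph: averaging over `x` yields only such densities. -/
theorem configWeight_eq_sum (hd : 0 < d) (x : Fin k → X)
    (ω : Fin k × Fin k → Bool × Fin d × Bool) :
    configWeight M U x ω = (1 / (4 * d)) ^ (k * k) *
      ∑ T : Finset (Fin k × Fin k), if ∀ e ∈ T, e.1 < e.2 then
        (∏ e ∈ T, boolSign (ω e).2.2 / M) *
        ∏ e ∈ (orientedOfPairs T fun e => (ω e).1).edges,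
          U (ω (sortPair e.1 e.2)).2.1 (x e.1) (x e.2) else 0 := by
  have hd' : (d : ℝ) ≠ 0 := by positivity
  have e1 : ∀ e, pairWeight M U x e (ω e) = 1 / (4 * d) * (1 + if e.1 < e.2 then
      boolSign (ω e).2.2 / M * directed U (ω e).1 (ω e).2.1 (x e.1) (x e.2) else 0) := by
    intro e
    unfold pairWeight stateWeight
    split_ifs
    · field_simp
    · simp
  unfold configWeight
  simp only [e1]
  rw [Finset.prod_mul_distrib, Finset.prod_const, Finset.card_univ, Fintype.card_prod,
    Fintype.card_fin, Finset.prod_one_add]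
  congr 1
  rw [Finset.powerset_univ]
  refine Finset.sum_congr rfl fun T _ => ?_
  split_ifs with hT
  · rw [prod_orientedOfPairs T hT, ← Finset.prod_mul_distrib]
    exact Finset.prod_congr rfl fun e he => by rw [if_pos (hT e he)]
  · push Not at hT
    obtain ⟨e, he, hlt⟩ := hT
    exact Finset.prod_eq_zero he (if_neg (not_lt.2 hlt))

/-- The laws of the configurations sampled from two tuples of kernels are close when their
moments are close. -/
theorem abs_expect_configWeight_sub_le (hd : 0 < d) (hM : 0 < M) {U' : Fin d → X → X → ℝ} {η : ℝ}
    (h : ∀ (F : OrientedSimpleGraph (Fin k)) (c : Fin k × Fin k → Fin d),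
      |moment F (fun e => U (c e)) - moment F (fun e => U' (c e))| ≤ η)
    (ω : Fin k × Fin k → Bool × Fin d × Bool) :
    |𝔼 x : Fin k → X, configWeight M U x ω - 𝔼 x : Fin k → X, configWeight M U' x ω| ≤
      (∑ T : Finset (Fin k × Fin k), (1 / M) ^ T.card) * η := by
  -- The hypothesis at the empty graph forces `η` to be nonnegative.
  have hη : 0 ≤ η := (abs_nonneg _).trans (h ⟨∅, by simp⟩ fun _ => ⟨0, hd⟩)
  have e : ∀ U : Fin d → X → X → ℝ, 𝔼 x : Fin k → X, configWeight M U x ω =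
      (1 / (4 * d)) ^ (k * k) * ∑ T : Finset (Fin k × Fin k), if ∀ e ∈ T, e.1 < e.2 then
        (∏ e ∈ T, boolSign (ω e).2.2 / M) *
        moment (orientedOfPairs T fun e => (ω e).1) (fun e => U (ω (sortPair e.1 e.2)).2.1)
        else 0 := by
    intro U
    simp only [configWeight_eq_sum hd]
    rw [← Finset.mul_expect, Finset.expect_sum_comm]
    congr 1
    refine Finset.sum_congr rfl fun T _ => ?_
    split_ifs with hT
    · rw [← Finset.mul_expect]; rfl
    · simp
  rw [e, e, ← mul_sub, ← Finset.sum_sub_distrib, abs_mul]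
  have hle1 : |(1 / (4 * d) : ℝ) ^ (k * k)| ≤ 1 := by
    rw [abs_of_nonneg (by positivity)]
    refine pow_le_one₀ (by positivity) ?_
    have : (1 : ℝ) ≤ d := by exact_mod_cast hd
    rw [div_le_one (by positivity)]
    linarith
  refine (mul_le_of_le_one_left (abs_nonneg _) hle1).trans ?_
  refine (Finset.abs_sum_le_sum_abs _ _).trans ?_
  rw [Finset.sum_mul]
  refine Finset.sum_le_sum fun T _ => ?_
  split_ifs with hT
  · rw [← mul_sub, abs_mul, Finset.abs_prod]
    have : ∏ e ∈ T, |boolSign (ω e).2.2 / M| = (1 / M) ^ T.card := by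
      simp [abs_div, abs_boolSign, abs_of_pos hM]
    rw [this]
    exact mul_le_mul_of_nonneg_left (h _ _) (by positivity)
  · rw [sub_zero, abs_zero]; positivity

end Discrepancy

/-! ### The inverse counting lemma for tuples of matrices. -/

section FiniteInverse

open Finset
open scoped BigOperators

/-- Otherwise every outcome is bad for all samples of one of the two laws. Let `A` be the outcomes
always bad for the first. By Markov, `A` has mass at most `1/4` under the first law and its
complement at most `1/4` under the second, hence at most `1/2` under the first; the total would stay
below 1. -/
theorem exists_common_outcome {Z Ω : Type*} [Fintype Z] [Nonempty Z] [Fintype Ω]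
    (w w' D D' : Z → Ω → ℝ) (hw : ∀ z ω, 0 ≤ w z ω) (hw' : ∀ z ω, 0 ≤ w' z ω)
    (hsum : ∀ z, ∑ ω, w z ω = 1) (hD : ∀ z ω, 0 ≤ D z ω) (hD' : ∀ z ω, 0 ≤ D' z ω)
    (hE : 𝔼 z, ∑ ω, w z ω * D z ω ≤ 1 / 4) (hE' : 𝔼 z, ∑ ω, w' z ω * D' z ω ≤ 1 / 4) {η : ℝ}
    (hη : ∀ ω, |𝔼 z, w z ω - 𝔼 z, w' z ω| ≤ η) (hη' : Fintype.card Ω * η ≤ 1 / 4) :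
    ∃ ω z z', D z ω ≤ 1 ∧ D' z' ω ≤ 1 := by
  classical
  by_contra hcon
  push Not at hcon
  set A : Finset Ω := Finset.univ.filter fun ω => ∀ z, 1 < D z ω with hA
  have markov : ∀ (w D : Z → Ω → ℝ) (A : Finset Ω), (∀ z ω, 0 ≤ w z ω) → (∀ z ω, 0 ≤ D z ω) →
      (∀ ω ∈ A, ∀ z, 1 < D z ω) → ∑ ω ∈ A, 𝔼 z, w z ω ≤ 𝔼 z, ∑ ω, w z ω * D z ω := by
    intro w D A hw hD hA
    rw [← Finset.expect_sum_comm]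
    refine Finset.expect_le_expect fun z _ => ?_
    refine le_trans (Finset.sum_le_sum fun ω hω => ?_)
      (Finset.sum_le_univ_sum_of_nonneg fun ω => mul_nonneg (hw z ω) (hD z ω))
    · exact le_mul_of_one_le_right (hw z ω) (hA ω hω z).le
  have h1 := markov w D A hw hD (fun ω hω => (Finset.mem_filter.1 hω).2)
  have h2 := markov w' D' Aᶜ hw' hD' (fun ω hω z' => by
    simp only [hA, Finset.compl_filter, Finset.mem_filter, Finset.mem_univ, true_and,
      not_forall, not_lt] at hω
    obtain ⟨z, hz⟩ := hω
    exact hcon ω z z' hz)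
  have h3 : ∑ ω ∈ Aᶜ, 𝔼 z, w z ω ≤ ∑ ω ∈ Aᶜ, 𝔼 z, w' z ω + 1 / 4 := by
    have : ∑ ω ∈ Aᶜ, (𝔼 z, w z ω - 𝔼 z, w' z ω) ≤ Fintype.card Ω * η := by
      calc _ ≤ ∑ ω ∈ Aᶜ, |𝔼 z, w z ω - 𝔼 z, w' z ω| :=
            Finset.sum_le_sum fun _ _ => le_abs_self _
        _ ≤ ∑ ω, |𝔼 z, w z ω - 𝔼 z, w' z ω| :=
            Finset.sum_le_univ_sum_of_nonneg fun _ => abs_nonneg _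
        _ ≤ ∑ _ω : Ω, η := Finset.sum_le_sum fun ω _ => hη ω
        _ = _ := by simp
    rw [Finset.sum_sub_distrib] at this
    linarith
  have h4 : ∑ ω, 𝔼 z, w z ω = 1 := by
    rw [← Finset.expect_sum_comm]
    simp only [hsum]
    exact Fintype.expect_const _
  rw [← Finset.sum_add_sum_compl A] at h4
  linarith

variable {X Y : Type*} [Fintype X] [Fintype Y] [DecidableEq Y] {k : ℕ}

theorem sum_comp_of_card_fiber {I : Type*} [Fintype I] [DecidableEq I] {π : X → I} {r : ℝ}
    (hr : ∀ i, ((univ.filter fun y => π y = i).card : ℝ) = r) (h : I → ℝ) :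
    ∑ y, h (π y) = r * ∑ i, h i := by
  rw [← Finset.sum_fiberwise Finset.univ π, Finset.mul_sum]
  refine Finset.sum_congr rfl fun i _ => ?_
  rw [Finset.sum_congr rfl fun y hy => by rw [(Finset.mem_filter.1 hy).2]]
  rw [Finset.sum_const, nsmul_eq_mul, hr]

theorem fourCycle_comp_of_card_fiber {I : Type*} [Fintype I] [DecidableEq I] {π : X → I} {r : ℝ}
    (hr : ∀ i, ((univ.filter fun y => π y = i).card : ℝ) = r) (D : I → I → ℝ) :
    fourCycle (fun y y' => D (π y) (π y')) = r ^ 4 * fourCycle D := by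
  unfold fourCycle
  have s := fun h => sum_comp_of_card_fiber hr h
  rw [s (fun a => ∑ x', ∑ y, ∑ y', D a (π y) * D a (π y') * D (π x') (π y) * D (π x') (π y'))]
  rw [Finset.sum_congr rfl fun a _ => s (fun a' => ∑ y, ∑ y', D a (π y) * D a (π y') *
    D a' (π y) * D a' (π y'))]
  rw [Finset.sum_congr rfl fun a _ => by rw [Finset.sum_congr rfl fun a' _ =>
    s (fun b => ∑ y', D a b * D a (π y') * D a' b * D a' (π y'))]]
  rw [Finset.sum_congr rfl fun a _ => by rw [Finset.sum_congr rfl fun a' _ => by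
    rw [Finset.sum_congr rfl fun b _ => s (fun b' => D a b * D a b' * D a' b * D a' b')]]]
  simp only [← Finset.mul_sum]
  ring

theorem card_eq_of_card_fiber {π : X → Fin k} {r : ℝ}
    (hr : ∀ i, ((univ.filter fun y => π y = i).card : ℝ) = r) : (Fintype.card X : ℝ) = r * k := by
  simpa using sum_comp_of_card_fiber hr fun _ => 1

/-- `P` and the blow-up of `P ∘ x` along `π` have nearly equal class sizes, so a permutation matches
them outside a set `W` of at most `|Y| * τ * |X|` points. Errors, at most `2 * M` each, live on the
rows and columns of `W`. As `σ` depends only on the labels, it serves all colours. -/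
theorem exists_perm_cutLE_of_frequency [Nonempty X] [DecidableEq X] (hk : 0 < k) {π : X → Fin k}
    {r : ℝ} (hr : ∀ i, ((univ.filter fun y => π y = i).card : ℝ) = r) (P : X → Y)
    (x : Fin k → X) {τ : ℝ} (hτ : 0 ≤ τ)
    (hfreq : ∀ p, (((univ.filter fun i => P (x i) = p).card : ℝ) / k -
      ((univ.filter fun z => P z = p).card : ℝ) / Fintype.card X) ^ 2 ≤ τ ^ 2) :
    ∃ σ : Equiv.Perm X, ∀ (M : ℝ) (g : Y → Y → ℝ), (∀ p q, |g p q| ≤ M) →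
      CutLE (fun y y' => g (P (σ y)) (P (σ y')) - g (P (x (π y))) (P (x (π y'))))
        (4 * M * Fintype.card Y * τ) := by
  obtain ⟨σ, hσ⟩ := exists_perm_card_ne_le P (fun y => P (x (π y)))
  refine ⟨σ, fun M g hg => ?_⟩
  have hX := card_eq_of_card_fiber hr
  have hXpos : (0 : ℝ) < Fintype.card X := by positivity
  have hk' : (0 : ℝ) < k := by positivity
  set W := univ.filter fun y => P (σ y) ≠ P (x (π y)) with hW
  have hWc : (W.card : ℝ) ≤ Fintype.card Y * τ * Fintype.card X := by
    refine hσ.trans ?_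
    calc _ ≤ ∑ _p : Y, τ * Fintype.card X := by
          refine Finset.sum_le_sum fun p _ => ?_
          have h1 : ((univ.filter fun y => P (x (π y)) = p).card : ℝ) =
              r * (univ.filter fun i => P (x i) = p).card := by
            have := sum_comp_of_card_fiber hr fun i => if P (x i) = p then 1 else 0
            simpa [Finset.sum_boole] using this
          have h2 := abs_le_of_sq_le_sq (hfreq p) hτ
          have h3 : ((univ.filter fun z => P z = p).card : ℝ) -
              (univ.filter fun y => P (x (π y)) = p).card = -(Fintype.card X *
              (((univ.filter fun i => P (x i) = p).card : ℝ) / k -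
                ((univ.filter fun z => P z = p).card : ℝ) / Fintype.card X)) := by
            rw [h1, mul_sub, mul_div_cancel₀ _ hXpos.ne', hX]
            field_simp
            ring
          rw [h3, abs_neg, abs_mul, abs_of_pos hXpos, mul_comm]
          exact mul_le_mul_of_nonneg_right h2 hXpos.le
      _ = _ := by simp [mul_assoc]
  have hM : 0 ≤ M := by
    have y : X := Classical.arbitrary X
    exact (abs_nonneg _).trans (hg (P y) (P y))
  refine CutLE.of_sum_abs ?_
  have hb : ∀ y y', |g (P (σ y)) (P (σ y')) - g (P (x (π y))) (P (x (π y')))| ≤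
      2 * M * ((if y ∈ W then 1 else 0) + (if y' ∈ W then 1 else 0)) := by
    intro y y'
    have h2M : |g (P (σ y)) (P (σ y')) - g (P (x (π y))) (P (x (π y')))| ≤ 2 * M := by
      refine (abs_sub _ _).trans ?_
      linarith [hg (P (σ y)) (P (σ y')), hg (P (x (π y))) (P (x (π y')))]
    by_cases hy : y ∈ W
    · rw [if_pos hy]
      refine h2M.trans ?_
      split_ifs <;> nlinarith
    by_cases hy' : y' ∈ W
    · rw [if_pos hy', if_neg hy]
      linarith
    · simp only [hW, Finset.mem_filter, Finset.mem_univ, true_and, ne_eq, not_not] at hy hy'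
      rw [hy, hy', sub_self, abs_zero]
      split_ifs <;> positivity
  refine (Finset.sum_le_sum fun y _ => Finset.sum_le_sum fun y' _ => hb y y').trans ?_
  have : ∑ y : X, ∑ y' : X, 2 * M * ((if y ∈ W then (1 : ℝ) else 0) + (if y' ∈ W then 1 else 0)) =
      4 * M * Fintype.card X * W.card := by
    simp only [← Finset.mul_sum, Finset.sum_add_distrib, Finset.sum_const, Finset.card_univ,
      nsmul_eq_mul, Finset.sum_ite_mem, Finset.univ_inter, mul_one]
    ring
  rw [this]
  calc _ ≤ 4 * M * Fintype.card X * (Fintype.card Y * τ * Fintype.card X) := by gcongr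
    _ = _ := by ring

/-- The normalized discrepancy between the kernels sampled along `x` and the configuration `ω`:
errors of the estimated matrices in the four-cycle norm, and errors of the class frequencies. -/
def discrepancy {d : ℕ} (M a b : ℝ) (P : X → Y) (g : Fin d → Y → Y → ℝ)
    (x : Fin k → X) (ω : Fin k × Fin k → Bool × Fin d × Bool) : ℝ :=
  (∑ c, fourCycle fun i j => sampleMatrix M ω c i j - g c (P (x i)) (P (x j))) / (a * k ^ 4) +
    (∑ p, (((univ.filter fun i => P (x i) = p).card : ℝ) / k -
      ((univ.filter fun z => P z = p).card : ℝ) / Fintype.card X) ^ 2) / b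

theorem discrepancy_nonneg {d : ℕ} {M a b : ℝ} (ha : 0 ≤ a) (hb : 0 ≤ b) (P : X → Y)
    (g : Fin d → Y → Y → ℝ)
    (x : Fin k → X) (ω : Fin k × Fin k → Bool × Fin d × Bool) :
    0 ≤ discrepancy M a b P g x ω := by
  unfold discrepancy
  refine add_nonneg (div_nonneg (Finset.sum_nonneg fun _ _ => fourCycle_nonneg _) (by positivity))
    (div_nonneg (Finset.sum_nonneg fun _ _ => sq_nonneg _) hb)

theorem expect_discrepancy_le [Nonempty X] {d : ℕ} {M a b B τ : ℝ} {U : Fin d → X → X → ℝ}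
    (hd : 0 < d) (hM : 0 < M) (hk : 0 < k) (ha : 0 < a) (hb : 0 < b)
    (hU : ∀ c x y, |U c x y| ≤ M) (P : X → Y) (g : Fin d → Y → Y → ℝ)
    (hg : ∀ c p q, |g c p q| ≤ M) (hB : 2 * d * M + M ≤ B) (hτ0 : 0 ≤ τ)
    (hτ : ∀ c, fourCycle (fun x y => U c x y - g c (P x) (P y)) ≤ τ * (Fintype.card X : ℝ) ^ 4) :
    𝔼 x : Fin k → X, ∑ ω, configWeight M U x ω * discrepancy M a b P g x ω ≤
      d * (τ + 6 * B ^ 4 / k) / a + Fintype.card Y / (b * k) := by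
  have hk' : (0 : ℝ) < k := by positivity
  have e : ∀ x : Fin k → X, ∑ ω, configWeight M U x ω * discrepancy M a b P g x ω =
      1 / (a * k ^ 4) * (∑ c, ∑ ω, configWeight M U x ω *
        fourCycle (fun i j => sampleMatrix M ω c i j - g c (P (x i)) (P (x j)))) +
      1 / b * ∑ p, (((univ.filter fun i => P (x i) = p).card : ℝ) / k -
        ((univ.filter fun z => P z = p).card : ℝ) / Fintype.card X) ^ 2 := by
    intro x
    rw [Finset.sum_comm]
    simp only [discrepancy, mul_add, Finset.sum_add_distrib, ← Finset.mul_sum, ← Finset.sum_mul,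
      sum_configWeight hd, one_mul]
    congr 1
    · rw [Finset.mul_sum]
      refine Finset.sum_congr rfl fun ω _ => ?_
      ring
    · ring
  simp only [e]
  rw [Finset.expect_add_distrib, ← Finset.mul_expect, ← Finset.mul_expect,
    Finset.expect_sum_comm, Finset.expect_sum_comm]
  have h1 : ∑ c, 𝔼 x : Fin k → X, ∑ ω, configWeight M U x ω *
      fourCycle (fun i j => sampleMatrix M ω c i j - g c (P (x i)) (P (x j))) ≤
      d * (τ * k ^ 4 + 6 * B ^ 4 * k ^ 3) := by
    refine (Finset.sum_le_sum fun c _ => expect_sum_configWeight_mul_fourCycle_le hd hM hU c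
      (fun x y => g c (P x) (P y)) hB (fun _ _ => hg _ _ _) (hτ c) hτ0).trans ?_
    simp [mul_add]
  have h2 : ∑ p, 𝔼 x : Fin k → X, (((univ.filter fun i => P (x i) = p).card : ℝ) / k -
        ((univ.filter fun z => P z = p).card : ℝ) / Fintype.card X) ^ 2 ≤
      Fintype.card Y * (1 / k) := by
    refine (Finset.sum_le_sum fun p _ => expect_sq_frequency_le hk P p).trans ?_
    simp
  calc _ ≤ 1 / (a * k ^ 4) * (d * (τ * k ^ 4 + 6 * B ^ 4 * k ^ 3)) +
        1 / b * (Fintype.card Y * (1 / k)) := by gcongr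
    _ = _ := by field_simp

/-- Three errors add up: regularity (`δ`), matching of classes (`4 * M * |Y| * τ`), and the
four-cycle error of the estimated matrix (`a`), the last unchanged by the blow-up because the fibres
of `π` have equal size. -/
theorem exists_perm_cutLE_of_discrepancy [Nonempty X] [DecidableEq X] {d : ℕ} {M a τ : ℝ}
    {U : Fin d → X → X → ℝ}
    (hk : 0 < k) (ha : 0 < a) (hτ : 0 < τ) {π : X → Fin k}
    {r : ℝ} (hr : ∀ i, ((univ.filter fun y => π y = i).card : ℝ) = r)
    (P : X → Y) (g : Fin d → Y → Y → ℝ) (hg : ∀ c p q, |g c p q| ≤ M) {δ : ℝ}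
    (hcut : ∀ c, CutLE (fun x y => U c x y - g c (P x) (P y)) δ)
    (x : Fin k → X) (ω : Fin k × Fin k → Bool × Fin d × Bool)
    (hdis : discrepancy M (a ^ 4) (τ ^ 2) P g x ω ≤ 1) :
    ∃ σ : Equiv.Perm X, ∀ c, CutLE (fun y y' => U c (σ y) (σ y') - sampleMatrix M ω c (π y) (π y'))
      (δ + 4 * M * Fintype.card Y * τ + a) := by
  have hk' : (0 : ℝ) < k := by positivity
  have n1 : 0 ≤ ∑ c, fourCycle fun i j => sampleMatrix M ω c i j - g c (P (x i)) (P (x j)) :=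
    Finset.sum_nonneg fun _ _ => fourCycle_nonneg _
  have n2 : 0 ≤ ∑ p, (((univ.filter fun i => P (x i) = p).card : ℝ) / k -
      ((univ.filter fun z => P z = p).card : ℝ) / Fintype.card X) ^ 2 :=
    Finset.sum_nonneg fun _ _ => sq_nonneg _
  unfold discrepancy at hdis
  have d1 : (∑ c, fourCycle fun i j => sampleMatrix M ω c i j - g c (P (x i)) (P (x j))) ≤
      a ^ 4 * k ^ 4 := by
    have : (∑ c, fourCycle fun i j => sampleMatrix M ω c i j - g c (P (x i)) (P (x j))) /
        (a ^ 4 * k ^ 4) ≤ 1 := le_trans (le_add_of_nonneg_right (by positivity)) hdis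
    rwa [div_le_one (by positivity)] at this
  have d2 : ∑ p, (((univ.filter fun i => P (x i) = p).card : ℝ) / k -
      ((univ.filter fun z => P z = p).card : ℝ) / Fintype.card X) ^ 2 ≤ τ ^ 2 := by
    have := le_trans (le_add_of_nonneg_left (by positivity)) hdis
    rwa [div_le_one (by positivity)] at this
  obtain ⟨σ, hσ⟩ := exists_perm_cutLE_of_frequency hk hr P x hτ.le fun p =>
    (Finset.single_le_sum (f := fun p => (((univ.filter fun i => P (x i) = p).card : ℝ) / k -
      ((univ.filter fun z => P z = p).card : ℝ) / Fintype.card X) ^ 2)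
      (fun _ _ => sq_nonneg _) (Finset.mem_univ p)).trans d2
  refine ⟨σ, fun c => ?_⟩
  have c1 := (hcut c).comp_perm σ
  have c2 := hσ M (g c) (hg c)
  have c3 : CutLE (fun y y' => sampleMatrix M ω c (π y) (π y') -
      g c (P (x (π y))) (P (x (π y')))) a := by
    refine CutLE.of_fourCycle ha.le ?_
    rw [fourCycle_comp_of_card_fiber hr
      (fun i j => sampleMatrix M ω c i j - g c (P (x i)) (P (x j))), card_eq_of_card_fiber hr]
    have := (Finset.single_le_sum (f := fun c => fourCycle fun i j => sampleMatrix M ω c i j -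
      g c (P (x i)) (P (x j))) (fun _ _ => fourCycle_nonneg _) (Finset.mem_univ c)).trans d1
    calc _ ≤ r ^ 4 * (a ^ 4 * k ^ 4) := by gcongr
      _ = _ := by ring
  convert (c1.add c2).sub c3 using 3 with y y'
  ring

/-- Finite inverse counting lemma: two tuples of kernels on `X` whose oriented moments of bounded
order are close agree up to a permutation and a small error in cut norm. -/
theorem exists_perm_cutLE_of_moment (d : ℕ) {M ε : ℝ} (hM : 0 < M) (hε : 0 < ε) :
    ∃ k : ℕ, 0 < k ∧ ∃ η : ℝ, 0 < η ∧ ∀ (X : Type) [Fintype X] [Nonempty X] (π : X → Fin k) (r : ℝ),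
      (∀ i, ((univ.filter fun y => π y = i).card : ℝ) = r) → ∀ U U' : Fin d → X → X → ℝ,
      (∀ c x y, |U c x y| ≤ M) → (∀ c x y, |U' c x y| ≤ M) →
      (∀ (F : OrientedSimpleGraph (Fin k)) (c : Fin k × Fin k → Fin d),
        |moment F (fun e => U (c e)) - moment F (fun e => U' (c e))| ≤ η) →
      ∃ σ : Equiv.Perm X, ∀ c, CutLE (fun x y => U c x y - U' c (σ x) (σ y)) ε := by
  classical
  rcases Nat.eq_zero_or_pos d with rfl | hd
  · exact ⟨1, one_pos, 1, one_pos, fun X _ _ _ _ _ _ _ _ _ _ => ⟨1, fun c => c.elim0⟩⟩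
  have hd' : (0 : ℝ) < d := by positivity
  set B : ℝ := 2 * d * M + M with hB
  have hB0 : 0 < B := by positivity
  -- The quantities `a`, `δ` and `4 * M * |Y| * τ` are each at most `ε / 6`, so either tuple is
  -- within `ε / 2` of the common blow-up.
  set a : ℝ := ε / 6 with ha
  have ha0 : 0 < a := by positivity
  -- `δ` is small enough for the four-cycle norm of the regularity error
  set δ : ℝ := min (ε / 6) (a ^ 4 / (16 * d * (4 * B ^ 3))) with hδ
  have hδ0 : 0 < δ := by positivity
  obtain ⟨n, hn⟩ := exists_weak_regularity_bounded M δ hM.le hδ0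
  -- The common refinement of the `d` regularity partitions.
  let Y := Fin d → Fin n → Bool × Bool
  have hY : (0 : ℝ) < Fintype.card Y := by positivity
  set τ : ℝ := ε / (24 * M * Fintype.card Y) with hτ
  have hτ0 : 0 < τ := by positivity
  -- The sample size makes the expected discrepancy at most `1/16 + 1/16 + 1/8 = 1/4`: regularity,
  -- coincidences of indices, and frequencies.
  obtain ⟨k, hk⟩ := exists_nat_gt (max (96 * d * B ^ 4 / a ^ 4) (8 * Fintype.card Y / τ ^ 2))
  have hk1 : 96 * d * B ^ 4 / a ^ 4 < k := (le_max_left _ _).trans_lt hk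
  have hk2 : 8 * Fintype.card Y / τ ^ 2 < k := (le_max_right _ _).trans_lt hk
  have hk' : (0 : ℝ) < k := lt_trans (by positivity) hk1
  have hk0 : 0 < k := by exact_mod_cast hk'
  -- `K * η` bounds the total variation of the two configuration laws, and `η = 1 / (4 * (K + 1))`
  -- keeps it below `1/4`.
  set K : ℝ := Fintype.card (Fin k × Fin k → Bool × Fin d × Bool) *
    ∑ T : Finset (Fin k × Fin k), (1 / M) ^ T.card with hK
  have hK0 : 0 ≤ K := by positivity
  refine ⟨k, hk0, 1 / (4 * (K + 1)), by positivity, ?_⟩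
  intro X _ _ π r hr U U' hU hU' hmom
  have reg : ∀ U : Fin d → X → X → ℝ, (∀ c x y, |U c x y| ≤ M) →
      ∃ (P : X → Y) (g : Fin d → Y → Y → ℝ), (∀ c p q, |g c p q| ≤ M) ∧
        (∀ c, CutLE (fun x y => U c x y - g c (P x) (P y)) δ) ∧
        𝔼 x : Fin k → X, ∑ ω, configWeight M U x ω * discrepancy M (a ^ 4) (τ ^ 2) P g x ω ≤
          1 / 4 := by
    intro U hU
    choose P g hg hcut using fun c => hn X (U c) (hU c)
    refine ⟨fun x c => P c x, fun c p q => g c (p c) (q c), fun c p q => hg c _ _, hcut, ?_⟩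
    have hτ' : ∀ c, fourCycle (fun x y => U c x y - g c (P c x) (P c y)) ≤
        (4 * B ^ 3 * δ) * (Fintype.card X : ℝ) ^ 4 := fun c =>
      (hcut c).fourCycle_le hB0 fun x y => by
        refine (abs_sub _ _).trans ?_
        have : (1 : ℝ) ≤ d := by exact_mod_cast hd
        have h1 := hU c x y
        have h2 := hg c (P c x) (P c y)
        nlinarith
    have := expect_discrepancy_le (k := k) hd hM hk0 (pow_pos ha0 4) (pow_pos hτ0 2) hU
      (fun x c => P c x) (fun c (p q : Y) => g c (p c) (q c)) (fun c p q => hg c _ _)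
      hB.ge (by positivity) hτ'
    refine this.trans ?_
    have q1 : d * (4 * B ^ 3 * δ) / a ^ 4 ≤ 1 / 16 := by
      have : δ ≤ a ^ 4 / (16 * d * (4 * B ^ 3)) := min_le_right _ _
      rw [le_div_iff₀ (by positivity)] at this
      rw [div_le_iff₀ (by positivity)]
      linarith
    have q2 : d * (6 * B ^ 4 / k) / a ^ 4 ≤ 1 / 16 := by
      rw [div_lt_iff₀ (by positivity)] at hk1
      rw [div_le_iff₀ (by positivity), ← mul_div_assoc, div_le_iff₀ hk']
      linarith
    have q3 : Fintype.card Y / (τ ^ 2 * k) ≤ 1 / 8 := by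
      rw [div_lt_iff₀ (by positivity)] at hk2
      rw [div_le_iff₀ (by positivity)]
      linarith
    rw [mul_add, add_div]
    linarith
  obtain ⟨P, g, hg, hcut, hE⟩ := reg U hU
  obtain ⟨P', g', hg', hcut', hE'⟩ := reg U' hU'
  obtain ⟨ω, x, x', hx, hx'⟩ := exists_common_outcome (configWeight M U) (configWeight M U')
    (discrepancy M (a ^ 4) (τ ^ 2) P g) (discrepancy M (a ^ 4) (τ ^ 2) P' g')
    (configWeight_nonneg hM hU) (configWeight_nonneg hM hU') (sum_configWeight hd)
    (discrepancy_nonneg (by positivity) (by positivity) P g)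
    (discrepancy_nonneg (by positivity) (by positivity) P' g') hE hE'
    (abs_expect_configWeight_sub_le hd hM hmom) (by
      rw [← mul_assoc, ← hK, mul_one_div, div_le_iff₀ (by positivity)]
      linarith)
  obtain ⟨σ, hσ⟩ := exists_perm_cutLE_of_discrepancy hk0 ha0 hτ0 hr P g hg hcut x ω hx
  obtain ⟨σ', hσ'⟩ := exists_perm_cutLE_of_discrepancy hk0 ha0 hτ0 hr P' g' hg' hcut' x' ω hx'
  -- Both `U ∘ σ` and `U' ∘ σ'` are close to one blow-up; relabelling by `σ⁻¹` puts the whole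
  -- permutation on `U'`.
  refine ⟨σ' * σ⁻¹, fun c => ?_⟩
  have h := ((hσ c).sub (hσ' c)).comp_perm σ⁻¹
  have hδ1 : δ ≤ ε / 6 := min_le_left _ _
  have hτ1 : 4 * M * Fintype.card Y * τ = ε / 6 := by
    rw [hτ]; field_simp; norm_num
  refine CutLE.mono (ε := δ + 4 * M * Fintype.card Y * τ + a + (δ + 4 * M * Fintype.card Y * τ + a))
    ?_ (by rw [hτ1]; linarith)
  convert h using 3 with y y'
  simp

end FiniteInverse

/-! ### The counting lemma for tuples of matrices. -/

section FiniteCounting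

open Finset
open scoped BigOperators

variable {X V : Type*} [Fintype X] [Nonempty X] [Fintype V] [DecidableEq V]

theorem abs_prod_le_pow {ι : Type*} (s : Finset ι) (f : ι → ℝ) {M : ℝ} {n : ℕ} (hM : 1 ≤ M)
    (hf : ∀ e ∈ s, |f e| ≤ M) (hn : s.card ≤ n) : |∏ e ∈ s, f e| ≤ M ^ n := by
  rw [Finset.abs_prod]
  calc ∏ e ∈ s, |f e| ≤ ∏ _e ∈ s, M := Finset.prod_le_prod (fun _ _ => abs_nonneg _) hf
    _ = M ^ s.card := by simp
    _ ≤ M ^ n := pow_le_pow_right₀ hM hn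

/-- Replacing the kernel on a single edge by a kernel of small cut norm makes the density small. -/
theorem CutLE.abs_expect_mul_prod_le (F : OrientedSimpleGraph V) {i j : V}
    (hij : (i, j) ∈ F.edges) {D : X → X → ℝ} {ε M : ℝ} (hD : CutLE D ε) (hM : 1 ≤ M)
    (A : V × V → X → X → ℝ) (hA : ∀ e ∈ F.edges, ∀ x y, |A e x y| ≤ M) :
    |𝔼 x : V → X, D (x i) (x j) * ∏ e ∈ F.edges.erase (i, j), A e (x e.1) (x e.2)| ≤
      4 * M ^ (2 * F.edges.card) * ε := by
  have hne : i ≠ j := by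
    rintro rfl
    exact F.oriented i i hij hij
  have hX : (0 : ℝ) < Fintype.card X := by positivity
  set n := F.edges.card
  have hMn : 0 < M ^ n := by positivity
  rw [← expect_update _ i, ← expect_update _ j]
  have key : ∀ x : V → X, |𝔼 b, 𝔼 a, D (Function.update (Function.update x j b) i a i)
      (Function.update (Function.update x j b) i a j) * ∏ e ∈ F.edges.erase (i, j),
        A e (Function.update (Function.update x j b) i a e.1)
          (Function.update (Function.update x j b) i a e.2)| ≤ 4 * M ^ (2 * n) * ε := by
    intro x
    set E := F.edges.erase (i, j)
    -- `f` collects the other edges at `i`, `g` the edges avoiding `i`. Since `(i, j)` is erased and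
    -- its reversal is excluded by orientation, no edge in `f` touches `j`: the product separates in
    -- `a` and `b`.
    let f : X → ℝ := fun a => ∏ e ∈ E with e.1 = i ∨ e.2 = i,
      A e (Function.update x i a e.1) (Function.update x i a e.2)
    let g : X → ℝ := fun b => ∏ e ∈ E with ¬(e.1 = i ∨ e.2 = i),
      A e (Function.update x j b e.1) (Function.update x j b e.2)
    have hE : ∀ e ∈ E, e ∈ F.edges := fun e he => Finset.mem_of_mem_erase he
    have hEn : E.card ≤ n := Finset.card_le_card (Finset.erase_subset _ _)
    have hf : ∀ a, |f a| ≤ M ^ n := fun a => abs_prod_le_pow _ _ hM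
      (fun e he => hA e (hE e (Finset.mem_filter.1 he).1) _ _)
      ((Finset.card_filter_le _ _).trans hEn)
    have hg : ∀ b, |g b| ≤ M ^ n := fun b => abs_prod_le_pow _ _ hM
      (fun e he => hA e (hE e (Finset.mem_filter.1 he).1) _ _)
      ((Finset.card_filter_le _ _).trans hEn)
    have hsplit : ∀ a b, D (Function.update (Function.update x j b) i a i)
      (Function.update (Function.update x j b) i a j) * ∏ e ∈ E,
        A e (Function.update (Function.update x j b) i a e.1)
          (Function.update (Function.update x j b) i a e.2) = f a * g b * D a b := by
      intro a b
      rw [← Finset.prod_filter_mul_prod_filter_not E (fun e => e.1 = i ∨ e.2 = i)]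
      have p1 : ∏ e ∈ E with e.1 = i ∨ e.2 = i,
          A e (Function.update (Function.update x j b) i a e.1)
          (Function.update (Function.update x j b) i a e.2) = f a := by
        refine Finset.prod_congr rfl fun e he => ?_
        obtain ⟨he, hi⟩ := Finset.mem_filter.1 he
        have hej : e.1 ≠ j ∧ e.2 ≠ j := by
          obtain ⟨p, q⟩ := e
          have hpq := hE _ he
          dsimp only at hi ⊢
          rcases hi with rfl | rfl
          · refine ⟨hne, ?_⟩
            rintro rfl
            exact (Finset.mem_erase.1 he).1 rfl
          · refine ⟨?_, hne⟩
            rintro rfl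
            exact F.oriented _ _ hij hpq
        rw [Function.update_comm hne.symm, Function.update_of_ne hej.1, Function.update_of_ne hej.2]
      have p2 : ∏ e ∈ E with ¬(e.1 = i ∨ e.2 = i),
          A e (Function.update (Function.update x j b) i a e.1)
          (Function.update (Function.update x j b) i a e.2) = g b := by
        refine Finset.prod_congr rfl fun e he => ?_
        obtain ⟨he, hi⟩ := Finset.mem_filter.1 he
        push Not at hi
        rw [Function.update_of_ne hi.1, Function.update_of_ne hi.2]
      rw [p1, p2, Function.update_self, Function.update_of_ne hne.symm, Function.update_self]
      ring
    simp only [hsplit]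
    have hb := hD.bilinear f g hf hg hMn hMn
    rw [Finset.expect_comm]
    simp only [Fintype.expect_eq_sum_div_card, ← Finset.sum_div, div_div]
    rw [abs_div, abs_of_pos (mul_pos hX hX), div_le_iff₀ (mul_pos hX hX)]
    refine hb.trans (le_of_eq ?_)
    ring
  refine (Finset.abs_expect_le _ _).trans ?_
  exact Finset.expect_le Finset.univ_nonempty fun x _ => key x

/-- Finite counting lemma. -/
theorem abs_moment_sub_le (F : OrientedSimpleGraph V) {U U' : V × V → X → X → ℝ} {ε M : ℝ}
    (hM : 1 ≤ M) (hU : ∀ e ∈ F.edges, ∀ x y, |U e x y| ≤ M)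
    (hU' : ∀ e ∈ F.edges, ∀ x y, |U' e x y| ≤ M)
    (hcut : ∀ e ∈ F.edges, CutLE (fun x y => U e x y - U' e x y) ε) :
    |moment F U - moment F U'| ≤ F.edges.card * (4 * M ^ (2 * F.edges.card) * ε) := by
  -- Telescoping: `U` is installed in place of `U'` on one more edge at each step.
  have main : ∀ S ⊆ F.edges, |moment F (fun e => if e ∈ S then U e else U' e) - moment F U'| ≤
      S.card * (4 * M ^ (2 * F.edges.card) * ε) := by
    intro S
    induction S using Finset.induction_on with
    | empty => simp
    | insert e S he ih =>
      intro hS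
      have heF : e ∈ F.edges := hS (Finset.mem_insert_self _ _)
      have ih' := ih ((Finset.subset_insert _ _).trans hS)
      have hstep : moment F (fun e' => if e' ∈ insert e S then U e' else U' e') -
          moment F (fun e' => if e' ∈ S then U e' else U' e') =
          𝔼 x : V → X, (U e (x e.1) (x e.2) - U' e (x e.1) (x e.2)) *
            ∏ e' ∈ F.edges.erase e, (if e' ∈ S then U e' else U' e') (x e'.1) (x e'.2) := by
        unfold moment
        rw [← Finset.expect_sub_distrib]
        refine Finset.expect_congr rfl fun x _ => ?_
        rw [← Finset.mul_prod_erase _ _ heF, ← Finset.mul_prod_erase _ _ heF, sub_mul]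
        have : ∏ e' ∈ F.edges.erase e, (if e' ∈ insert e S then U e' else U' e') (x e'.1) (x e'.2) =
            ∏ e' ∈ F.edges.erase e, (if e' ∈ S then U e' else U' e') (x e'.1) (x e'.2) := by
          refine Finset.prod_congr rfl fun e' he' => ?_
          simp [Finset.mem_insert, (Finset.mem_erase.1 he').1]
        rw [this]
        dsimp only
        rw [if_pos (Finset.mem_insert_self _ _), if_neg he]
      have hle := (hcut e heF).abs_expect_mul_prod_le F (i := e.1) (j := e.2) heF hM
        (fun e' => if e' ∈ S then U e' else U' e') (fun e' he' x y => by
          split_ifs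
          · exact hU e' he' x y
          · exact hU' e' he' x y)
      rw [Prod.mk.eta, ← hstep] at hle
      rw [Finset.card_insert_of_notMem he]
      push_cast
      rw [add_mul, one_mul, add_comm]
      refine (abs_sub_le _ _ _).trans (add_le_add hle ih')
  have := main F.edges subset_rfl
  have e : moment F (fun e => if e ∈ F.edges then U e else U' e) = moment F U := by
    unfold moment
    refine Finset.expect_congr rfl fun x _ => Finset.prod_congr rfl fun e he => ?_
    dsimp only
    rw [if_pos he]
  rwa [e] at this

end FiniteCounting

/-! ### The equipartition of the unit interval -/

section Cells

variable {N : ℕ} [NeZero N]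

/-- The index of the cell `[i/N, (i+1)/N)` containing `x` (irrelevant at `x = 1`). -/
def cell (N : ℕ) [NeZero N] (x : unitInterval) : Fin N := Fin.ofNat N ⌊(N : ℝ) * x⌋₊

theorem measurable_cell : Measurable (cell N) :=
  (measurable_from_top (f := Fin.ofNat N)).comp
    (Measurable.nat_floor (measurable_const.mul measurable_subtype_coe))

theorem floor_lt_of_ne_one {x : unitInterval} (hx : x ≠ 1) : ⌊(N : ℝ) * x⌋₊ < N := by
  have hN : (0 : ℝ) < N := Nat.cast_pos.2 (NeZero.pos N)
  rw [Nat.floor_lt (mul_nonneg hN.le x.2.1)]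
  have h1 : (x : ℝ) < 1 := lt_of_le_of_ne x.2.2 fun h => hx (Subtype.ext h)
  nlinarith

theorem cell_val {x : unitInterval} (hx : x ≠ 1) : (cell N x : ℕ) = ⌊(N : ℝ) * x⌋₊ :=
  Nat.mod_eq_of_lt (floor_lt_of_ne_one hx)

theorem cell_le {x : unitInterval} (hx : x ≠ 1) : (cell N x : ℝ) ≤ N * x := by
  rw [cell_val hx]
  exact Nat.floor_le (mul_nonneg (Nat.cast_nonneg _) x.2.1)

theorem lt_cell_add_one {x : unitInterval} (hx : x ≠ 1) : N * (x : ℝ) < cell N x + 1 := by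
  rw [cell_val hx]
  exact Nat.lt_floor_add_one _

theorem cell_eq_of_mem {x : unitInterval} (hx : x ≠ 1) {i : Fin N} (h1 : (i : ℝ) ≤ N * x)
    (h2 : N * (x : ℝ) < i + 1) : cell N x = i := by
  apply Fin.ext
  rw [cell_val hx, Nat.floor_eq_iff (mul_nonneg (Nat.cast_nonneg _) x.2.1)]
  exact ⟨h1, h2⟩

theorem shift_mem (σ : Equiv.Perm (Fin N)) {x : unitInterval} (hx : x ≠ 1) :
    0 ≤ (x : ℝ) + ((σ (cell N x) : ℝ) - cell N x) / N ∧
      (x : ℝ) + ((σ (cell N x) : ℝ) - cell N x) / N < 1 := by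
  have hN : (0 : ℝ) < N := Nat.cast_pos.2 (NeZero.pos N)
  have e : (x : ℝ) + ((σ (cell N x) : ℝ) - cell N x) / N =
      (N * x - cell N x + σ (cell N x)) / N := by field_simp; ring
  have h1 := cell_le (N := N) hx
  have h2 := lt_cell_add_one (N := N) hx
  have h3 : (σ (cell N x) : ℝ) + 1 ≤ N := by exact_mod_cast (σ (cell N x)).2
  have h4 : (0 : ℝ) ≤ σ (cell N x) := Nat.cast_nonneg _
  rw [e, div_lt_one hN]
  exact ⟨div_nonneg (by linarith) hN.le, by linarith⟩

/-- The interval exchange translating the cell `i` onto the cell `σ i`. -/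
def cellPerm (σ : Equiv.Perm (Fin N)) (x : unitInterval) : unitInterval :=
  if hx : x = 1 then 1 else
    ⟨(x : ℝ) + ((σ (cell N x) : ℝ) - cell N x) / N, (shift_mem σ hx).1, (shift_mem σ hx).2.le⟩

theorem coe_cellPerm (σ : Equiv.Perm (Fin N)) {x : unitInterval} (hx : x ≠ 1) :
    (cellPerm σ x : ℝ) = x + ((σ (cell N x) : ℝ) - cell N x) / N := by
  rw [cellPerm, dif_neg hx]

theorem cellPerm_one (σ : Equiv.Perm (Fin N)) : cellPerm σ 1 = 1 := dif_pos rfl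

theorem cellPerm_ne_one (σ : Equiv.Perm (Fin N)) {x : unitInterval} (hx : x ≠ 1) :
    cellPerm σ x ≠ 1 := by
  intro h
  have := congrArg Subtype.val h
  rw [coe_cellPerm σ hx] at this
  exact (shift_mem σ hx).2.ne this

theorem cell_cellPerm (σ : Equiv.Perm (Fin N)) {x : unitInterval} (hx : x ≠ 1) :
    cell N (cellPerm σ x) = σ (cell N x) := by
  have hN : (0 : ℝ) < N := Nat.cast_pos.2 (NeZero.pos N)
  have h1 := cell_le (N := N) hx
  have h2 := lt_cell_add_one (N := N) hx
  have e : (N : ℝ) * (cellPerm σ x) = N * x - cell N x + σ (cell N x) := by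
    rw [coe_cellPerm σ hx]; field_simp; ring
  refine cell_eq_of_mem (cellPerm_ne_one σ hx) ?_ ?_ <;> rw [e] <;> linarith

theorem cellPerm_inv_cellPerm (σ : Equiv.Perm (Fin N)) (x : unitInterval) :
    cellPerm σ⁻¹ (cellPerm σ x) = x := by
  by_cases hx : x = 1
  · rw [hx, cellPerm_one, cellPerm_one]
  · apply Subtype.ext
    rw [coe_cellPerm _ (cellPerm_ne_one σ hx), cell_cellPerm σ hx, coe_cellPerm σ hx,
      show σ⁻¹ (σ (cell N x)) = cell N x from σ.symm_apply_apply _]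
    ring

theorem measurable_cellPerm (σ : Equiv.Perm (Fin N)) : Measurable (cellPerm σ) := by
  have hf : Measurable fun i : Fin N => ((σ i : ℝ) - (i : ℝ)) / N := measurable_of_finite _
  have h : Measurable fun x : {x : unitInterval // ¬x = 1} =>
      (⟨((x : unitInterval) : ℝ) + ((σ (cell N x) : ℝ) - cell N x) / N,
        (shift_mem σ x.2).1, (shift_mem σ x.2).2.le⟩ : unitInterval) :=
    Measurable.subtype_mk ((measurable_subtype_coe.comp measurable_subtype_coe).add
      (hf.comp (measurable_cell.comp measurable_subtype_coe)))
  exact Measurable.dite (s := {x : unitInterval | x = 1}) measurable_const h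
    (measurableSet_singleton _)

/-- The interval exchange `cellPerm σ` as a measurable equivalence. -/
def cellEquiv (σ : Equiv.Perm (Fin N)) : unitInterval ≃ᵐ unitInterval where
  toFun := cellPerm σ
  invFun := cellPerm σ⁻¹
  left_inv := cellPerm_inv_cellPerm σ
  right_inv x := by simpa using cellPerm_inv_cellPerm σ⁻¹ x
  measurable_toFun := measurable_cellPerm σ
  measurable_invFun := measurable_cellPerm σ⁻¹

theorem volume_eq_sum_cell (A : Set unitInterval) (hA : MeasurableSet A) :
    volume A = ∑ i : Fin N, volume {x | x ∈ A ∧ x ≠ 1 ∧ cell N x = i} := by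
  have hm : ∀ i : Fin N, MeasurableSet {x | x ∈ A ∧ x ≠ 1 ∧ cell N x = i} := fun i =>
    hA.inter (((measurableSet_singleton _).compl).inter
      (measurable_cell (measurableSet_singleton i)))
  have e : volume A = volume (A \ {1}) := (measure_sdiff_null (measure_singleton _)).symm
  have e2 : A \ {1} = ⋃ i : Fin N, {x | x ∈ A ∧ x ≠ 1 ∧ cell N x = i} := by
    ext x; simpa using fun h _ => h
  rw [e, e2, measure_iUnion _ hm, tsum_fintype]
  intro i j hij
  refine Set.disjoint_left.2 fun x hx hx' => hij ?_
  rw [← hx.2.2, hx'.2.2]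

/-- On a single cell the exchange is a translation, so invariance of Lebesgue measure on `ℝ`
applies. -/
theorem volume_preimage_cellPerm_inter (σ : Equiv.Perm (Fin N)) (A : Set unitInterval)
    (i : Fin N) :
    volume {x | x ∈ cellPerm σ ⁻¹' A ∧ x ≠ 1 ∧ cell N x = i} =
      volume {x | x ∈ A ∧ x ≠ 1 ∧ cell N x = σ i} := by
  rw [unitInterval.volume_apply, unitInterval.volume_apply,
    ← measure_preimage_add_right volume (((σ i : ℝ) - i) / N)
      (Subtype.val '' {x | x ∈ A ∧ x ≠ 1 ∧ cell N x = σ i})]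
  congr 1
  ext t
  constructor
  · rintro ⟨x, ⟨hxA, hx, rfl⟩, rfl⟩
    exact ⟨cellPerm σ x, ⟨hxA, cellPerm_ne_one σ hx, cell_cellPerm σ hx⟩, coe_cellPerm σ hx⟩
  · rintro ⟨y, ⟨hyA, hy, hyc⟩, hyt⟩
    have hc : cell N (cellPerm σ⁻¹ y) = i := by rw [cell_cellPerm σ⁻¹ hy, hyc]; simp
    refine ⟨cellPerm σ⁻¹ y, ⟨?_, cellPerm_ne_one _ hy, hc⟩, ?_⟩
    · have := cellPerm_inv_cellPerm σ⁻¹ y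
      rw [inv_inv] at this
      rwa [Set.mem_preimage, this]
    · rw [coe_cellPerm _ hy, hyc, show σ⁻¹ (σ i) = i from σ.symm_apply_apply _, hyt]
      ring

theorem measurePreserving_cellEquiv (σ : Equiv.Perm (Fin N)) :
    MeasurePreserving (cellEquiv σ) volume volume := by
  refine ⟨(cellEquiv σ).measurable, Measure.ext fun A hA => ?_⟩
  rw [Measure.map_apply (cellEquiv σ).measurable hA, volume_eq_sum_cell (N := N) A hA,
    volume_eq_sum_cell (N := N) _ ((cellEquiv σ).measurable hA)]
  exact Fintype.sum_equiv σ _ _ fun i => volume_preimage_cellPerm_inter σ A i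

theorem cell_cellEquiv_ae (σ : Equiv.Perm (Fin N)) :
    ∀ᵐ x : unitInterval, cell N (cellEquiv σ x) = σ (cell N x) := by
  have : ∀ᵐ x : unitInterval, x ≠ 1 := by
    rw [ae_iff]; simp
  filter_upwards [this] with x hx using cell_cellPerm σ hx

/-- The exchange of two cells preserves volume, so all `N` cells have the same volume, and these sum
to 1. -/
theorem volume_cell (i : Fin N) :
    (volume : Measure unitInterval).real (cell N ⁻¹' {i}) = 1 / N := by
  have hN : (N : ℝ) ≠ 0 := NeZero.ne _
  have e : ∀ i : Fin N, volume {x : unitInterval | x ∈ Set.univ ∧ x ≠ 1 ∧ cell N x = i} =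
      volume (cell N ⁻¹' {i}) := by
    intro i
    have : ({x : unitInterval | x ∈ Set.univ ∧ x ≠ 1 ∧ cell N x = i}) = cell N ⁻¹' {i} \ {1} := by
      ext x; simp [and_comm]
    rw [this, measure_sdiff_null (measure_singleton _)]
  have h : ∀ j : Fin N, (volume : Measure unitInterval).real (cell N ⁻¹' {j}) =
      (volume : Measure unitInterval).real (cell N ⁻¹' {i}) := by
    intro j
    have := volume_preimage_cellPerm_inter (Equiv.swap j i) Set.univ j
    rw [Set.preimage_univ, Equiv.swap_apply_left, e, e] at this
    rw [Measure.real, Measure.real, this]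
  have hs : ∑ j : Fin N, (volume : Measure unitInterval).real (cell N ⁻¹' {j}) = 1 := by
    have := volume_eq_sum_cell (N := N) Set.univ MeasurableSet.univ
    simp only [e, measure_univ] at this
    simp only [Measure.real]
    rw [← ENNReal.toReal_sum (fun _ _ => measure_ne_top _ _), ← this, ENNReal.toReal_one]
  simp only [h, Finset.sum_const, Finset.card_univ, Fintype.card_fin, nsmul_eq_mul] at hs
  rw [eq_div_iff hN, mul_comm]
  exact hs

end Cells

/-! ### Step kernels and discretization -/

section StepKernels

variable {N : ℕ} [NeZero N]

/-- The step kernel on the unit square with values `D`. -/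
def stepKernel (D : Fin N → Fin N → ℝ) (z : unitInterval × unitInterval) : ℝ :=
  D (cell N z.1) (cell N z.2)

theorem measurable_stepKernel (D : Fin N → Fin N → ℝ) : Measurable (stepKernel D) :=
  (measurable_of_finite fun p : Fin N × Fin N => D p.1 p.2).comp
    ((measurable_cell.comp measurable_fst).prodMk (measurable_cell.comp measurable_snd))

theorem integrable_of_abs_le {α : Type*} [MeasurableSpace α] {μ : Measure α} [IsFiniteMeasure μ]
    {f : α → ℝ} (hf : AEStronglyMeasurable f μ) {M : ℝ} (h : ∀ᵐ x ∂μ, |f x| ≤ M) :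
    Integrable f μ :=
  Integrable.of_bound hf M h

theorem integrable_stepKernel (D : Fin N → Fin N → ℝ) : Integrable (stepKernel D) volume := by
  obtain ⟨M, hM⟩ : ∃ M, ∀ i j, |D i j| ≤ M :=
    ⟨∑ i, ∑ j, |D i j|, fun i j => (Finset.single_le_sum (f := fun j => |D i j|)
      (fun _ _ => abs_nonneg _) (Finset.mem_univ j)).trans
      (Finset.single_le_sum (f := fun i => ∑ j, |D i j|)
        (fun _ _ => Finset.sum_nonneg fun _ _ => abs_nonneg _) (Finset.mem_univ i))⟩
  exact integrable_of_abs_le (measurable_stepKernel D).aestronglyMeasurable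
    (ae_of_all _ fun z => hM _ _)

theorem setIntegral_stepKernel (D : Fin N → Fin N → ℝ) {S T : Set unitInterval}
    (hS : MeasurableSet S) (hT : MeasurableSet T) :
    ∫ z in S ×ˢ T, stepKernel D z = ∑ i, ∑ j,
      (volume : Measure unitInterval).real (S ∩ cell N ⁻¹' {i}) *
      (volume : Measure unitInterval).real (T ∩ cell N ⁻¹' {j}) * D i j := by
  have hc : ∀ (A : Set unitInterval), MeasurableSet A → ∀ i : Fin N,
      MeasurableSet (A ∩ cell N ⁻¹' {i}) := fun A hA i =>
    hA.inter (measurable_cell (measurableSet_singleton i))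
  have e : ∀ z ∈ S ×ˢ T, stepKernel D z = ∑ i, ∑ j,
      ((S ∩ cell N ⁻¹' {i}) ×ˢ (T ∩ cell N ⁻¹' {j})).indicator (fun _ => D i j) z := by
    rintro ⟨x, y⟩ ⟨hx, hy⟩
    rw [Finset.sum_eq_single (cell N x), Finset.sum_eq_single (cell N y)]
    · rw [Set.indicator_of_mem]
      · rfl
      · exact ⟨⟨hx, rfl⟩, hy, rfl⟩
    · intro j _ hj
      exact Set.indicator_of_notMem (fun h => hj h.2.2.symm) _
    · simp
    · intro i _ hi
      exact Finset.sum_eq_zero fun j _ => Set.indicator_of_notMem (fun h => hi h.1.2.symm) _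
    · simp
  rw [setIntegral_congr_fun (hS.prod hT) e, integral_finsetSum]
  · refine Finset.sum_congr rfl fun i _ => ?_
    rw [integral_finsetSum]
    · refine Finset.sum_congr rfl fun j _ => ?_
      rw [setIntegral_indicator ((hc S hS i).prod (hc T hT j)), setIntegral_const,
        Set.inter_eq_self_of_subset_right
          (Set.prod_mono Set.inter_subset_left Set.inter_subset_left), smul_eq_mul,
        Measure.volume_eq_prod, measureReal_prod_prod]
    · intro j _
      exact (integrable_const _).indicator ((hc S hS i).prod (hc T hT j))
  · intro i _
    refine integrable_finsetSum _ fun j _ => ?_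
    exact (integrable_const _).indicator ((hc S hS i).prod (hc T hT j))

/-- Arbitrary measurable `S` and `T` enter only through the fractions of the cells that they fill,
which are weights in `[0,1]`. -/
theorem CutLE.abs_setIntegral_stepKernel_le {D : Fin N → Fin N → ℝ} {ε : ℝ} (h : CutLE D ε)
    {S T : Set unitInterval} (hS : MeasurableSet S) (hT : MeasurableSet T) :
    |∫ z in S ×ˢ T, stepKernel D z| ≤ ε := by
  have hN : (0 : ℝ) < N := Nat.cast_pos.2 (NeZero.pos N)
  have hle : ∀ (A : Set unitInterval) (i : Fin N),
      N * (volume : Measure unitInterval).real (A ∩ cell N ⁻¹' {i}) ≤ 1 := by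
    intro A i
    have := measureReal_mono (μ := (volume : Measure unitInterval))
      (Set.inter_subset_right : A ∩ cell N ⁻¹' {i} ⊆ _)
    rw [volume_cell, le_div_iff₀ hN] at this
    linarith
  have hw := h.weighted (fun i => N * (volume : Measure unitInterval).real (S ∩ cell N ⁻¹' {i}))
    (fun i => N * (volume : Measure unitInterval).real (T ∩ cell N ⁻¹' {i}))
    (fun i => by positivity) (hle S) (fun i => by positivity) (hle T)
  rw [setIntegral_stepKernel D hS hT]
  have e : ∑ i, ∑ j, N * (volume : Measure unitInterval).real (S ∩ cell N ⁻¹' {i}) *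
      (N * (volume : Measure unitInterval).real (T ∩ cell N ⁻¹' {j})) * D i j =
      (N : ℝ) ^ 2 * ∑ i, ∑ j, (volume : Measure unitInterval).real (S ∩ cell N ⁻¹' {i}) *
      (volume : Measure unitInterval).real (T ∩ cell N ⁻¹' {j}) * D i j := by
    simp only [Finset.mul_sum]
    exact Finset.sum_congr rfl fun i _ => Finset.sum_congr rfl fun j _ => by ring
  rw [e, abs_mul, abs_of_pos (by positivity), Fintype.card_fin, mul_comm] at hw
  exact le_of_mul_le_mul_right hw (by positivity)

theorem abs_setIntegral_sub_le {α : Type*} [MeasurableSpace α] {μ : Measure α} {f g : α → ℝ}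
    (hf : Integrable f μ) (hg : Integrable g μ) (S : Set α) :
    |∫ z in S, f z ∂μ - ∫ z in S, g z ∂μ| ≤ ∫ z, |f z - g z| ∂μ := by
  rw [← integral_sub hf.integrableOn hg.integrableOn]
  refine (abs_integral_le_integral_abs).trans ?_
  exact setIntegral_le_integral (hf.sub hg).abs (ae_of_all _ fun _ => abs_nonneg _)

/-- It suffices to test on unions of cells. -/
theorem cutLE_of_setIntegral_stepKernel {D : Fin N → Fin N → ℝ} {ε : ℝ}
    (h : ∀ S T : Set unitInterval, MeasurableSet S → MeasurableSet T →
      |∫ z in S ×ˢ T, stepKernel D z| ≤ ε) : CutLE D ε := by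
  classical
  have hN : (0 : ℝ) < N := Nat.cast_pos.2 (NeZero.pos N)
  intro S T
  have hm : ∀ S : Finset (Fin N), MeasurableSet (cell N ⁻¹' (S : Set (Fin N))) := fun S =>
    measurable_cell (Finset.measurableSet S)
  have hv : ∀ (S : Finset (Fin N)) (i : Fin N), (volume : Measure unitInterval).real
      (cell N ⁻¹' (S : Set (Fin N)) ∩ cell N ⁻¹' {i}) = if i ∈ S then 1 / (N : ℝ) else 0 := by
    intro S i
    split_ifs with hi
    · rw [Set.inter_eq_self_of_subset_right, volume_cell]
      exact Set.preimage_mono (by simpa using hi)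
    · have : cell N ⁻¹' (S : Set (Fin N)) ∩ cell N ⁻¹' {i} = ∅ := by
        ext x
        simp only [Set.mem_inter_iff, Set.mem_preimage, Finset.mem_coe, Set.mem_singleton_iff,
          Set.mem_empty_iff_false, iff_false, not_and]
        rintro hx rfl
        exact hi hx
      rw [this, measureReal_empty]
  have := h _ _ (hm S) (hm T)
  rw [setIntegral_stepKernel D (hm S) (hm T)] at this
  simp only [hv] at this
  have e : ∑ i, ∑ j, (if i ∈ S then 1 / (N : ℝ) else 0) * (if j ∈ T then 1 / (N : ℝ) else 0) *
      D i j = (∑ i ∈ S, ∑ j ∈ T, D i j) / (N : ℝ) ^ 2 := by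
    rw [Finset.sum_div, ← Finset.sum_subset (Finset.subset_univ S)]
    · refine Finset.sum_congr rfl fun i hi => ?_
      rw [Finset.sum_div, ← Finset.sum_subset (Finset.subset_univ T)]
      · refine Finset.sum_congr rfl fun j hj => ?_
        rw [if_pos hi, if_pos hj]
        ring
      · intro j _ hj; simp [hj]
    · intro i _ hi; simp [hi]
  rw [e, abs_div, abs_of_pos (by positivity : (0 : ℝ) < (N : ℝ) ^ 2),
    div_le_iff₀ (by positivity)] at this
  rwa [Fintype.card_fin]

end StepKernels

/-- Every bounded kernel is approximated in `L¹` by step kernels on all fine equipartitions. -/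
theorem exists_stepKernel_approx {u : unitInterval × unitInterval → ℝ}
    (hu : AEStronglyMeasurable u volume) {M : ℝ} (hM : 0 ≤ M) (hb : ∀ᵐ z, |u z| ≤ M) {η : ℝ}
    (hη : 0 < η) : ∃ N₀ : ℕ, ∀ N [NeZero N], N₀ ≤ N → ∃ D : Fin N → Fin N → ℝ,
      (∀ i j, |D i j| ≤ M) ∧ ∫ z, |u z - stepKernel D z| ≤ η := by
  have hui : Integrable u volume := integrable_of_abs_le hu hb
  obtain ⟨g₀, hg₀, hg₀i⟩ := hui.exists_boundedContinuous_integral_sub_le (half_pos hη)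
  -- Clipping to `[-M, M]` gives the step values the bound `M` and does not increase the distance to
  -- `u`, whose values already lie there almost everywhere.
  let g : unitInterval × unitInterval → ℝ := fun z => max (-M) (min (g₀ z) M)
  have hgc : Continuous g := continuous_const.max (g₀.continuous.min continuous_const)
  have hgM : ∀ z, |g z| ≤ M := fun z =>
    abs_le.2 ⟨le_max_left _ _, max_le (by linarith) (min_le_right _ _)⟩
  have hgi : Integrable g volume := integrable_of_abs_le hgc.aestronglyMeasurable
    (ae_of_all _ hgM)
  have hug : ∫ z, |u z - g z| ≤ η / 2 := by
    refine le_trans (integral_mono_ae (hui.sub hgi).abs (hui.sub hg₀i).norm ?_) hg₀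
    filter_upwards [hb] with z hz
    change |u z - max (-M) (min (g₀ z) M)| ≤ |u z - g₀ z|
    have h1 := abs_le.1 hz
    rcases le_total (g₀ z) M with h2 | h2
    · rw [min_eq_left h2]
      rcases le_total (-M) (g₀ z) with h3 | h3
      · rw [max_eq_right h3]
      · rw [max_eq_left h3]
        rw [abs_of_nonneg (by linarith), abs_of_nonneg (by linarith)]
        linarith
    · rw [min_eq_right h2, max_eq_right (by linarith)]
      rw [abs_of_nonpos (by linarith), abs_of_nonpos (by linarith)]
      linarith
  obtain ⟨δ, hδ, hgu⟩ := Metric.uniformContinuous_iff.1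
    (CompactSpace.uniformContinuous_of_continuous hgc) (η / 2) (half_pos hη)
  obtain ⟨N₀, hN₀⟩ := exists_nat_gt (1 / δ)
  refine ⟨N₀, fun N _ hN => ?_⟩
  have hNpos : (0 : ℝ) < N := Nat.cast_pos.2 (NeZero.pos N)
  have hNδ : 1 / (N : ℝ) < δ := by
    have : 1 / δ < N := hN₀.trans_le (by exact_mod_cast hN)
    rw [div_lt_iff₀ hδ] at this
    rw [div_lt_iff₀ hNpos]
    linarith
  -- Left endpoints of the cells: each lies within `1 / N < δ` of every point of its cell other than
  -- `x = 1`, which is null.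
  let pt : Fin N → unitInterval := fun i => ⟨(i : ℝ) / N, by positivity, by
    rw [div_le_one hNpos]; exact_mod_cast i.2.le⟩
  have hpt : ∀ x : unitInterval, x ≠ 1 → dist x (pt (cell N x)) < δ := by
    intro x hx
    have h1 := cell_le (N := N) hx
    have h2 := lt_cell_add_one (N := N) hx
    rw [Subtype.dist_eq, Real.dist_eq]
    have e : (x : ℝ) - (pt (cell N x) : ℝ) = (N * x - cell N x) / N := by
      simp only [pt]; field_simp
    rw [e, abs_of_nonneg (div_nonneg (by linarith) hNpos.le)]
    refine lt_of_le_of_lt ?_ hNδ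
    exact div_le_div_of_nonneg_right (by linarith) hNpos.le
  refine ⟨fun i j => g (pt i, pt j), fun i j => hgM _, ?_⟩
  have hsi := integrable_stepKernel (fun i j => g (pt i, pt j))
  have hgs : ∫ z, |g z - stepKernel (fun i j => g (pt i, pt j)) z| ≤ η / 2 := by
    have hne : ∀ᵐ z : unitInterval × unitInterval, z.1 ≠ 1 ∧ z.2 ≠ 1 := by
      have h1 : ∀ᵐ x : unitInterval, x ≠ 1 := by rw [ae_iff]; simp
      have a := (Measure.quasiMeasurePreserving_fst (μ := (volume : Measure unitInterval))
        (ν := (volume : Measure unitInterval))).ae h1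
      have b := (Measure.quasiMeasurePreserving_snd (μ := (volume : Measure unitInterval))
        (ν := (volume : Measure unitInterval))).ae h1
      exact a.and b
    calc ∫ z, |g z - stepKernel (fun i j => g (pt i, pt j)) z| ≤
          ∫ _z : unitInterval × unitInterval, η / 2 := by
          refine integral_mono_ae (hgi.sub hsi).abs (integrable_const _) ?_
          filter_upwards [hne] with z hz
          have hd : dist z (pt (cell N z.1), pt (cell N z.2)) < δ :=
            max_lt (hpt _ hz.1) (hpt _ hz.2)
          have := hgu hd
          rw [Real.dist_eq] at this
          exact this.le
      _ = η / 2 := by simp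
  calc ∫ z, |u z - stepKernel (fun i j => g (pt i, pt j)) z| ≤
        ∫ z, (|u z - g z| + |g z - stepKernel (fun i j => g (pt i, pt j)) z|) := by
        refine integral_mono (hui.sub hsi).abs ((hui.sub hgi).abs.add (hgi.sub hsi).abs) ?_
        intro z
        exact abs_sub_le _ _ _
    _ = (∫ z, |u z - g z|) + ∫ z, |g z - stepKernel (fun i j => g (pt i, pt j)) z| :=
        integral_add (hui.sub hgi).abs (hgi.sub hsi).abs
    _ ≤ η := by linarith

/-! ### Densities of kernels -/

section KernelMoment

variable {V : Type*} [Fintype V]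

theorem measurePreserving_pair {i j : V} (hij : i ≠ j) :
    MeasurePreserving (fun ξ : V → unitInterval => (ξ i, ξ j)) volume volume := by
  have hind := ProbabilityTheory.iIndepFun_pi (ι := V)
    (μ := fun _ : V => (volume : Measure unitInterval)) (X := fun _ x => x)
    (fun _ => aemeasurable_id)
  have h2 := (ProbabilityTheory.indepFun_iff_map_prod_eq_prod_map_map
    (measurable_pi_apply i).aemeasurable (measurable_pi_apply j).aemeasurable).1
      (hind.indepFun hij)
  refine ⟨(measurable_pi_apply i).prodMk (measurable_pi_apply j), ?_⟩
  have hm : ∀ i : V, Measure.map (fun ξ : V → unitInterval => ξ i)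
      (Measure.pi fun _ => (volume : Measure unitInterval)) = volume := fun i =>
    (measurePreserving_eval (fun _ : V => (volume : Measure unitInterval)) i).map_eq
  rw [hm i, hm j] at h2
  exact h2

/-- Transfers almost everywhere statements and integrals from the square to edge coordinates; the
absence of loops is what makes the two coordinates independent. -/
theorem measurePreserving_edge (F : OrientedSimpleGraph V) {e : V × V} (he : e ∈ F.edges) :
    MeasurePreserving (fun ξ : V → unitInterval => (ξ e.1, ξ e.2)) volume volume := by
  refine measurePreserving_pair fun h => ?_
  obtain ⟨i, j⟩ := e
  obtain rfl : i = j := h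
  exact F.oriented i i he he

/-- The density of the oriented graph `F`, the edge `e` carrying the scalar kernel `u e`. -/
def kernelMoment (F : OrientedSimpleGraph V) (u : V × V → unitInterval × unitInterval → ℝ) : ℝ :=
  ∫ ξ : V → unitInterval, ∏ e ∈ F.edges, u e (ξ e.1, ξ e.2)

/-- The factors are exchanged one at a time; this makes densities of bounded kernels Lipschitz in
`L¹`. -/
theorem abs_prod_sub_prod_le {ι : Type*} (s : Finset ι) (f g : ι → ℝ) {M : ℝ} (hM : 1 ≤ M)
    (hf : ∀ e ∈ s, |f e| ≤ M) (hg : ∀ e ∈ s, |g e| ≤ M) :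
    |∏ e ∈ s, f e - ∏ e ∈ s, g e| ≤ M ^ s.card * ∑ e ∈ s, |f e - g e| := by
  classical
  induction s using Finset.induction_on with
  | empty => simp
  | insert a s ha ih =>
    have ih' := ih (fun e he => hf e (Finset.mem_insert_of_mem he))
      (fun e he => hg e (Finset.mem_insert_of_mem he))
    rw [Finset.prod_insert ha, Finset.prod_insert ha, Finset.sum_insert ha,
      Finset.card_insert_of_notMem ha]
    have e : f a * ∏ e ∈ s, f e - g a * ∏ e ∈ s, g e =
        f a * (∏ e ∈ s, f e - ∏ e ∈ s, g e) + (f a - g a) * ∏ e ∈ s, g e := by ring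
    have h1 := hf a (Finset.mem_insert_self _ _)
    have h2 : |∏ e ∈ s, g e| ≤ M ^ (s.card + 1) := abs_prod_le_pow s g hM
      (fun e he => hg e (Finset.mem_insert_of_mem he)) (Nat.le_succ _)
    rw [e]
    refine (abs_add_le _ _).trans ?_
    rw [abs_mul, abs_mul]
    have hM0 : 0 ≤ M := by linarith
    calc _ ≤ M * (M ^ s.card * ∑ e ∈ s, |f e - g e|) + |f a - g a| * M ^ (s.card + 1) := by
          gcongr
      _ = _ := by ring

theorem ae_edge_le (F : OrientedSimpleGraph V) {u : V × V → unitInterval × unitInterval → ℝ}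
    {M : ℝ} (hb : ∀ e ∈ F.edges, ∀ᵐ z, |u e z| ≤ M) :
    ∀ᵐ ξ : V → unitInterval, ∀ e ∈ F.edges, |u e (ξ e.1, ξ e.2)| ≤ M := by
  rw [Filter.eventually_all_finset]
  intro e he
  exact (measurePreserving_edge F he).quasiMeasurePreserving.ae (hb e he)

theorem aestronglyMeasurable_edge_prod (F : OrientedSimpleGraph V)
    {u : V × V → unitInterval × unitInterval → ℝ}
    (hu : ∀ e ∈ F.edges, AEStronglyMeasurable (u e) volume) :
    AEStronglyMeasurable (fun ξ : V → unitInterval => ∏ e ∈ F.edges, u e (ξ e.1, ξ e.2))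
      volume := by
  refine Finset.aestronglyMeasurable_fun_prod _ fun e he => ?_
  exact (hu e he).comp_measurePreserving (measurePreserving_edge F he)

theorem integrable_edge_prod (F : OrientedSimpleGraph V)
    {u : V × V → unitInterval × unitInterval → ℝ} {M : ℝ} (hM : 1 ≤ M)
    (hu : ∀ e ∈ F.edges, AEStronglyMeasurable (u e) volume)
    (hb : ∀ e ∈ F.edges, ∀ᵐ z, |u e z| ≤ M) :
    Integrable (fun ξ : V → unitInterval => ∏ e ∈ F.edges, u e (ξ e.1, ξ e.2)) volume := by
  refine integrable_of_abs_le (aestronglyMeasurable_edge_prod F hu) (M := M ^ F.edges.card) ?_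
  filter_upwards [ae_edge_le F hb] with ξ hξ
  exact abs_prod_le_pow _ _ hM hξ le_rfl

theorem abs_kernelMoment_sub_le (F : OrientedSimpleGraph V)
    {u u' : V × V → unitInterval × unitInterval → ℝ} {M : ℝ} (hM : 1 ≤ M)
    (hu : ∀ e ∈ F.edges, AEStronglyMeasurable (u e) volume)
    (hb : ∀ e ∈ F.edges, ∀ᵐ z, |u e z| ≤ M)
    (hu' : ∀ e ∈ F.edges, AEStronglyMeasurable (u' e) volume)
    (hb' : ∀ e ∈ F.edges, ∀ᵐ z, |u' e z| ≤ M) :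
    |kernelMoment F u - kernelMoment F u'| ≤
      M ^ F.edges.card * ∑ e ∈ F.edges, ∫ z, |u e z - u' e z| := by
  have hi := integrable_edge_prod F hM hu hb
  have hi' := integrable_edge_prod F hM hu' hb'
  have hd : ∀ e ∈ F.edges, Integrable (fun z => |u e z - u' e z|) volume := fun e he =>
    ((integrable_of_abs_le (hu e he) (hb e he)).sub
      (integrable_of_abs_le (hu' e he) (hb' e he))).abs
  have hd' : ∀ e ∈ F.edges, Integrable (fun ξ : V → unitInterval =>
      |u e (ξ e.1, ξ e.2) - u' e (ξ e.1, ξ e.2)|) volume := fun e he =>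
    (measurePreserving_edge F he).integrable_comp_of_integrable (hd e he)
  unfold kernelMoment
  rw [← integral_sub hi hi']
  refine abs_integral_le_integral_abs.trans ?_
  calc _ ≤ ∫ ξ : V → unitInterval, M ^ F.edges.card *
        ∑ e ∈ F.edges, |u e (ξ e.1, ξ e.2) - u' e (ξ e.1, ξ e.2)| := by
        refine integral_mono_ae (hi.sub hi').abs
          ((integrable_finsetSum _ hd').const_mul _) ?_
        filter_upwards [ae_edge_le F hb, ae_edge_le F hb'] with ξ h h'
        exact abs_prod_sub_prod_le F.edges (fun e => u e (ξ e.1, ξ e.2))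
          (fun e => u' e (ξ e.1, ξ e.2)) hM h h'
    _ = _ := by
        rw [integral_const_mul, integral_finsetSum _ hd']
        congr 1
        refine Finset.sum_congr rfl fun e he => ?_
        have hmp := measurePreserving_edge F he
        rw [← hmp.map_eq, integral_map hmp.measurable.aemeasurable]
        rw [hmp.map_eq]
        exact (hd e he).aestronglyMeasurable

/-- `cell N` pushes Lebesgue measure to the uniform law on `Fin N`, independently in each vertex. -/
theorem kernelMoment_stepKernel [DecidableEq V] (F : OrientedSimpleGraph V) {N : ℕ} [NeZero N]
    (D : V × V → Fin N → Fin N → ℝ) :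
    kernelMoment F (fun e => stepKernel (D e)) = moment F D := by
  let ν : Measure (Fin N) := Measure.map (cell N) volume
  have hν : IsProbabilityMeasure ν := Measure.isProbabilityMeasure_map measurable_cell.aemeasurable
  have hmp : MeasurePreserving (fun (ξ : V → unitInterval) i => cell N (ξ i)) volume
      (Measure.pi fun _ => ν) :=
    measurePreserving_pi (fun _ : V => (volume : Measure unitInterval)) (fun _ => ν)
      fun _ => ⟨measurable_cell, rfl⟩
  have h1 : kernelMoment F (fun e => stepKernel (D e)) =
      ∫ x, ∏ e ∈ F.edges, D e (x e.1) (x e.2) ∂(Measure.pi fun _ : V => ν) := by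
    rw [← hmp.map_eq, integral_map hmp.measurable.aemeasurable]
    · rfl
    · exact (measurable_of_finite _).aestronglyMeasurable
  rw [h1, integral_fintype (Integrable.of_finite), moment, Fintype.expect_eq_sum_div_card,
    Finset.sum_div]
  refine Finset.sum_congr rfl fun x _ => ?_
  rw [measureReal_def, Measure.pi_singleton, ENNReal.toReal_prod]
  have : ∀ i : Fin N, (ν {i}).toReal = 1 / N := by
    intro i
    rw [Measure.map_apply measurable_cell (measurableSet_singleton i)]
    exact volume_cell i
  simp only [this, Finset.prod_const, Finset.card_univ, smul_eq_mul, Fintype.card_fun,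
    Fintype.card_fin]
  push_cast
  rw [one_div, inv_pow]
  ring

end KernelMoment

/-! ### Counting and inverse counting for tuples of scalar kernels on the square. -/

section ScalarKernels

theorem MeasureTheory.MeasurePreserving.prodMap_self {φ : unitInterval → unitInterval}
    (h : MeasurePreserving φ volume volume) :
    MeasurePreserving (fun z : unitInterval × unitInterval => (φ z.1, φ z.2)) volume volume :=
  h.prod h

/-- Counting lemma for tuples of scalar kernels. -/
theorem abs_kernelMoment_sub_le_of_cut {V : Type*} [Fintype V] [DecidableEq V]
    (F : OrientedSimpleGraph V)
    {u u' : V × V → unitInterval × unitInterval → ℝ} {M ε : ℝ} (hM : 1 ≤ M)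
    (hu : ∀ e ∈ F.edges, AEStronglyMeasurable (u e) volume)
    (hb : ∀ e ∈ F.edges, ∀ᵐ z, |u e z| ≤ M)
    (hu' : ∀ e ∈ F.edges, AEStronglyMeasurable (u' e) volume)
    (hb' : ∀ e ∈ F.edges, ∀ᵐ z, |u' e z| ≤ M)
    (hcut : ∀ e ∈ F.edges, ∀ S T : Set unitInterval, MeasurableSet S → MeasurableSet T →
      |∫ z in S ×ˢ T, (u e z - u' e z)| ≤ ε) :
    |kernelMoment F u - kernelMoment F u'| ≤ F.edges.card * (4 * M ^ (2 * F.edges.card) * ε) := by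
  set E : ℝ := (F.edges.card : ℝ) with hE
  have hM0 : 0 ≤ M := by linarith
  have hE0 : 0 ≤ E := Nat.cast_nonneg _
  -- The finite counting lemma applied to step approximations of accuracy `η`; the coefficient of
  -- `η` is independent of `η`, which then tends to 0.
  have key : ∀ η > 0, |kernelMoment F u - kernelMoment F u'| ≤
      E * (4 * M ^ (2 * F.edges.card) * ε) +
        (2 * (M ^ F.edges.card * (E * 1)) + E * (4 * M ^ (2 * F.edges.card) * 2)) * η := by
    intro η hη
    choose! N₀ h₀ using fun e (he : e ∈ F.edges) =>
      exists_stepKernel_approx (hu e he) hM0 (hb e he) hη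
    choose! N₁ h₁ using fun e (he : e ∈ F.edges) =>
      exists_stepKernel_approx (hu' e he) hM0 (hb' e he) hη
    let N := F.edges.sup N₀ + F.edges.sup N₁ + 1
    have : NeZero N := ⟨Nat.succ_ne_zero _⟩
    have hN₀ : ∀ e ∈ F.edges, N₀ e ≤ N := fun e he => (Finset.le_sup he).trans (by omega)
    have hN₁ : ∀ e ∈ F.edges, N₁ e ≤ N := fun e he => (Finset.le_sup he).trans (by omega)
    choose! D hD hDη using fun e he => h₀ e he N (hN₀ e he)
    choose! D' hD' hDη' using fun e he => h₁ e he N (hN₁ e he)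
    have hcutD : ∀ e ∈ F.edges, CutLE (fun x y => D e x y - D' e x y) (ε + 2 * η) := by
      intro e he
      refine cutLE_of_setIntegral_stepKernel fun S T hS hT => ?_
      have i1 := integrable_stepKernel (D e)
      have i2 := integrable_stepKernel (D' e)
      have j1 := integrable_of_abs_le (hu e he) (hb e he)
      have j2 := integrable_of_abs_le (hu' e he) (hb' e he)
      have a1 := (abs_setIntegral_sub_le j1 i1 (S ×ˢ T)).trans (hDη e he)
      have a2 := (abs_setIntegral_sub_le j2 i2 (S ×ˢ T)).trans (hDη' e he)
      have a3 := hcut e he S T hS hT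
      rw [integral_sub j1.integrableOn j2.integrableOn] at a3
      have e1 : ∫ z in S ×ˢ T, stepKernel (fun x y => D e x y - D' e x y) z =
          (∫ z in S ×ˢ T, stepKernel (D e) z) - ∫ z in S ×ˢ T, stepKernel (D' e) z :=
        integral_sub i1.integrableOn i2.integrableOn
      rw [e1]
      rw [abs_le] at *
      constructor <;> linarith
    have b1 := abs_kernelMoment_sub_le F (u' := fun e => stepKernel (D e)) hM hu hb
      (fun e _ => (measurable_stepKernel (D e)).aestronglyMeasurable)
      (fun e he => ae_of_all _ fun z => hD e he _ _)
    have b2 := abs_kernelMoment_sub_le F (u' := fun e => stepKernel (D' e)) hM hu' hb'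
      (fun e _ => (measurable_stepKernel (D' e)).aestronglyMeasurable)
      (fun e he => ae_of_all _ fun z => hD' e he _ _)
    have c1 : ∑ e ∈ F.edges, ∫ z, |u e z - stepKernel (D e) z| ≤ E * η := by
      refine (Finset.sum_le_sum hDη).trans ?_
      simp [hE]
    have c2 : ∑ e ∈ F.edges, ∫ z, |u' e z - stepKernel (D' e) z| ≤ E * η := by
      refine (Finset.sum_le_sum hDη').trans ?_
      simp [hE]
    replace b1 := b1.trans (mul_le_mul_of_nonneg_left c1 (by positivity))
    replace b2 := b2.trans (mul_le_mul_of_nonneg_left c2 (by positivity))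
    have b3 := abs_moment_sub_le F hM hD hD' hcutD
    rw [kernelMoment_stepKernel] at b1 b2
    have : |kernelMoment F u - kernelMoment F u'| ≤
        |kernelMoment F u - moment F D| + |moment F D - moment F D'| +
          |kernelMoment F u' - moment F D'| := by
      have h1 := abs_sub_le (kernelMoment F u) (moment F D) (kernelMoment F u')
      have h2 := abs_sub_le (moment F D) (moment F D') (kernelMoment F u')
      rw [abs_sub_comm (moment F D') (kernelMoment F u')] at h2
      linarith
    refine this.trans ((add_le_add (add_le_add b1 b3) b2).trans (le_of_eq ?_))
    ring
  refine le_of_forall_pos_le_add fun t ht => ?_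
  set C := 2 * (M ^ F.edges.card * (E * 1)) + E * (4 * M ^ (2 * F.edges.card) * 2) with hC
  have hC0 : 0 ≤ C := by positivity
  refine (key (t / (C + 1)) (by positivity)).trans ?_
  gcongr
  rw [← mul_div_assoc, div_le_iff₀ (by positivity)]
  nlinarith

theorem card_filter_finProdFinEquiv (k r : ℕ) (i : Fin k) :
    (Finset.univ.filter fun y : Fin (k * r) => (finProdFinEquiv.symm y).1 = i).card = r := by
  have : (Finset.univ.filter fun y : Fin (k * r) => (finProdFinEquiv.symm y).1 = i) =
      (Finset.univ : Finset (Fin r)).map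
        ((Function.Embedding.sectR i (Fin r)).trans finProdFinEquiv.toEmbedding) := by
    ext y
    simp only [Finset.mem_filter, Finset.mem_univ, true_and, Finset.mem_map,
      Function.Embedding.trans_apply, Equiv.coe_toEmbedding]
    constructor
    · rintro rfl
      exact ⟨(finProdFinEquiv.symm y).2, finProdFinEquiv.apply_symm_apply y⟩
    · rintro ⟨b, rfl⟩
      change (finProdFinEquiv.symm (finProdFinEquiv (i, b))).1 = i
      rw [Equiv.symm_apply_apply]
  rw [this, Finset.card_map, Finset.card_univ, Fintype.card_fin]

/-- Inverse counting lemma for tuples of scalar kernels. -/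
theorem exists_measurePreserving_cut_le (d : ℕ) {M ε : ℝ} (hM : 1 ≤ M) (hε : 0 < ε) :
    ∃ k : ℕ, ∃ η : ℝ, 0 < η ∧ ∀ u u' : Fin d → unitInterval × unitInterval → ℝ,
      (∀ c, AEStronglyMeasurable (u c) volume) → (∀ c, ∀ᵐ z, |u c z| ≤ M) →
      (∀ c, AEStronglyMeasurable (u' c) volume) → (∀ c, ∀ᵐ z, |u' c z| ≤ M) →
      (∀ (F : OrientedSimpleGraph (Fin k)) (c : Fin k × Fin k → Fin d),
        |kernelMoment F (fun e => u (c e)) - kernelMoment F (fun e => u' (c e))| ≤ η) →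
      ∃ φ : unitInterval ≃ᵐ unitInterval, MeasurePreserving φ volume volume ∧
        ∀ c, ∀ S T : Set unitInterval, MeasurableSet S → MeasurableSet T →
          |∫ z in S ×ˢ T, (u c z - u' c (φ z.1, φ z.2))| ≤ ε := by
  obtain ⟨k, hk, η, hη, H⟩ := exists_perm_cutLE_of_moment d (one_pos.trans_le hM) (half_pos hε)
  refine ⟨k, η / 2, half_pos hη, fun u u' hu hb hu' hb' hmom => ?_⟩
  have hM0 : 0 ≤ M := by linarith
  set K : ℝ := M ^ (k * k) * (k * k : ℕ) with hK
  have hK0 : 0 ≤ K := by positivity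
  -- Two discretizations cost `2 * t ≤ ε / 2` in cut norm, beside the `ε / 2` of the finite lemma.
  -- Each also moves a density by at most `K * t ≤ η / 4`, beside the assumed `η / 2`.
  set t : ℝ := min (ε / 4) (η / (4 * (K + 1))) with ht
  have ht0 : 0 < t := by positivity
  choose N₀ h₀ using fun c => exists_stepKernel_approx (hu c) hM0 (hb c) ht0
  choose N₁ h₁ using fun c => exists_stepKernel_approx (hu' c) hM0 (hb' c) ht0
  let r := Finset.univ.sup N₀ + Finset.univ.sup N₁ + 1
  -- A multiple of `k`, so that `Fin N` maps onto `Fin k` with fibres of equal size `r`.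
  let N := k * r
  have hrN : r ≤ N := Nat.le_mul_of_pos_left r hk
  have hNpos : 0 < N := lt_of_lt_of_le (Nat.succ_pos _) hrN
  have : NeZero N := ⟨hNpos.ne'⟩
  have hN₀ : ∀ c, N₀ c ≤ N := fun c =>
    le_trans ((Finset.le_sup (Finset.mem_univ c)).trans (by omega)) hrN
  have hN₁ : ∀ c, N₁ c ≤ N := fun c =>
    le_trans ((Finset.le_sup (Finset.mem_univ c)).trans (by omega)) hrN
  choose D hD hDt using fun c => h₀ c N (hN₀ c)
  choose D' hD' hDt' using fun c => h₁ c N (hN₁ c)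
  have close : ∀ (u : Fin d → unitInterval × unitInterval → ℝ) (D : Fin d → Fin N → Fin N → ℝ),
      (∀ c, AEStronglyMeasurable (u c) volume) → (∀ c, ∀ᵐ z, |u c z| ≤ M) →
      (∀ c i j, |D c i j| ≤ M) → (∀ c, ∫ z, |u c z - stepKernel (D c) z| ≤ t) →
      ∀ (F : OrientedSimpleGraph (Fin k)) (c : Fin k × Fin k → Fin d),
        |kernelMoment F (fun e => u (c e)) - moment F (fun e => D (c e))| ≤ η / 4 := by
    intro u D hu hb hD hDt F c
    have b := abs_kernelMoment_sub_le F (u := fun e => u (c e))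
      (u' := fun e => stepKernel (D (c e))) hM (fun e _ => hu _) (fun e _ => hb _)
      (fun e _ => (measurable_stepKernel (D (c e))).aestronglyMeasurable)
      (fun e he => ae_of_all _ fun z => hD _ _ _)
    rw [kernelMoment_stepKernel] at b
    refine b.trans ?_
    have hcard : F.edges.card ≤ k * k := by
      simpa using Finset.card_le_univ F.edges
    calc _ ≤ M ^ (k * k) * ((k * k : ℕ) * t) := by
          refine mul_le_mul (pow_le_pow_right₀ hM hcard) ?_
            (Finset.sum_nonneg fun _ _ => integral_nonneg fun _ => abs_nonneg _) (by positivity)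
          refine (Finset.sum_le_sum fun e _ => hDt (c e)).trans ?_
          rw [Finset.sum_const, nsmul_eq_mul]
          gcongr
      _ = K * t := by rw [hK]; ring
      _ ≤ K * (η / (4 * (K + 1))) := by gcongr; exact min_le_right _ _
      _ ≤ η / 4 := by
          rw [← mul_div_assoc, div_le_iff₀ (by positivity)]
          nlinarith
  obtain ⟨σ, hσ⟩ := H (Fin N) (fun y => (finProdFinEquiv.symm y).1) r
    (fun i => by rw [card_filter_finProdFinEquiv k r i]) D D' hD hD' (fun F c => by
      have a1 := close u D hu hb hD hDt F c
      have a2 := close u' D' hu' hb' hD' hDt' F c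
      have a3 := hmom F c
      rw [abs_le] at *
      constructor <;> linarith)
  have hφ := measurePreserving_cellEquiv σ
  have hφ2 := hφ.prodMap_self
  refine ⟨cellEquiv σ, hφ, fun c S T hS hT => ?_⟩
  have i1 := integrable_stepKernel (D c)
  have i2 := integrable_stepKernel (D' c)
  have j1 := integrable_of_abs_le (hu c) (hb c)
  have j2 := integrable_of_abs_le (hu' c) (hb' c)
  have i2' := hφ2.integrable_comp_of_integrable i2
  have j2' := hφ2.integrable_comp_of_integrable j2
  have a1 := (abs_setIntegral_sub_le j1 i1 (S ×ˢ T)).trans (hDt c)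
  have a2 := abs_setIntegral_sub_le j2' i2' (S ×ˢ T)
  have a3 : ∫ z, |(u' c ∘ fun z : unitInterval × unitInterval =>
        (cellEquiv σ z.1, cellEquiv σ z.2)) z -
      (stepKernel (D' c) ∘ fun z : unitInterval × unitInterval =>
        (cellEquiv σ z.1, cellEquiv σ z.2)) z| = ∫ z, |u' c z - stepKernel (D' c) z| := by
    conv_rhs => rw [← hφ2.map_eq]
    rw [integral_map hφ2.measurable.aemeasurable]
    · rfl
    · rw [hφ2.map_eq]
      exact (j2.sub i2).abs.aestronglyMeasurable
  rw [a3] at a2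
  replace a2 := a2.trans (hDt' c)
  have a4 := (hσ c).abs_setIntegral_stepKernel_le hS hT
  have hae : ∀ᵐ z : unitInterval × unitInterval,
      (stepKernel (D' c) ∘ fun z : unitInterval × unitInterval =>
        (cellEquiv σ z.1, cellEquiv σ z.2)) z =
      stepKernel (fun x y => D' c (σ x) (σ y)) z := by
    have h1 := (Measure.quasiMeasurePreserving_fst (μ := (volume : Measure unitInterval))
        (ν := (volume : Measure unitInterval))).ae (cell_cellEquiv_ae σ)
    have h2 := (Measure.quasiMeasurePreserving_snd (μ := (volume : Measure unitInterval))
        (ν := (volume : Measure unitInterval))).ae (cell_cellEquiv_ae σ)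
    filter_upwards [h1, h2] with z hz1 hz2
    simp only [Function.comp, stepKernel, hz1, hz2]
  rw [setIntegral_congr_ae (hS.prod hT) (hae.mono fun z hz _ => hz)] at a2
  have i3 := integrable_stepKernel (fun x y => D' c (σ x) (σ y))
  have e1 : ∫ z in S ×ˢ T, stepKernel (fun x y => D c x y - D' c (σ x) (σ y)) z =
      (∫ z in S ×ˢ T, stepKernel (D c) z) -
        ∫ z in S ×ˢ T, stepKernel (fun x y => D' c (σ x) (σ y)) z :=
    integral_sub i1.integrableOn i3.integrableOn
  have e2 : ∫ z in S ×ˢ T, (u c z - u' c (cellEquiv σ z.1, cellEquiv σ z.2)) =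
      (∫ z in S ×ˢ T, u c z) - ∫ z in S ×ˢ T, (u' c ∘ fun z : unitInterval × unitInterval =>
        (cellEquiv σ z.1, cellEquiv σ z.2)) z :=
    integral_sub j1.integrableOn j2'.integrableOn
  rw [e1] at a4
  rw [e2]
  have ht4 : t ≤ ε / 4 := min_le_left _ _
  rw [abs_le] at *
  constructor <;> linarith

end ScalarKernels

section HilbertKernels

variable {H : Type*} [NormedAddCommGroup H] [InnerProductSpace ℝ H]

/-! ### The elementary tensor as a continuous multilinear map -/

theorem norm_hilbertTprod {S : Type*} [Fintype S] (v : S → H) :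
    ‖hilbertTprod v‖ = ∏ i, ‖v i‖ := by
  have h : ‖hilbertTprod v‖ ^ 2 = (∏ i, ‖v i‖) ^ 2 := by
    rw [← real_inner_self_eq_norm_sq, inner_hilbertTprod, ← Finset.prod_pow]
    exact Finset.prod_congr rfl fun i _ => real_inner_self_eq_norm_sq _
  exact (pow_left_inj₀ (norm_nonneg _) (Finset.prod_nonneg fun _ _ => norm_nonneg _)
    two_ne_zero).1 h

/-- The elementary tensor map `v ↦ ⨂ vᵢ` as a continuous multilinear map. -/
def hilbertTprodL (S H : Type*) [Fintype S] [NormedAddCommGroup H] [InnerProductSpace ℝ H] :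
    ContinuousMultilinearMap ℝ (fun _ : S => H) (HilbertTensorPower S H) :=
  MultilinearMap.mkContinuous
    ((UniformSpace.Completion.toComplL (𝕜 := ℝ) (E := AlgTensorPower S H)).toLinearMap.compMultilinearMap
      (AlgTensorPower.tprod S H)) 1 fun v => by
        rw [one_mul]
        exact (norm_hilbertTprod v).le

theorem hilbertTprodL_apply {S : Type*} [Fintype S] (v : S → H) :
    hilbertTprodL S H v = hilbertTprod v := rfl

theorem norm_hilbertTprodL_le (S : Type*) [Fintype S] : ‖hilbertTprodL S H‖ ≤ 1 :=
  MultilinearMap.mkContinuous_norm_le _ zero_le_one _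

/-! ### Finite-dimensional approximation on compact sets -/

/-- Take an orthonormal basis of the span of a finite `ε`-net: the orthogonal projection is at least
as close as the nearest net point, and it is a contraction. -/
theorem exists_finite_coordinates {K : Set H} (hK : IsCompact K) {ε : ℝ} (hε : 0 < ε) :
    ∃ (d : ℕ) (b : Fin d → H), (∀ c, ‖b c‖ = 1) ∧
      (∀ x ∈ K, ‖x - ∑ c, inner ℝ (b c) x • b c‖ ≤ ε) ∧
      ∀ x, ‖∑ c, inner ℝ (b c) x • b c‖ ≤ ‖x‖ := by
  obtain ⟨t, -, htf, ht⟩ := hK.finite_cover_balls hε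
  let W := Submodule.span ℝ t
  have : FiniteDimensional ℝ W := FiniteDimensional.span_of_finite ℝ htf
  let b := stdOrthonormalBasis ℝ W
  have hP : ∀ x : H, ∑ c, inner ℝ (b c : H) x • (b c : H) = W.starProjection x := by
    intro x
    rw [b.starProjection_eq_sum_rankOne]
    simp
  refine ⟨_, fun c => (b c : H), fun c => ?_, fun x hx => ?_, fun x => ?_⟩
  · exact b.orthonormal.1 c
  · rw [hP, Submodule.starProjection_minimal]
    obtain ⟨y, hy, hxy⟩ := Set.mem_iUnion₂.1 (ht hx)
    refine (ciInf_le ⟨0, ?_⟩ (⟨y, Submodule.subset_span hy⟩ : W)).trans ?_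
    · rintro _ ⟨y, rfl⟩
      exact norm_nonneg _
    · rw [Metric.mem_ball, dist_eq_norm] at hxy
      exact hxy.le
  · rw [hP]
    exact W.norm_starProjection_apply_le x

/-! ### Cut norm -/

theorem cutNorm_nonneg (u : unitInterval × unitInterval → H) : 0 ≤ cutNorm u :=
  Real.sSup_nonneg' ⟨0, ⟨0, ∅, ∅, by simp, MeasurableSet.empty, MeasurableSet.empty, by simp⟩, le_rfl⟩

theorem cutDist_nonneg (u₁ u₂ : unitInterval × unitInterval → H) : 0 ≤ cutDist u₁ u₂ :=
  Real.iInf_nonneg fun _ => cutNorm_nonneg _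

theorem cutDist_le_cutNorm (u₁ u₂ : unitInterval × unitInterval → H)
    {φ : unitInterval → unitInterval} (hφ : Function.Bijective φ)
    (hm : MeasurePreserving φ volume volume) :
    cutDist u₁ u₂ ≤ cutNorm fun z => u₁ z - u₂ (φ z.1, φ z.2) :=
  ciInf_le (f := fun Φ : {Φ : unitInterval → unitInterval //
      Function.Bijective Φ ∧ MeasurePreserving Φ volume volume} =>
      cutNorm fun z => u₁ z - u₂ (Φ.1 z.1, Φ.1 z.2))
    ⟨0, by rintro _ ⟨Φ, rfl⟩; exact cutNorm_nonneg _⟩ ⟨φ, hφ, hm⟩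

theorem exists_cutNorm_lt_of_cutDist_lt {u₁ u₂ : unitInterval × unitInterval → H} {δ : ℝ}
    (h : cutDist u₁ u₂ < δ) : ∃ φ : unitInterval → unitInterval,
      MeasurePreserving φ volume volume ∧ cutNorm (fun z => u₁ z - u₂ (φ z.1, φ z.2)) < δ := by
  have : Nonempty {Φ : unitInterval → unitInterval //
      Function.Bijective Φ ∧ MeasurePreserving Φ volume volume} :=
    ⟨⟨id, Function.bijective_id, MeasurePreserving.id _⟩⟩
  obtain ⟨Φ, hΦ⟩ := exists_lt_of_ciInf_lt h
  exact ⟨Φ.1, Φ.2.2, hΦ⟩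

theorem cutNorm_le {u : unitInterval × unitInterval → H} {δ : ℝ}
    (h : ∀ S T : Set unitInterval, MeasurableSet S → MeasurableSet T →
      ‖∫ z in S ×ˢ T, u z‖ ≤ δ) : cutNorm u ≤ δ := by
  refine Real.sSup_le ?_ ((norm_nonneg _).trans (h ∅ ∅ MeasurableSet.empty MeasurableSet.empty))
  rintro _ ⟨e, S, T, he, hS, hT, rfl⟩
  refine (real_inner_le_norm _ _).trans ?_
  exact (mul_le_of_le_one_left (norm_nonneg _) he).trans (h S T hS hT)

theorem abs_inner_setIntegral_le_cutNorm {u : unitInterval × unitInterval → H}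
    (hu : Integrable u volume) {e : H} (he : ‖e‖ ≤ 1) {S T : Set unitInterval}
    (hS : MeasurableSet S) (hT : MeasurableSet T) :
    |inner ℝ e (∫ z in S ×ˢ T, u z)| ≤ cutNorm u := by
  -- A real `sSup` carries information only for a bounded set; here the `L¹` norm of `u` bounds it.
  -- Testing `-e` then gives the absolute value.
  have hbdd : BddAbove {r : ℝ | ∃ (e : H) (S T : Set unitInterval), ‖e‖ ≤ 1 ∧ MeasurableSet S ∧
      MeasurableSet T ∧ r = inner ℝ e (∫ z in S ×ˢ T, u z)} := by
    refine ⟨∫ z, ‖u z‖, ?_⟩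
    rintro _ ⟨e, S, T, he, -, -, rfl⟩
    refine (real_inner_le_norm _ _).trans ?_
    refine (mul_le_of_le_one_left (norm_nonneg _) he).trans ?_
    refine (norm_integral_le_integral_norm _).trans ?_
    exact setIntegral_le_integral hu.norm (ae_of_all _ fun _ => norm_nonneg _)
  refine abs_le.2 ⟨?_, le_csSup hbdd ⟨e, S, T, he, hS, hT, rfl⟩⟩
  have := le_csSup hbdd ⟨-e, S, T, by rwa [norm_neg], hS, hT, rfl⟩
  rw [inner_neg_left] at this
  exact neg_le.1 this

/-! ### Densities of Hilbert space valued kernels -/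

variable {V : Type*} [Fintype V]

theorem aestronglyMeasurable_hilbertTprod [TopologicalSpace.SeparableSpace H]
    (F : OrientedSimpleGraph V)
    {u : unitInterval × unitInterval → H} (hu : AEStronglyMeasurable u volume) :
    AEStronglyMeasurable (fun ξ : V → unitInterval =>
      hilbertTprod fun e : F.edges => u (ξ e.1.1, ξ e.1.2)) volume := by
  borelize H
  have : SecondCountableTopology H := UniformSpace.secondCountable_of_separable H
  have h : AEMeasurable (fun (ξ : V → unitInterval) (e : F.edges) => u (ξ e.1.1, ξ e.1.2))
      volume := by
    refine aemeasurable_pi_lambda _ fun e => ?_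
    exact (hu.comp_measurePreserving (measurePreserving_edge F e.2)).aemeasurable
  exact (hilbertTprodL F.edges H).cont.comp_aestronglyMeasurable h.aestronglyMeasurable

theorem ae_forall_edge (F : OrientedSimpleGraph V) {p : unitInterval × unitInterval → Prop}
    (hp : ∀ᵐ z, p z) : ∀ᵐ ξ : V → unitInterval, ∀ e : F.edges, p (ξ e.1.1, ξ e.1.2) := by
  rw [ae_all_iff]
  intro e
  exact (measurePreserving_edge F e.2).quasiMeasurePreserving.ae hp

theorem integrable_hilbertTprod [TopologicalSpace.SeparableSpace H] (F : OrientedSimpleGraph V)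
    {u : unitInterval × unitInterval → H} (hu : AEStronglyMeasurable u volume) {M : ℝ}
    (hb : ∀ᵐ z, ‖u z‖ ≤ M) :
    Integrable (fun ξ : V → unitInterval =>
      hilbertTprod fun e : F.edges => u (ξ e.1.1, ξ e.1.2)) volume := by
  refine Integrable.of_bound (aestronglyMeasurable_hilbertTprod F hu) (∏ _e : F.edges, M) ?_
  filter_upwards [ae_forall_edge F hb] with ξ hξ
  rw [norm_hilbertTprod]
  exact Finset.prod_le_prod (fun _ _ => norm_nonneg _) fun e _ => hξ e

/-- The elementary tensor is multilinear of norm at most 1, hence Lipschitz on bounded sets; the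
estimate is integrated over a probability space. -/
theorem norm_homDensity_sub_le [TopologicalSpace.SeparableSpace H] (F : OrientedSimpleGraph V)
    {u v : unitInterval × unitInterval → H} (hu : AEStronglyMeasurable u volume)
    (hv : AEStronglyMeasurable v volume) {M ε : ℝ} (hM : 0 ≤ M) (hε : 0 ≤ ε)
    (hbu : ∀ᵐ z, ‖u z‖ ≤ M) (hbv : ∀ᵐ z, ‖v z‖ ≤ M) (h : ∀ᵐ z, ‖u z - v z‖ ≤ ε) :
    ‖homDensity F u - homDensity F v‖ ≤ F.edges.card * M ^ (F.edges.card - 1) * ε := by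
  unfold homDensity
  rw [← integral_sub (integrable_hilbertTprod F hu hbu) (integrable_hilbertTprod F hv hbv)]
  refine (norm_integral_le_of_norm_le_const (C := F.edges.card * M ^ (F.edges.card - 1) * ε)
    ?_).trans (by simp)
  filter_upwards [ae_forall_edge F hbu, ae_forall_edge F hbv, ae_forall_edge F h] with ξ h1 h2 h3
  have := (hilbertTprodL F.edges H).norm_image_sub_le
    (fun e => u (ξ e.1.1, ξ e.1.2)) (fun e => v (ξ e.1.1, ξ e.1.2))
  rw [hilbertTprodL_apply, hilbertTprodL_apply, Fintype.card_coe] at this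
  refine this.trans ?_
  have n1 := norm_hilbertTprodL_le (H := H) F.edges
  have m1 : max ‖fun e : F.edges => u (ξ e.1.1, ξ e.1.2)‖
      ‖fun e : F.edges => v (ξ e.1.1, ξ e.1.2)‖ ≤ M :=
    max_le ((pi_norm_le_iff_of_nonneg hM).2 h1) ((pi_norm_le_iff_of_nonneg hM).2 h2)
  have d1 : ‖(fun e : F.edges => u (ξ e.1.1, ξ e.1.2)) - fun e => v (ξ e.1.1, ξ e.1.2)‖ ≤ ε :=
    (pi_norm_le_iff_of_nonneg hε).2 h3
  calc _ ≤ 1 * (F.edges.card : ℝ) * M ^ (F.edges.card - 1) * ε := by gcongr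
    _ = _ := by rw [one_mul]

/-- Applying `φ` to every vertex preserves the product measure. -/
theorem homDensity_comp [TopologicalSpace.SeparableSpace H] (F : OrientedSimpleGraph V)
    {u : unitInterval × unitInterval → H} (hu : AEStronglyMeasurable u volume)
    {φ : unitInterval → unitInterval} (hφ : MeasurePreserving φ volume volume) :
    homDensity F (fun z => u (φ z.1, φ z.2)) = homDensity F u := by
  have hpi : MeasurePreserving (fun (ξ : V → unitInterval) i => φ (ξ i)) volume volume :=
    measurePreserving_pi (fun _ : V => (volume : Measure unitInterval))
      (fun _ : V => (volume : Measure unitInterval)) fun _ => hφ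
  unfold homDensity
  conv_rhs => rw [← hpi.map_eq]
  rw [integral_map hpi.measurable.aemeasurable]
  rw [hpi.map_eq]
  exact aestronglyMeasurable_hilbertTprod F hu

theorem abs_inner_le_of_norm_le {b x : H} {M : ℝ} (hb : ‖b‖ = 1) (hx : ‖x‖ ≤ M) :
    |inner ℝ b x| ≤ M := by
  refine (abs_real_inner_le_norm _ _).trans ?_
  rwa [hb, one_mul]

/-- Scalar densities are coordinates of the tensorized density. -/
theorem inner_hilbertTprod_homDensity [TopologicalSpace.SeparableSpace H]
    (F : OrientedSimpleGraph V)
    {u : unitInterval × unitInterval → H} (hu : AEStronglyMeasurable u volume) {M : ℝ}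
    (hbu : ∀ᵐ z, ‖u z‖ ≤ M) (b : V × V → H) :
    inner ℝ (hilbertTprod fun e : F.edges => b e.1) (homDensity F u) =
      kernelMoment F (fun e z => inner ℝ (b e) (u z)) := by
  unfold homDensity kernelMoment
  rw [← integral_inner (integrable_hilbertTprod F hu hbu)]
  refine integral_congr_ae (ae_of_all _ fun ξ => ?_)
  dsimp only
  rw [inner_hilbertTprod]
  exact Finset.prod_coe_sort F.edges fun e => inner ℝ (b e) (u (ξ e.1, ξ e.2))

/-- The density of a kernel with values in the span of finitely many vectors is the tensor whose
coordinates are scalar densities. -/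
theorem homDensity_sum_smul [DecidableEq V] (F : OrientedSimpleGraph V) {d : ℕ}
    (b : Fin d → H) {U : Fin d → unitInterval × unitInterval → ℝ} {M : ℝ} (hM : 1 ≤ M)
    (hU : ∀ c, AEStronglyMeasurable (U c) volume) (hb : ∀ c, ∀ᵐ z, |U c z| ≤ M) :
    homDensity F (fun z => ∑ c, U c z • b c) = ∑ k : F.edges → Fin d,
      kernelMoment F (fun e => if h : e ∈ F.edges then U (k ⟨e, h⟩) else 0) •
        hilbertTprod fun e => b (k e) := by
  have e1 : ∀ ξ : V → unitInterval,
      (hilbertTprod fun e : F.edges => ∑ c, U c (ξ e.1.1, ξ e.1.2) • b c) =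
      ∑ k : F.edges → Fin d, (∏ e ∈ F.edges,
        (if h : e ∈ F.edges then U (k ⟨e, h⟩) else 0) (ξ e.1, ξ e.2)) •
          hilbertTprod fun e => b (k e) := by
    intro ξ
    rw [← hilbertTprodL_apply, ContinuousMultilinearMap.map_sum]
    refine Finset.sum_congr rfl fun k _ => ?_
    rw [ContinuousMultilinearMap.map_smul_univ, hilbertTprodL_apply]
    congr 1
    rw [← Finset.prod_coe_sort F.edges]
    refine Finset.prod_congr rfl fun e _ => ?_
    rw [dif_pos e.2]
  unfold homDensity
  simp only [e1]
  rw [integral_finsetSum]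
  · refine Finset.sum_congr rfl fun k _ => ?_
    rw [integral_smul_const]
    rfl
  · intro k _
    refine Integrable.smul_const ?_ _
    refine integrable_edge_prod F hM (fun e he => ?_) fun e he => ?_
    · rw [dif_pos he]; exact hU _
    · rw [dif_pos he]; exact hb _

end HilbertKernels

/-! ### Passage from tuples of scalar kernels to kernels with values in a compact set. -/

section CompactValues

variable {H : Type*} [NormedAddCommGroup H] [InnerProductSpace ℝ H] [CompleteSpace H]
  [TopologicalSpace.SeparableSpace H]

/-- Counting lemma, uniformly over kernels with values in a fixed compact set. -/
theorem exists_norm_homDensity_sub_le {V : Type*} [Fintype V] (F : OrientedSimpleGraph V)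
    {K : Set H} (hK : IsCompact K) {ε : ℝ} (hε : 0 < ε) :
    ∃ δ : ℝ, 0 < δ ∧ ∀ u u' : unitInterval × unitInterval → H, AEStronglyMeasurable u volume →
      AEStronglyMeasurable u' volume → (∀ᵐ z, u z ∈ K) → (∀ᵐ z, u' z ∈ K) →
      cutNorm (fun z => u z - u' z) ≤ δ → ‖homDensity F u - homDensity F u'‖ ≤ ε := by
  classical
  obtain ⟨M₀, hM₀⟩ := hK.isBounded.exists_norm_le
  set M : ℝ := max M₀ 1
  have hM : 1 ≤ M := le_max_right _ _
  have hKM : ∀ x ∈ K, ‖x‖ ≤ M := fun x hx => (hM₀ x hx).trans (le_max_left _ _)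
  set C : ℝ := F.edges.card * M ^ (F.edges.card - 1) with hC
  have hC0 : 0 ≤ C := by positivity
  obtain ⟨d, b, hb1, hbK, hbn⟩ := exists_finite_coordinates hK
    (show 0 < ε / (4 * (C + 1)) by positivity)
  -- There are `d ^ |edges|` coordinate tensors of norm 1, each with a coefficient controlled by the
  -- scalar counting lemma. The two projections cost `ε / 4` each and the coordinates `ε / 2`.
  set C' : ℝ := (d : ℝ) ^ F.edges.card * (F.edges.card * (4 * M ^ (2 * F.edges.card))) with hC'
  have hC'0 : 0 ≤ C' := by positivity
  refine ⟨ε / (2 * (C' + 1)), by positivity, fun u u' hu hu' hKu hKu' hcut => ?_⟩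
  set δ : ℝ := ε / (2 * (C' + 1)) with hδ
  let U : Fin d → unitInterval × unitInterval → ℝ := fun c z => inner ℝ (b c) (u z)
  let U' : Fin d → unitInterval × unitInterval → ℝ := fun c z => inner ℝ (b c) (u' z)
  have meas : ∀ v : unitInterval × unitInterval → H, AEStronglyMeasurable v volume → ∀ c,
      AEStronglyMeasurable (fun z => (inner ℝ (b c) (v z) : ℝ)) volume := fun v hv c =>
    (innerSL ℝ (b c)).continuous.comp_aestronglyMeasurable hv
  have bound : ∀ v : unitInterval × unitInterval → H, (∀ᵐ z, v z ∈ K) → ∀ c,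
      ∀ᵐ z, |(inner ℝ (b c) (v z) : ℝ)| ≤ M := fun v hv c =>
    hv.mono fun z hz => abs_inner_le_of_norm_le (hb1 c) (hKM _ hz)
  have proj : ∀ v : unitInterval × unitInterval → H, AEStronglyMeasurable v volume →
      (∀ᵐ z, v z ∈ K) →
      ‖homDensity F v - homDensity F (fun z => ∑ c, (inner ℝ (b c) (v z) : ℝ) • b c)‖ ≤
        ε / 4 := by
    intro v hv hKv
    have hbv : ∀ᵐ z, ‖v z‖ ≤ M := hKv.mono fun z hz => hKM _ hz
    refine (norm_homDensity_sub_le F hv ?_ (by linarith)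
      (show 0 ≤ ε / (4 * (C + 1)) by positivity) hbv
      (hbv.mono fun z hz => (hbn _).trans hz) (hKv.mono fun z hz => hbK _ hz)).trans ?_
    · exact Finset.aestronglyMeasurable_fun_sum _ fun c _ => (meas v hv c).smul_const _
    · rw [← hC, ← mul_div_assoc, div_le_iff₀ (by positivity)]
      nlinarith
  have hui : Integrable (fun z => u z - u' z) volume :=
    (Integrable.of_bound hu M (hKu.mono fun z hz => hKM _ hz)).sub
      (Integrable.of_bound hu' M (hKu'.mono fun z hz => hKM _ hz))
  have hUcut : ∀ c, ∀ S T : Set unitInterval, MeasurableSet S → MeasurableSet T →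
      |∫ z in S ×ˢ T, (U c z - U' c z)| ≤ δ := by
    intro c S T hS hT
    have := abs_inner_setIntegral_le_cutNorm hui (hb1 c).le hS hT
    rw [← integral_inner hui.integrableOn] at this
    simp only [inner_sub_right] at this
    exact this.trans hcut
  have hmid : ‖homDensity F (fun z => ∑ c, U c z • b c) -
      homDensity F (fun z => ∑ c, U' c z • b c)‖ ≤ ε / 2 := by
    rw [homDensity_sum_smul F b hM (meas u hu) (bound u hKu),
      homDensity_sum_smul F b hM (meas u' hu') (bound u' hKu'), ← Finset.sum_sub_distrib]
    refine (norm_sum_le _ _).trans ?_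
    have hk : ∀ k : F.edges → Fin d,
        ‖kernelMoment F (fun e => if h : e ∈ F.edges then U (k ⟨e, h⟩) else 0) •
            hilbertTprod (fun e => b (k e)) -
          kernelMoment F (fun e => if h : e ∈ F.edges then U' (k ⟨e, h⟩) else 0) •
            hilbertTprod (fun e => b (k e))‖ ≤
        F.edges.card * (4 * M ^ (2 * F.edges.card) * δ) := by
      intro k
      rw [← sub_smul, norm_smul, norm_hilbertTprod]
      simp only [hb1, Finset.prod_const_one, mul_one, Real.norm_eq_abs]
      refine abs_kernelMoment_sub_le_of_cut F hM ?_ ?_ ?_ ?_ ?_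
      · intro e he; rw [dif_pos he]; exact meas u hu _
      · intro e he; rw [dif_pos he]; exact bound u hKu _
      · intro e he; rw [dif_pos he]; exact meas u' hu' _
      · intro e he; rw [dif_pos he]; exact bound u' hKu' _
      · intro e he; rw [dif_pos he, dif_pos he]; exact hUcut _
    refine (Finset.sum_le_sum fun k _ => hk k).trans ?_
    rw [Finset.sum_const, Finset.card_univ, Fintype.card_fun, Fintype.card_fin, Fintype.card_coe,
      nsmul_eq_mul]
    push_cast
    calc _ = C' * δ := by rw [hC']; ring
      _ ≤ ε / 2 := by
        rw [hδ, ← mul_div_assoc, div_le_iff₀ (by positivity)]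
        nlinarith
  have p1 := proj u hu hKu
  have p2 := proj u' hu' hKu'
  have t1 := norm_sub_le_norm_sub_add_norm_sub (homDensity F u)
    (homDensity F (fun z => ∑ c, U c z • b c)) (homDensity F u')
  have t2 := norm_sub_le_norm_sub_add_norm_sub (homDensity F (fun z => ∑ c, U c z • b c))
    (homDensity F (fun z => ∑ c, U' c z • b c)) (homDensity F u')
  rw [norm_sub_rev (homDensity F fun z => ∑ c, U' c z • b c)] at t2
  linarith

/-- Inverse counting lemma, uniformly over kernels with values in a fixed compact set. -/
theorem exists_cutDist_le {K : Set H} (hK : IsCompact K) {ε : ℝ} (hε : 0 < ε) :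
    ∃ (k : ℕ) (η : ℝ), 0 < η ∧ ∀ u u' : unitInterval × unitInterval → H,
      AEStronglyMeasurable u volume →
      AEStronglyMeasurable u' volume → (∀ᵐ z, u z ∈ K) → (∀ᵐ z, u' z ∈ K) →
      (∀ F : OrientedSimpleGraph (Fin k), ‖homDensity F u - homDensity F u'‖ ≤ η) →
      cutDist u u' ≤ ε := by
  obtain ⟨M₀, hM₀⟩ := hK.isBounded.exists_norm_le
  set M : ℝ := max M₀ 1
  have hM : 1 ≤ M := le_max_right _ _
  have hKM : ∀ x ∈ K, ‖x‖ ≤ M := fun x hx => (hM₀ x hx).trans (le_max_left _ _)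
  -- Projecting `u` and the rearranged `u'` costs `ε / 4` each; the `d` scalar coordinates, at `ε /
  -- (2 * (d + 1))` each, cost at most `ε / 2`.
  obtain ⟨d, b, hb1, hbK, -⟩ := exists_finite_coordinates hK (show 0 < ε / 4 by positivity)
  obtain ⟨k, η, hη, h⟩ := exists_measurePreserving_cut_le d hM
    (show 0 < ε / (2 * (d + 1)) by positivity)
  refine ⟨k, η, hη, fun u u' hu hu' hKu hKu' hmom => ?_⟩
  have meas : ∀ v : unitInterval × unitInterval → H, AEStronglyMeasurable v volume → ∀ c,
      AEStronglyMeasurable (fun z => (inner ℝ (b c) (v z) : ℝ)) volume := fun v hv c =>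
    (innerSL ℝ (b c)).continuous.comp_aestronglyMeasurable hv
  have bound : ∀ v : unitInterval × unitInterval → H, (∀ᵐ z, v z ∈ K) → ∀ c,
      ∀ᵐ z, |(inner ℝ (b c) (v z) : ℝ)| ≤ M := fun v hv c =>
    hv.mono fun z hz => abs_inner_le_of_norm_le (hb1 c) (hKM _ hz)
  have hbu : ∀ᵐ z, ‖u z‖ ≤ M := hKu.mono fun z hz => hKM _ hz
  have hbu' : ∀ᵐ z, ‖u' z‖ ≤ M := hKu'.mono fun z hz => hKM _ hz
  obtain ⟨φ, hφ, hcut⟩ := h (fun c z => inner ℝ (b c) (u z)) (fun c z => inner ℝ (b c) (u' z))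
    (meas u hu) (bound u hKu) (meas u' hu') (bound u' hKu') (fun F c => by
      rw [← inner_hilbertTprod_homDensity F hu hbu (fun e => b (c e)),
        ← inner_hilbertTprod_homDensity F hu' hbu' (fun e => b (c e)), ← inner_sub_right]
      -- A mixed scalar density is the inner product of the tensorized density with a unit
      -- elementary tensor.
      refine abs_inner_le_of_norm_le ?_ (hmom F)
      rw [norm_hilbertTprod]
      simp [hb1])
  have hφ2 := hφ.prodMap_self
  refine (cutDist_le_cutNorm u u' φ.bijective hφ).trans (cutNorm_le fun S T hS hT => ?_)
  set v : unitInterval × unitInterval → H := fun z => u z - u' (φ z.1, φ z.2) with hv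
  have hui : Integrable u volume := Integrable.of_bound hu M hbu
  have hui' : Integrable u' volume := Integrable.of_bound hu' M hbu'
  have hvi : Integrable v volume := hui.sub (hφ2.integrable_comp_of_integrable hui')
  have hK2 : ∀ᵐ z : unitInterval × unitInterval, u' (φ z.1, φ z.2) ∈ K :=
    hφ2.quasiMeasurePreserving.ae hKu'
  let P : H → H := fun x => ∑ c, (inner ℝ (b c) x : ℝ) • b c
  have hci : ∀ c, Integrable (fun z => (inner ℝ (b c) (v z) : ℝ)) volume := fun c =>
    hvi.const_inner (b c)
  have hPi : Integrable (fun z => P (v z)) volume :=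
    integrable_finsetSum _ fun c _ => (hci c).smul_const _
  have hvP : ∀ᵐ z, ‖v z - P (v z)‖ ≤ ε / 2 := by
    filter_upwards [hKu, hK2] with z h1 h2
    have e : v z - P (v z) = (u z - P (u z)) - (u' (φ z.1, φ z.2) - P (u' (φ z.1, φ z.2))) := by
      simp only [hv, P, inner_sub_right, sub_smul, Finset.sum_sub_distrib]
      abel
    rw [e]
    refine (norm_sub_le _ _).trans ?_
    have a1 := hbK _ h1
    have a2 := hbK _ h2
    simp only [P]
    linarith
  have e : ∫ z in S ×ˢ T, v z = (∫ z in S ×ˢ T, (v z - P (v z))) + ∫ z in S ×ˢ T, P (v z) := by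
    rw [integral_sub hvi.integrableOn hPi.integrableOn, sub_add_cancel]
  have n1 : ‖∫ z in S ×ˢ T, (v z - P (v z))‖ ≤ ε / 2 := by
    refine (norm_integral_le_of_norm_le_const (ae_restrict_of_ae hvP)).trans ?_
    refine mul_le_of_le_one_right (by positivity) ?_
    rw [measureReal_restrict_apply_univ]
    exact measureReal_le_one
  have n2 : ‖∫ z in S ×ˢ T, P (v z)‖ ≤ ε / 2 := by
    simp only [P]
    rw [integral_finsetSum _ fun c _ => ((hci c).smul_const _).integrableOn]
    refine (norm_sum_le _ _).trans ?_
    have hc : ∀ c, ‖∫ z in S ×ˢ T, (inner ℝ (b c) (v z) : ℝ) • b c‖ ≤ ε / (2 * (d + 1)) := by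
      intro c
      rw [integral_smul_const, norm_smul, hb1, mul_one, Real.norm_eq_abs]
      have := hcut c S T hS hT
      simpa only [hv, inner_sub_right] using this
    refine (Finset.sum_le_sum fun c _ => hc c).trans ?_
    rw [Finset.sum_const, Finset.card_univ, Fintype.card_fin, nsmul_eq_mul, ← mul_div_assoc,
      div_le_iff₀ (by positivity)]
    nlinarith
  rw [e]
  refine (norm_add_le _ _).trans ?_
  linarith

end CompactValues

/-- Lets convergence graph by graph become uniform over all graphs on `Fin k`. -/
instance OrientedSimpleGraph.finite (V : Type*) [Finite V] : Finite (OrientedSimpleGraph V) :=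
  Finite.of_injective OrientedSimpleGraph.edges fun F G h => by
    cases F; cases G; cases h; rfl

theorem ae_mem_closure_image_closedBall {B H : Type*} [NormedAddCommGroup B] [NormedSpace ℝ B]
    [NormedAddCommGroup H] [InnerProductSpace ℝ H] (ι : B →L[ℝ] H)
    {w : unitInterval × unitInterval → B} {R : ℝ≥0} (h : eLpNorm w ∞ volume ≤ R) :
    ∀ᵐ z, ι (w z) ∈ closure (ι '' Metric.closedBall 0 R) := by
  rw [eLpNorm_exponent_top] at h
  filter_upwards [ae_le_eLpNormEssSup (f := w) (μ := volume)] with z hz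
  refine subset_closure ⟨w z, ?_, rfl⟩
  rw [mem_closedBall_zero_iff]
  have := hz.trans h
  rwa [enorm_le_coe] at this

end

theorem lemma2p15 {B H : Type*}
    [NormedAddCommGroup B] [NormedSpace ℝ B] [CompleteSpace B]
    [NormedAddCommGroup H] [InnerProductSpace ℝ H] [CompleteSpace H]
    [TopologicalSpace.SeparableSpace H]
    (ι : B →L[ℝ] H) (hι : Function.Injective ι) (hcpt : IsCompactOperator ι)
    (w : ℕ → unitInterval × unitInterval → B) (w' : unitInterval × unitInterval → B)
    (hw : ∀ n, IsLinftyKernel ι (w n)) (hw' : IsLinftyKernel ι w')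
    (wmax : ℝ≥0) (hbound : ⨆ n, eLpNorm (w n) ∞ volume < wmax) :
    (∀ (V : Type) [Fintype V] (F : OrientedSimpleGraph V),
        Tendsto (fun n => ‖homDensity F (fun z => ι (w n z)) - homDensity F (fun z => ι (w' z))‖)
          atTop (𝓝 0)) ↔
      Tendsto (fun n => cutDist (fun z => ι (w n z)) (fun z => ι (w' z))) atTop (𝓝 0) := by
  obtain ⟨R', hR'⟩ : ∃ R' : ℝ≥0, eLpNorm w' ∞ volume ≤ R' :=
    ⟨(eLpNorm w' ∞ volume).toNNReal, (ENNReal.coe_toNNReal hw'.2.ne).ge⟩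
  -- The radius must also cover the limit kernel, which `wmax` does not control.
  set R : ℝ≥0 := max wmax R'
  set K : Set H := closure (ι '' Metric.closedBall 0 R)
  have hK : IsCompact K := hcpt.isCompact_closure_image_closedBall (R : ℝ)
  have hKw : ∀ n, ∀ᵐ z, ι (w n z) ∈ K := fun n => ae_mem_closure_image_closedBall ι
    ((le_iSup (fun n => eLpNorm (w n) ∞ volume) n).trans
      (hbound.le.trans (ENNReal.coe_le_coe.2 (le_max_left _ _))))
  have hKw' : ∀ᵐ z, ι (w' z) ∈ K := ae_mem_closure_image_closedBall ι
    (hR'.trans (ENNReal.coe_le_coe.2 (le_max_right _ _)))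
  constructor
  · intro h
    refine Metric.tendsto_atTop.2 fun ε hε => ?_
    obtain ⟨k, η, hη, hk⟩ := exists_cutDist_le hK (half_pos hε)
    have hev : ∀ᶠ n in atTop, ∀ F : OrientedSimpleGraph (Fin k),
        ‖homDensity F (fun z => ι (w n z)) - homDensity F (fun z => ι (w' z))‖ ≤ η := by
      rw [eventually_all]
      intro F
      exact (h (Fin k) F).eventually_le_const hη
    obtain ⟨n₀, hn₀⟩ := eventually_atTop.1 hev
    refine ⟨n₀, fun n hn => ?_⟩
    have := hk _ _ (hw n).1 hw'.1 (hKw n) hKw' (hn₀ n hn)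
    rw [Real.dist_eq, sub_zero, abs_of_nonneg (cutDist_nonneg _ _)]
    linarith
  · intro h V _ F
    refine Metric.tendsto_atTop.2 fun ε hε => ?_
    obtain ⟨δ, hδ, hF⟩ := exists_norm_homDensity_sub_le F hK (half_pos hε)
    obtain ⟨n₀, hn₀⟩ := eventually_atTop.1 (h.eventually_lt_const hδ)
    refine ⟨n₀, fun n hn => ?_⟩
    -- Rearranging the limit kernel changes neither its densities nor its compact set of values, so
    -- the counting lemma may be applied to the rearranged kernel.
    obtain ⟨φ, hφ, hcut⟩ := exists_cutNorm_lt_of_cutDist_lt (hn₀ n hn)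
    have hφ2 := hφ.prodMap_self
    have := hF _ (fun z => ι (w' (φ z.1, φ z.2))) (hw n).1 (hw'.1.comp_measurePreserving hφ2)
      (hKw n) (hφ2.quasiMeasurePreserving.ae hKw') hcut.le
    rw [homDensity_comp F hw'.1 hφ] at this
    rw [Real.dist_eq, sub_zero, abs_of_nonneg (norm_nonneg _)]
    linarith
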